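/- Let $J^k$ be the space of $k$-jets of sections $(u(t,x,y),v(t,x,y))$ of the trivial bundle $\mathbb R^3(t,x,y)\times\mathbb R^2(u,v)\to\mathbb R^3(t,x,y)$. Consider the modified Manakov–Santini system $$F_1=(u_t+uu_y+vu_x)_x-(u_y)_y=0,\qquad F_2=(v_t+vv_x-uv_y)_x-(v_y-2uv_x)_y=0,$$ and let $\mathcal E_k\subset J^k$ be the zero set of all total derivatives of $F_1,F_2$ of order at most $k-2$ (so $\mathcal E_0=J^0$, $\mathcal E_1=J^1$). Let $\mathcal G_{\mathrm{top}}$ be the Lie pseudogroup of the transformations $$\begin{aligned} t&\mapsto D,\qquad x\mapsto E^2x+EE'y^2+Cy+A,\qquad y\mapsto \sqrt{D'}\,E\,y+B,\\ u&\mapsto \tfrac{E}{\sqrt{D'}}u-\tfrac{y}{E^2}\tfrac{d}{dt}\tfrac{E^3}{\sqrt{D'}}+\tfrac{B'}{D'}-\tfrac{2C}{E\sqrt{D'}},\\ v&\mapsto \tfrac{E^2}{D'}v+\tfrac{C+2EE'y}{D'}u+\tfrac{EE''-3E'^2}{D'}y^2+\tfrac{E^4}{D'}\tfrac{d}{dt}\Big(\tfrac{C}{E^4}\Big)y+\tfrac{2EE'}{D'}x+\tfrac{E^2A'-C^2}{D'E^2},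 \end{aligned}$$ where $D=D(t)$ is an orientation-preserving local diffeomorphism of $\mathbb R$ and $A,B,C,E$ are smooth functions of $t$ with the same domain, $E>0$. Let $\mathcal G$ be the pseudogroup generated by $\mathcal G_{\mathrm{top}}$ and the reflections $(t,x,y)\mapsto(-t,-x,-y)$ and $(y,u)\mapsto(-y,-u)$ (the remaining coordinates being fixed); it acts on $\mathcal E_k$ by prolongation. A rational differential invariant of order $\le k$ is a rational function on $\mathcal E_k$ that is constant, where defined, on the orbits of $\mathcal G$ on $\mathcal E_k$. Let $s_k$ be the number of independent differential invariants of order $\le k$, i.e. the transcendence degree over $\mathbb R$ of the field of rational differential invariants of order $\le k$, and let $h_k=s_k-s_{k-1}$ (with $s_{-1}=0$) be the number of invariants of pure order $k$. Then all $s_k$ are finite and: - $s_0=s_1=0$ and $s_k=2k^2-k-3$ for $k\ge2$; - $h_0=h_1=0$, $h_2=3$ and $h_k=4k-3$ for $k>2$; - the Hilbert polynomial, i.e. the unique polynomial $H$ with $h_k=H(k)$ for all sufficiently large $k$, is $H(k)=4k-3$; - the Poincaré function is $$P(z)=\sum_{k=0}^\infty h_kz^k=\frac{(3+3z-2z^2)z^2}{(1-z)^2},$$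 both as an identity of formal power series and as a convergent sum for all complex $z$ with $|z|<1$. -/

import Mathlib

open scoped ContDiff

namespace ManakovSantini

noncomputable section

/-! Coordinates `0, 1, 2` on `M = ℝ³` are `t, x, y`; the dependent variables `0, 1` are `u, v`. -/

/-- Coordinates on the infinite jet space of `ℝ³ × ℝ² → ℝ³`: `inl i` is the `i`-th base
coordinate, and `inr (a, σ)` is the partial derivative of the `a`-th dependent variable
with multi-index `σ` (so `σ = 0` is the dependent variable itself). -/
abbrev JetCoord : Type := Fin 3 ⊕ (Fin 2 × (Fin 3 → ℕ))

/-- The order of a jet coordinate. -/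
def jetOrder : JetCoord → ℕ
  | Sum.inl _ => 0
  | Sum.inr (_, σ) => ∑ i, σ i

/-- Coordinates on the space `J^k` of `k`-jets. -/
abbrev JetCoordLE (k : ℕ) : Type := {c : JetCoord // jetOrder c ≤ k}

/-- The space `J^k` of `k`-jets of sections of `ℝ³ × ℝ² → ℝ³`. -/
abbrev JetSpace (k : ℕ) : Type := JetCoordLE k → ℝ

/-! ### The modified Manakov–Santini system and its prolongations -/

/-- Differential polynomials in `u, v` (with coefficients polynomial in `t, x, y`). -/
abbrev DiffPoly : Type := MvPolynomial JetCoord ℝ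

/-- The total derivative with respect to the `i`-th base coordinate. -/
def totalDeriv (i : Fin 3) : Derivation ℝ DiffPoly DiffPoly :=
  MvPolynomial.mkDerivation ℝ fun c =>
    match c with
    | Sum.inl j => if j = i then 1 else 0
    | Sum.inr (a, σ) => MvPolynomial.X (Sum.inr (a, σ + Pi.single i 1))

/-- The iterated total derivative `D_t^{σ 0} D_x^{σ 1} D_y^{σ 2}`. -/
def iterTotalDeriv (σ : Fin 3 → ℕ) (F : DiffPoly) : DiffPoly :=
  (totalDeriv 0)^[σ 0] ((totalDeriv 1)^[σ 1] ((totalDeriv 2)^[σ 2] F))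

/-- The dependent variable `u` as a differential polynomial. -/
def uVar : DiffPoly := MvPolynomial.X (Sum.inr (0, 0))

/-- The dependent variable `v` as a differential polynomial. -/
def vVar : DiffPoly := MvPolynomial.X (Sum.inr (1, 0))

/-- The left-hand sides of the modified Manakov–Santini system:
`F₁ = (u_t + u u_y + v u_x)_x - (u_y)_y` and `F₂ = (v_t + v v_x - u v_y)_x - (v_y - 2 u v_x)_y`. -/
def msEquation : Fin 2 → DiffPoly :=
  ![totalDeriv 1 (totalDeriv 0 uVar + uVar * totalDeriv 2 uVar + vVar * totalDeriv 1 uVar)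
      - totalDeriv 2 (totalDeriv 2 uVar),
    totalDeriv 1 (totalDeriv 0 vVar + vVar * totalDeriv 1 vVar - uVar * totalDeriv 2 vVar)
      - totalDeriv 2 (totalDeriv 2 vVar - 2 * uVar * totalDeriv 1 vVar)]

/-- Evaluation point on the infinite jet space extending a `k`-jet. The coordinates of order
`> k` are set to `0`; this value is irrelevant, as only polynomials of order `≤ k` are evaluated. -/
def extendJet {k : ℕ} (θ : JetSpace k) : JetCoord → ℝ := fun c =>
  if h : jetOrder c ≤ k then θ ⟨c, h⟩ else 0

/-- The equation manifold `𝓔_k ⊆ J^k`: the zero set of all total derivatives of order `≤ k - 2` of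
the two equations (so `𝓔_0 = J^0`, `𝓔_1 = J^1`, and `𝓔_2` is the system itself). -/
def equationManifold (k : ℕ) : Set (JetSpace k) :=
  {θ | ∀ (a : Fin 2) (σ : Fin 3 → ℕ), (∑ i, σ i) + 2 ≤ k →
    MvPolynomial.eval (extendJet θ) (iterTotalDeriv σ (msEquation a)) = 0}

/-! ### Jets of sections -/

/-- The partial derivative with respect to the `i`-th coordinate. -/
def partialDeriv (i : Fin 3) (f : (Fin 3 → ℝ) → ℝ) : (Fin 3 → ℝ) → ℝ :=
  fun p => fderiv ℝ f p (Pi.single i 1)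

/-- The iterated partial derivative `∂_t^{σ 0} ∂_x^{σ 1} ∂_y^{σ 2}`. -/
def iterPartialDeriv (σ : Fin 3 → ℕ) (f : (Fin 3 → ℝ) → ℝ) : (Fin 3 → ℝ) → ℝ :=
  (partialDeriv 0)^[σ 0] ((partialDeriv 1)^[σ 1] ((partialDeriv 2)^[σ 2] f))

/-- The `k`-jet at `p` of the section `s = (u, v)`. -/
def jet (k : ℕ) (s : (Fin 3 → ℝ) → (Fin 2 → ℝ)) (p : Fin 3 → ℝ) : JetSpace k := fun c =>
  match c.1 with
  | Sum.inl i => p i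
  | Sum.inr (a, σ) => iterPartialDeriv σ (fun q => s q a) p

/-! ### The symmetry pseudogroup -/

/-- A fibre-preserving local transformation of `ℝ³ × ℝ²`, defined over `source ⊆ ℝ³`,
`(p, w) ↦ (base p, fibre p w)`. -/
structure LocalTransformation where
  source : Set (Fin 3 → ℝ)
  base : (Fin 3 → ℝ) → (Fin 3 → ℝ)
  fibre : (Fin 3 → ℝ) → (Fin 2 → ℝ) → (Fin 2 → ℝ)

/-- Functional parameters of the pseudogroup `𝒢_top`: an orientation-preserving local
diffeomorphism `D` of `ℝ` and smooth functions `A, B, C, E` with the same domain, `E > 0`. -/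
structure TopParameters where
  dom : Set ℝ
  isOpen_dom : IsOpen dom
  D : ℝ → ℝ
  A : ℝ → ℝ
  B : ℝ → ℝ
  C : ℝ → ℝ
  E : ℝ → ℝ
  smooth_D : ContDiffOn ℝ ∞ D dom
  smooth_A : ContDiffOn ℝ ∞ A dom
  smooth_B : ContDiffOn ℝ ∞ B dom
  smooth_C : ContDiffOn ℝ ∞ C dom
  smooth_E : ContDiffOn ℝ ∞ E dom
  injOn_D : Set.InjOn D dom
  deriv_D_pos : ∀ t ∈ dom, 0 < deriv D t
  E_pos : ∀ t ∈ dom, 0 < E t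

/-- The transformation of `ℝ³ × ℝ²` in `𝒢_top` with given functional parameters. -/
def TopParameters.toTransformation (g : TopParameters) : LocalTransformation where
  source := {p | p 0 ∈ g.dom}
  base := fun p =>
    let t := p 0
    let x := p 1
    let y := p 2
    ![g.D t,
      g.E t ^ 2 * x + g.E t * deriv g.E t * y ^ 2 + g.C t * y + g.A t,
      √(deriv g.D t) * g.E t * y + g.B t]
  fibre := fun p w =>
    let t := p 0
    let x := p 1
    let y := p 2
    let u := w 0
    let v := w 1
    ![g.E t / √(deriv g.D t) * u
        - y / g.E t ^ 2 * deriv (fun τ => g.E τ ^ 3 / √(deriv g.D τ)) t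
        + deriv g.B t / deriv g.D t
        - 2 * g.C t / (g.E t * √(deriv g.D t)),
      g.E t ^ 2 / deriv g.D t * v
        + (g.C t + 2 * g.E t * deriv g.E t * y) / deriv g.D t * u
        + (g.E t * deriv (deriv g.E) t - 3 * deriv g.E t ^ 2) / deriv g.D t * y ^ 2
        + g.E t ^ 4 / deriv g.D t * deriv (fun τ => g.C τ / g.E τ ^ 4) t * y
        + 2 * g.E t * deriv g.E t / deriv g.D t * x
        + (g.E t ^ 2 * deriv g.A t - g.C t ^ 2) / (deriv g.D t * g.E t ^ 2)]

/-- The reflections `(t, x, y, u, v) ↦ (ε t, ε x, ε δ y, δ u, v)`, `ε, δ ∈ {1, -1}`. They form the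
group `ℤ/2 × ℤ/2` generated by `(t, x, y) ↦ (-t, -x, -y)` and `(y, u) ↦ (-y, -u)`. -/
def reflection (ε δ : ℤˣ) : LocalTransformation where
  source := Set.univ
  base := fun p => ![((ε : ℤ) : ℝ) * p 0, ((ε : ℤ) : ℝ) * p 1, ((ε : ℤ) : ℝ) * ((δ : ℤ) : ℝ) * p 2]
  fibre := fun _ w => ![((δ : ℤ) : ℝ) * w 0, w 1]

/-- The composition `Ψ ∘ Φ`, where it is defined. -/
def LocalTransformation.comp (Ψ Φ : LocalTransformation) : LocalTransformation where
  source := {p | p ∈ Φ.source ∧ Φ.base p ∈ Ψ.source}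
  base := fun p => Ψ.base (Φ.base p)
  fibre := fun p w => Ψ.fibre (Φ.base p) (Φ.fibre p w)

/-- The symmetry pseudogroup `𝒢` (the Zariski closure of `𝒢_top`): `𝒢_top` is normal in `𝒢`, and
the quotient `ℤ/2 × ℤ/2` is represented by the reflections. -/
def symmetryPseudogroup : Set LocalTransformation :=
  {Φ | ∃ (ε δ : ℤˣ) (g : TopParameters), Φ = (reflection ε δ).comp g.toTransformation}

/-- `Φ^{(k)} θ = θ'` for the `k`-th prolongation of `Φ`: there is a smooth section germ `s` at a
point `p` with `k`-jet `θ`, whose graph is mapped by `Φ` near `p` onto the graph of a smooth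
section germ `s'` with `k`-jet `θ'` at the image of `p`. -/
def ProlongedMaps (k : ℕ) (Φ : LocalTransformation) (θ θ' : JetSpace k) : Prop :=
  ∃ (p : Fin 3 → ℝ) (s s' : (Fin 3 → ℝ) → (Fin 2 → ℝ)),
    p ∈ Φ.source ∧ ContDiffAt ℝ ∞ s p ∧ ContDiffAt ℝ ∞ s' (Φ.base p) ∧
    (∀ᶠ q in nhds p, s' (Φ.base q) = Φ.fibre q (s q)) ∧
    jet k s p = θ ∧ jet k s' (Φ.base p) = θ'

/-! ### Rational differential invariants -/

/-- The ring of polynomial functions on `𝓔_k`. -/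
abbrev CoordinateRing (k : ℕ) : Type :=
  MvPolynomial (JetCoordLE k) ℝ ⧸ MvPolynomial.vanishingIdeal ℝ (equationManifold k)

/-- The restriction of a polynomial on `J^k` to `𝓔_k`. -/
abbrev restrict (k : ℕ) : MvPolynomial (JetCoordLE k) ℝ →+* CoordinateRing k :=
  Ideal.Quotient.mk (MvPolynomial.vanishingIdeal ℝ (equationManifold k))

/-- Rational functions on `𝓔_k`. -/
abbrev RationalFunctions (k : ℕ) : Type := FractionRing (CoordinateRing k)

/-- A rational function `f` on `𝓔_k` is a differential invariant of order `≤ k` if it is constant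
on the orbits of `𝒢` on `𝓔_k`, where defined: `f` is a fraction `P / Q` that takes the same value
at `θ` and at `Φ^{(k)} θ`, for all `Φ ∈ 𝒢`, whenever `Q` vanishes at neither. -/
def IsDifferentialInvariant (k : ℕ) (f : RationalFunctions k) : Prop :=
  ∃ P Q : MvPolynomial (JetCoordLE k) ℝ,
    restrict k Q ∈ nonZeroDivisors (CoordinateRing k) ∧
    f * algebraMap (CoordinateRing k) (RationalFunctions k) (restrict k Q) =
      algebraMap (CoordinateRing k) (RationalFunctions k) (restrict k P) ∧
    ∀ Φ ∈ symmetryPseudogroup, ∀ θ ∈ equationManifold k, ∀ θ' ∈ equationManifold k,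
      ProlongedMaps k Φ θ θ' →
      MvPolynomial.eval θ Q ≠ 0 → MvPolynomial.eval θ' Q ≠ 0 →
      MvPolynomial.eval θ P / MvPolynomial.eval θ Q =
        MvPolynomial.eval θ' P / MvPolynomial.eval θ' Q

/-- The `ℝ`-algebra of rational differential invariants of order `≤ k`. -/
def differentialInvariants (k : ℕ) : Subalgebra ℝ (RationalFunctions k) where
  carrier := {f | IsDifferentialInvariant k f}
  mul_mem' := by
    rintro f f' ⟨P, Q, hQ, hf, hI⟩ ⟨P', Q', hQ', hf', hI'⟩
    refine ⟨P * P', Q * Q', ?_, ?_, ?_⟩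
    · rw [map_mul]; exact mul_mem hQ hQ'
    · simp only [map_mul]
      rw [← hf, ← hf']; ring
    · intro Φ hΦ θ hθ θ' hθ' h h1 h2
      simp only [map_mul] at h1 h2 ⊢
      rw [mul_div_mul_comm, mul_div_mul_comm,
        hI Φ hΦ θ hθ θ' hθ' h (left_ne_zero_of_mul h1) (left_ne_zero_of_mul h2),
        hI' Φ hΦ θ hθ θ' hθ' h (right_ne_zero_of_mul h1) (right_ne_zero_of_mul h2)]
  add_mem' := by
    rintro f f' ⟨P, Q, hQ, hf, hI⟩ ⟨P', Q', hQ', hf', hI'⟩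
    refine ⟨P * Q' + Q * P', Q * Q', ?_, ?_, ?_⟩
    · rw [map_mul]; exact mul_mem hQ hQ'
    · simp only [map_mul, map_add]
      rw [← hf, ← hf']; ring
    · intro Φ hΦ θ hθ θ' hθ' h h1 h2
      simp only [map_mul, map_add] at h1 h2 ⊢
      rw [← div_add_div _ _ (left_ne_zero_of_mul h1) (right_ne_zero_of_mul h1),
        ← div_add_div _ _ (left_ne_zero_of_mul h2) (right_ne_zero_of_mul h2),
        hI Φ hΦ θ hθ θ' hθ' h (left_ne_zero_of_mul h1) (left_ne_zero_of_mul h2),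
        hI' Φ hΦ θ hθ θ' hθ' h (right_ne_zero_of_mul h1) (right_ne_zero_of_mul h2)]
  algebraMap_mem' := by
    intro r
    refine ⟨MvPolynomial.C r, 1, ?_, ?_, ?_⟩
    · rw [map_one]; exact one_mem _
    · rw [map_one, map_one, mul_one]
      rfl
    · intro Φ hΦ θ hθ θ' hθ' h h1 h2
      simp

/-- The number of independent differential invariants of order `≤ k`, as a cardinal: the
transcendence degree over `ℝ` of the rational differential invariants of order `≤ k`. -/
def invariantRank (k : ℕ) : Cardinal := Algebra.trdeg ℝ (differentialInvariants k)

/-- The number `s_k` of independent differential invariants of order `≤ k`, as a natural number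
(`0` if infinite). -/
def invariantCount (k : ℕ) : ℕ := Cardinal.toNat (invariantRank k)

/-- The number `h_k = s_k - s_{k-1}` of invariants of pure order `k`, where `s_{-1} = 0`. -/
def pureInvariantCount : ℕ → ℤ
  | 0 => invariantCount 0
  | k + 1 => (invariantCount (k + 1) : ℤ) - invariantCount k

end

end ManakovSantini

/-! The number s_k is the dimension of the equation manifold minus the dimension of a generic orbit.
Both equations can be solved for u_yy and v_yy, and their total derivatives then eliminate every
derivative with two or more y's (`extendJet_eq_of_mem`, `pointOfFree_mem`). Hence 𝓔_k is a graph
over 3 + 2(k+1)^2 free coordinates, and its rational functions embed in a rational function field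
through `rationalChart`. For k ≥ 2 a generic orbit has dimension 5k + 8: three for the base point,
and five for the Taylor coefficients of A, B, C, D', E in each degree from 0 to k. The difference is
2k^2 - k - 3.

The orbit dimension enters through a splitting of the free coordinates. Each group parameter is
assigned a coordinate it can normalize, its `pivot`; the non-pivot coordinates of order at most k
form `InvariantCoord k`, and the transcendence degree is shown to be exactly their number. For k ≤ 1
every free coordinate is a pivot, so there are no invariants.

Lower bound (`mk_invariantCoord_le`). The functions u_x, u_xx, v_xx + u_xy and u_xx (u_yy + v_xy) -
u_xy (u_xy + v_xx) are multiplied by weights under the pseudogroup, and three covariant derivations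
`opX`, `opY`, `opT` preserve this property. With respect to a suitable ranking of the coordinates,
every non-pivot coordinate is the leading coordinate of a relative invariant obtained in this way
(`hasInvariant_of_notMem_range_pivot`). Division by u_x^i u_xx^l of equal weight gives an absolute
invariant. The denominator contains only pivots, so the Jacobian in the non-pivot directions is
triangular and the invariants are algebraically independent.

Upper bound (`invariantRank_le`). The differentials of algebraically independent invariants are
linearly independent at a generic point (`linearIndependent_jacobian`,
`exists_eval_linearIndependent`) and annihilate the tangent vectors of orbits. One curve in the
pseudogroup is constructed for each group parameter. At points with u_x and u_xx nonzero, the pivot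
components of the velocities of the resulting orbit curves form a triangular matrix with nonzero
diagonal (`exists_curve`). Linear algebra then bounds the number of invariants by the number of free
coordinates minus the number of pivots.

Both bounds need the prolonged action in all orders. It is handled algebraically: on germs of smooth
functions a transformation induces a `PointMap` between differential rings, so that transformation
laws are polynomial identities. Infinitesimally, the variation of a function is its characteristic
plus a transport term, and total derivatives then act on the characteristic alone
(`Variation.Prolongs.opD`). -/

namespace ManakovSantini

noncomputable section

/-! ### Derivations of fraction fields and the Jacobian criterion -/

section FractionDerivation

variable {A : Type*} [CommRing A] [Algebra ℝ A]

/-- The ring homomorphism `a ↦ a + ε D a` into the dual numbers over the fraction field. -/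
def dualHom (K : Type*) [Field K] [Algebra A K] [Algebra ℝ K] [IsScalarTower ℝ A K]
    (D : Derivation ℝ A A) : A →+* TrivSqZeroExt K K where
  toFun a := (algebraMap A K a, algebraMap A K (D a))
  map_one' := TrivSqZeroExt.ext (map_one _) (by
    change algebraMap A K (D 1) = 0
    rw [D.map_one_eq_zero, map_zero])
  map_zero' := TrivSqZeroExt.ext (map_zero _) (by
    change algebraMap A K (D 0) = 0
    rw [map_zero, map_zero])
  map_add' a b := TrivSqZeroExt.ext (map_add _ _ _) (by
    change algebraMap A K (D (a + b)) = algebraMap A K (D a) + algebraMap A K (D b)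
    rw [map_add, map_add])
  map_mul' a b := TrivSqZeroExt.ext (map_mul _ _ _) (by
    change algebraMap A K (D (a * b)) =
      algebraMap A K a * algebraMap A K (D b) + algebraMap A K (D a) * algebraMap A K b
    rw [D.leibniz, map_add, smul_eq_mul, smul_eq_mul, map_mul, map_mul]
    ring)

variable {K : Type*} [Field K] [Algebra A K] [Algebra ℝ K] [IsScalarTower ℝ A K]

theorem fst_dualHom (D : Derivation ℝ A A) (a : A) : (dualHom K D a).fst = algebraMap A K a := rfl

theorem snd_dualHom (D : Derivation ℝ A A) (a : A) :
    (dualHom K D a).snd = algebraMap A K (D a) := rfl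

variable [IsDomain A] [IsFractionRing A K]

theorem isUnit_dualHom (D : Derivation ℝ A A) (a : nonZeroDivisors A) :
    IsUnit (dualHom K D a) := by
  rw [TrivSqZeroExt.isUnit_iff_isUnit_fst]
  simp [fst_dualHom]

/-- The extension of `dualHom` to the fraction field. -/
def dualLift (K : Type*) [Field K] [Algebra A K] [Algebra ℝ K] [IsScalarTower ℝ A K]
    [IsFractionRing A K] (D : Derivation ℝ A A) : K →+* TrivSqZeroExt K K :=
  IsLocalization.lift (M := nonZeroDivisors A) (isUnit_dualHom (K := K) D)

theorem dualLift_algebraMap (D : Derivation ℝ A A) (a : A) :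
    dualLift K D (algebraMap A K a) = dualHom K D a :=
  IsLocalization.lift_eq _ a

theorem fst_dualLift (D : Derivation ℝ A A) (x : K) : (dualLift K D x).fst = x := by
  have : ((TrivSqZeroExt.fstHom K K K : TrivSqZeroExt K K →+* K).comp (dualLift K D)) =
      RingHom.id K := by
    apply IsLocalization.ringHom_ext (nonZeroDivisors A)
    ext a
    simp [dualLift_algebraMap, fst_dualHom]
  exact congrArg (fun f : K →+* K => f x) this

/-- The extension of a derivation to the fraction field. -/
def fracDerivation (K : Type*) [Field K] [Algebra A K] [Algebra ℝ K] [IsScalarTower ℝ A K]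
    [IsFractionRing A K] (D : Derivation ℝ A A) : Derivation ℝ K K :=
  Derivation.mk'
    { toFun := fun x => (dualLift K D x).snd
      map_add' := fun x y => by simp
      map_smul' := fun r x => by
        have h : dualLift K D (algebraMap ℝ K r) = TrivSqZeroExt.inl (algebraMap ℝ K r) := by
          rw [IsScalarTower.algebraMap_apply ℝ A K, dualLift_algebraMap]
          refine TrivSqZeroExt.ext ?_ ?_
          · rw [fst_dualHom, TrivSqZeroExt.fst_inl]
          · rw [snd_dualHom, TrivSqZeroExt.snd_inl, D.map_algebraMap, map_zero]
        rw [Algebra.smul_def, map_mul, h]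
        simp [Algebra.smul_def] }
    (fun x y => by
      simp [fst_dualLift, mul_comm])

theorem fracDerivation_algebraMap (D : Derivation ℝ A A) (a : A) :
    fracDerivation K D (algebraMap A K a) = algebraMap A K (D a) := by
  change (dualLift K D (algebraMap A K a)).snd = _
  rw [dualLift_algebraMap, snd_dualHom]

end FractionDerivation

/-- Applying D to p(x) = 0 gives p'(x) D x = 0. As S need not be a field, a descent on the degree
replaces the minimal polynomial: either D x = 0, or p' is a relation of smaller degree, nonzero in
characteristic zero. -/
theorem derivation_eq_zero_of_isAlgebraic {K : Type*} [Field K] [Algebra ℝ K]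
    (D : Derivation ℝ K K) (S : Subalgebra ℝ K) (hS : ∀ s ∈ S, D s = 0) {x : K}
    (hx : IsAlgebraic S x) : D x = 0 := by
  have : CharZero K := charZero_of_injective_algebraMap (algebraMap ℝ K).injective
  have : IsAddTorsionFree S := Function.Injective.isAddTorsionFree
    S.val.toLinearMap.toAddMonoidHom Subtype.val_injective
  have hD : ∀ p : Polynomial S, D (Polynomial.aeval x p) =
      Polynomial.aeval x (Polynomial.derivative p) * D x := by
    intro p
    induction p using Polynomial.induction_on' with
    | add p q hp hq => simp [hp, hq, add_mul]
    | monomial n a =>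
      simp only [Polynomial.aeval_monomial, Derivation.leibniz, Derivation.leibniz_pow,
        Polynomial.derivative_monomial, smul_eq_mul, nsmul_eq_mul, map_mul, map_natCast]
      have : D (algebraMap S K a) = 0 := hS _ a.2
      rw [this]; ring
  suffices H : ∀ n : ℕ, ∀ p : Polynomial S, p.natDegree = n → p ≠ 0 →
      Polynomial.aeval x p = 0 → D x = 0 by
    obtain ⟨p, hp, hpx⟩ := hx
    exact H _ p rfl hp hpx
  intro n
  induction n using Nat.strong_induction_on with
  | _ n ih =>
    intro p hn hp hpx
    have h1 := hD p
    rw [hpx, map_zero] at h1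
    rcases mul_eq_zero.mp h1.symm with h | h
    · have hdeg : p.natDegree ≠ 0 := by
        intro h0
        rw [Polynomial.eq_C_of_natDegree_eq_zero h0] at hpx hp
        rw [Polynomial.aeval_C] at hpx
        apply hp
        have : p.coeff 0 = 0 := Subtype.ext hpx
        rw [this, map_zero]
      have hd : Polynomial.derivative p ≠ 0 := fun h0 =>
        hdeg (Polynomial.derivative_eq_zero.mp h0)
      exact ih _ (hn ▸ Polynomial.natDegree_derivative_lt hdeg) _ rfl hd h
    · exact h

/-! ### The Jacobian criterion for algebraic independence of rational functions. -/

section Jacobian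

variable {ι : Type*}

/-- The field of rational functions in finitely many variables. -/
abbrev RatFun (ι : Type*) : Type _ := FractionRing (MvPolynomial ι ℝ)

/-- The partial derivatives on the field of rational functions. -/
def ratDeriv (j : ι) : Derivation ℝ (RatFun ι) (RatFun ι) :=
  fracDerivation (RatFun ι) (MvPolynomial.pderiv j)

theorem ratDeriv_algebraMap (j : ι) (a : MvPolynomial ι ℝ) :
    ratDeriv j (algebraMap _ (RatFun ι) a) = algebraMap _ (RatFun ι) (MvPolynomial.pderiv j a) :=
  fracDerivation_algebraMap _ _

theorem isTranscendenceBasis_ratFun (ι : Type*) :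
    IsTranscendenceBasis ℝ (fun i : ι => algebraMap (MvPolynomial ι ℝ) (RatFun ι)
      (MvPolynomial.X i)) :=
  have := IsLocalization.isAlgebraic (RatFun ι) (nonZeroDivisors (MvPolynomial ι ℝ))
  (IsTranscendenceBasis.mvPolynomial ι ℝ).algebraMap_comp

/-- Extend f to a transcendence basis B, which has as many elements as there are variables. A vector
in the kernel of the square Jacobian matrix of B is a derivation that kills B, hence kills
everything algebraic over ℝ[B], hence kills the variables. So this matrix is invertible, and the
Jacobian of f consists of some of its rows. -/
theorem linearIndependent_jacobian [Fintype ι] {m : Type*} {f : m → RatFun ι}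
    (hf : AlgebraicIndependent ℝ f) :
    LinearIndependent (RatFun ι) (fun i j => ratDeriv j (f i)) := by
  classical
  obtain ⟨B, hfB, hB⟩ := exists_isTranscendenceBasis_superset
    (hf.coe_range : AlgebraicIndependent ℝ ((↑) : Set.range f → RatFun ι))
  have hcard : Cardinal.mk B = Cardinal.mk ι := by
    simpa using hB.lift_cardinalMk_eq (isTranscendenceBasis_ratFun ι)
  have hfin : Finite B := by
    rw [← Cardinal.mk_lt_aleph0_iff, hcard]; exact Cardinal.mk_lt_aleph0
  have : Fintype B := Fintype.ofFinite B
  have hc : Fintype.card B = Fintype.card ι := by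
    rw [Cardinal.mk_fintype, Cardinal.mk_fintype] at hcard
    exact_mod_cast hcard
  let e : ι ≃ B := Fintype.equivOfCardEq hc.symm
  let M : Matrix ι ι (RatFun ι) := fun i j => ratDeriv j (e i : RatFun ι)
  have hM : Function.Injective M.mulVec := by
    rw [← Matrix.coe_mulVecLin, injective_iff_map_eq_zero]
    intro a ha
    -- The kernel vector a, read as the vector field with components a.
    let D : Derivation ℝ (RatFun ι) (RatFun ι) := ∑ j, a j • ratDeriv j
    have hDapp : ∀ x, D x = ∑ j, a j * ratDeriv j x := by
      intro x
      have : (Derivation.coeFnAddMonoidHom D : RatFun ι → RatFun ι) =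
          ∑ j, Derivation.coeFnAddMonoidHom (a j • ratDeriv j) := map_sum _ _ _
      have h := congrFun this x
      rw [Finset.sum_apply] at h
      exact h
    have hDB : ∀ b ∈ B, D b = 0 := by
      intro b hb
      have h : ∑ j, ratDeriv j (e (e.symm ⟨b, hb⟩) : RatFun ι) * a j = 0 :=
        congrFun ha (e.symm ⟨b, hb⟩)
      rw [Equiv.apply_symm_apply] at h
      rw [hDapp, ← h]
      exact Finset.sum_congr rfl fun j _ => mul_comm _ _
    have hDS : ∀ s ∈ Algebra.adjoin ℝ B, D s = 0 := by
      intro s hs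
      induction hs using Algebra.adjoin_induction with
      | mem x hx => exact hDB x hx
      | algebraMap r => exact D.map_algebraMap r
      | add x y _ _ hx hy => rw [map_add, hx, hy, add_zero]
      | mul x y _ _ hx hy => rw [Derivation.leibniz, hx, hy]; simp
    funext j
    have halg : Algebra.IsAlgebraic (Algebra.adjoin ℝ B) (RatFun ι) := by
      have := hB.isAlgebraic
      rwa [Subtype.range_coe] at this
    have := derivation_eq_zero_of_isAlgebraic D _ hDS
      (halg.isAlgebraic (algebraMap (MvPolynomial ι ℝ) (RatFun ι) (MvPolynomial.X j)))
    rw [hDapp, Finset.sum_eq_single j] at this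
    · simpa [ratDeriv_algebraMap] using this
    · intro i _ hij
      simp [ratDeriv_algebraMap, MvPolynomial.pderiv_X_of_ne hij.symm]
    · simp
  have hrows : LinearIndependent (RatFun ι) (fun i => M i) :=
    Matrix.linearIndependent_rows_of_isUnit
      ((Matrix.mulVec_injective_iff_isUnit).mp hM)
  have hinj : Function.Injective fun i : m => e.symm ⟨f i, hfB ⟨i, rfl⟩⟩ := by
    intro i j hij
    have := e.symm.injective hij
    exact hf.injective (congrArg Subtype.val this)
  have := hrows.comp _ hinj
  convert this using 3
  simp [M]

theorem exists_C_of_pderiv_eq_zero {m : Type*} {p : MvPolynomial m ℝ}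
    (h : ∀ i, MvPolynomial.pderiv i p = 0) : ∃ r, p = MvPolynomial.C r := by
  classical
  refine ⟨p.coeff 0, ?_⟩
  ext s
  rw [MvPolynomial.coeff_C]
  split_ifs with hs
  · rw [hs]
  · obtain ⟨i, hi⟩ : ∃ i, s i ≠ 0 := by
      by_contra! hc
      exact hs (Finsupp.ext fun i => (hc i).symm ▸ rfl)
    have h1 := congrArg (MvPolynomial.coeff (s - Finsupp.single i 1)) (h i)
    have hle : Finsupp.single i 1 ≤ s := by
      rw [Finsupp.single_le_iff]; omega
    rw [MvPolynomial.coeff_pderiv, tsub_add_cancel_of_le hle, MvPolynomial.coeff_zero] at h1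
    rcases mul_eq_zero.mp h1 with h2 | h2
    · exact h2
    · exact absurd h2 (by positivity)

theorem totalDegree_pderiv_lt {m : Type*} {p : MvPolynomial m ℝ} (i : m)
    (h : MvPolynomial.pderiv i p ≠ 0) : (MvPolynomial.pderiv i p).totalDegree < p.totalDegree := by
  classical
  have hp : 0 < p.totalDegree := by
    rw [Nat.pos_iff_ne_zero]
    intro h0
    rw [MvPolynomial.totalDegree_eq_zero_iff_eq_C.mp h0, MvPolynomial.pderiv_C] at h
    exact h rfl
  refine (Finset.sup_lt_iff hp).mpr ?_
  intro s hs
  rw [MvPolynomial.mem_support_iff, MvPolynomial.coeff_pderiv] at hs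
  have := MvPolynomial.le_totalDegree (MvPolynomial.mem_support_iff.mpr (left_ne_zero_of_mul hs))
  rw [Finsupp.sum_add_index' (by simp) (by simp)] at this
  simp at this
  omega

theorem derivation_aeval {m K : Type*} [Fintype m] [Field K] [Algebra ℝ K]
    (D : Derivation ℝ K K) (f : m → K) (p : MvPolynomial m ℝ) :
    D (MvPolynomial.aeval f p) =
      ∑ i, MvPolynomial.aeval f (MvPolynomial.pderiv i p) * D (f i) := by
  classical
  induction p using MvPolynomial.induction_on with
  | C a => simp
  | add p q hp hq => simp [hp, hq, add_mul, Finset.sum_add_distrib]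
  | mul_X p i hp =>
    simp only [map_mul, MvPolynomial.aeval_X, Derivation.leibniz, smul_eq_mul, hp, map_add,
      MvPolynomial.pderiv_X, add_mul, Finset.sum_add_distrib, Finset.mul_sum]
    congr 1
    · rw [Finset.sum_eq_single i] <;> simp +contextual [eq_comm]
    · exact Finset.sum_congr rfl fun j _ => by ring

/-- Differentiating a relation p(f) = 0 gives a linear relation among the rows with coefficients
(∂_i p)(f). These must vanish, so each ∂_i p is a relation of smaller degree and is zero by
induction. Thus p is a constant, and the constant is zero. -/
theorem algebraicIndependent_of_jacobian {m : Type*} [Fintype m] {f : m → RatFun ι}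
    (hf : LinearIndependent (RatFun ι) (fun i j => ratDeriv j (f i))) :
    AlgebraicIndependent ℝ f := by
  rw [algebraicIndependent_iff]
  suffices H : ∀ n : ℕ, ∀ p : MvPolynomial m ℝ, p.totalDegree = n →
      MvPolynomial.aeval f p = 0 → p = 0 from fun p hp => H _ p rfl hp
  intro n
  induction n using Nat.strong_induction_on with
  | _ n ih =>
    intro p hn hp
    have h0 : ∀ i, MvPolynomial.aeval f (MvPolynomial.pderiv i p) = 0 := by
      refine Fintype.linearIndependent_iff.mp hf _ ?_
      funext j
      have := derivation_aeval (ratDeriv j) f p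
      rw [hp, map_zero] at this
      simpa using this.symm
    have h1 : ∀ i, MvPolynomial.pderiv i p = 0 := by
      intro i
      by_contra hne
      exact hne (ih _ (hn ▸ totalDegree_pderiv_lt i hne) _ rfl (h0 i))
    obtain ⟨r, rfl⟩ := exists_C_of_pderiv_eq_zero h1
    have hr : r = 0 := by simpa using hp
    rw [hr, map_zero]

theorem linearIndependent_of_triangular {F m n κ : Type*} [Field F] [LinearOrder κ] [Fintype m]
    (key : m → κ) (hkey : Function.Injective key) (c : m → n) (M : m → n → F)
    (hlt : ∀ i j, key i < key j → M i (c j) = 0) (hdiag : ∀ i, M i (c i) ≠ 0) :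
    LinearIndependent F M := by
  classical
  rw [Fintype.linearIndependent_iff]
  intro g hg
  by_contra! hne
  let S : Finset m := Finset.univ.filter fun i => g i ≠ 0
  have hS : S.Nonempty := by
    obtain ⟨i, hi⟩ := hne
    exact ⟨i, by simp [S, hi]⟩
  -- In the column of the row of largest key among those with nonzero coefficient, only the diagonal
  -- entry survives.
  obtain ⟨i, hiS, himax⟩ := S.exists_max_image key hS
  have h := congrFun hg (c i)
  rw [Finset.sum_apply, Finset.sum_eq_single i] at h
  · simp only [Pi.smul_apply, smul_eq_mul, Pi.zero_apply, mul_eq_zero] at h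
    rcases h with h | h
    · exact (Finset.mem_filter.mp hiS).2 h
    · exact hdiag i h
  · intro j _ hji
    by_cases hgj : g j = 0
    · simp [hgj]
    · have hj : key j ≤ key i := himax j (by simp [S, hgj])
      have : key j < key i := lt_of_le_of_ne hj fun h => hji (hkey h)
      simp [hlt j i this]
  · simp

end Jacobian

end

end ManakovSantini

namespace ManakovSantini

noncomputable section

/-! ### Jets in differential rings -/

theorem iterate_comm_apply {S : Type*} {D₁ D₂ : S → S} (h : ∀ x, D₁ (D₂ x) = D₂ (D₁ x)) (n : ℕ) (x : S) :
    D₁ (D₂^[n] x) = D₂^[n] (D₁ x) :=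
  (Function.Commute.iterate_right (f := D₁) (g := D₂) h n) x

section EvJet

variable {R : Type*} [CommRing R] [Algebra ℝ R]

/-- The iterated derivative `d_t^{σ 0} d_x^{σ 1} d_y^{σ 2} h`. -/
def dIter (d : Fin 3 → Derivation ℝ R R) (σ : Fin 3 → ℕ) (h : R) : R :=
  (d 0)^[σ 0] ((d 1)^[σ 1] ((d 2)^[σ 2] h))

/-- The substitution of the jet of `(w 0, w 1)` into differential polynomials. -/
def evJet (d : Fin 3 → Derivation ℝ R R) (b : Fin 3 → R) (w : Fin 2 → R) : DiffPoly →ₐ[ℝ] R :=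
  MvPolynomial.aeval fun c => match c with
    | Sum.inl i => b i
    | Sum.inr (a, σ) => dIter d σ (w a)

variable {d : Fin 3 → Derivation ℝ R R} {b : Fin 3 → R} {w : Fin 2 → R}

theorem evJet_inl (i : Fin 3) : evJet d b w (MvPolynomial.X (Sum.inl i)) = b i := by
  simp [evJet]

theorem evJet_inr (a : Fin 2) (σ : Fin 3 → ℕ) :
    evJet d b w (MvPolynomial.X (Sum.inr (a, σ))) = dIter d σ (w a) := by
  simp [evJet]

theorem d_dIter (hd : ∀ i j h, d i (d j h) = d j (d i h)) (i : Fin 3) (σ : Fin 3 → ℕ) (h : R) :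
    d i (dIter d σ h) = dIter d (σ + Pi.single i 1) h := by
  fin_cases i
  · simp only [dIter, Fin.zero_eta, Pi.add_apply, Pi.single_eq_same, Fin.isValue]
    rw [Function.iterate_succ_apply']
    simp
  · simp only [dIter, Fin.mk_one, Pi.add_apply, Pi.single_eq_same, Fin.isValue]
    rw [Function.iterate_succ_apply', iterate_comm_apply (hd 1 0)]
    simp
  · simp only [dIter, Fin.reduceFinMk, Pi.add_apply, Pi.single_eq_same, Fin.isValue]
    rw [Function.iterate_succ_apply', iterate_comm_apply (hd 2 0), iterate_comm_apply (hd 2 1)]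
    simp

theorem dIter_d (hd : ∀ i j h, d i (d j h) = d j (d i h)) (i : Fin 3) (σ : Fin 3 → ℕ) (h : R) :
    dIter d σ (d i h) = d i (dIter d σ h) := by
  simp only [dIter]
  rw [iterate_comm_apply (hd i 0), iterate_comm_apply (hd i 1), iterate_comm_apply (hd i 2)]

/-- Both sides are derivations along the substitution, so the generators decide. This identity
allows jets to be computed in any ring with three commuting derivations; it is used for the free
polynomial ring and for germs of smooth functions. -/
theorem evJet_totalDeriv (hd : ∀ i j h, d i (d j h) = d j (d i h))
    (hb : ∀ i j, d i (b j) = if j = i then 1 else 0) (i : Fin 3) (f : DiffPoly) :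
    evJet d b w (totalDeriv i f) = d i (evJet d b w f) := by
  induction f using MvPolynomial.induction_on with
  | C r => simp [totalDeriv, evJet]
  | add p q hp hq => simp [hp, hq]
  | mul_X p c hp =>
    simp only [Derivation.leibniz, map_add, smul_eq_mul, map_mul, hp]
    congr 2
    rcases c with j | ⟨a, σ⟩
    · rw [evJet_inl, hb]
      simp only [totalDeriv, MvPolynomial.mkDerivation_X]
      split_ifs <;> simp
    · rw [evJet_inr, d_dIter hd]
      simp only [totalDeriv, MvPolynomial.mkDerivation_X]
      rw [evJet_inr]

theorem evJet_iterTotalDeriv (hd : ∀ i j h, d i (d j h) = d j (d i h))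
    (hb : ∀ i j, d i (b j) = if j = i then 1 else 0) (σ : Fin 3 → ℕ) (f : DiffPoly) :
    evJet d b w (iterTotalDeriv σ f) = dIter d σ (evJet d b w f) := by
  have h : ∀ (i : Fin 3) (n : ℕ) (f : DiffPoly),
      evJet d b w ((totalDeriv i)^[n] f) = (d i)^[n] (evJet d b w f) := by
    intro i n
    induction n with
    | zero => intro f; rfl
    | succ n ih => intro f; rw [Function.iterate_succ_apply, Function.iterate_succ_apply, ih,
        evJet_totalDeriv hd hb]
  simp only [iterTotalDeriv, dIter, h]

end EvJet

/-- A derivation maps polynomials in the variables `s` into a subalgebra containing these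
variables and their derivatives. -/
theorem derivation_mem_of_supported {σ : Type*} {s : Set σ}
    (A : Subalgebra ℝ (MvPolynomial σ ℝ))
    (D : Derivation ℝ (MvPolynomial σ ℝ) (MvPolynomial σ ℝ))
    (h₁ : ∀ c ∈ s, MvPolynomial.X c ∈ A) (h₂ : ∀ c ∈ s, D (MvPolynomial.X c) ∈ A)
    {f : MvPolynomial σ ℝ} (hf : f ∈ MvPolynomial.supported ℝ s) : D f ∈ A := by
  have hle : MvPolynomial.supported ℝ s ≤ A := by
    rw [MvPolynomial.supported]
    refine Algebra.adjoin_le ?_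
    rintro _ ⟨c, hc, rfl⟩
    exact h₁ c hc
  rw [MvPolynomial.supported] at hf
  induction hf using Algebra.adjoin_induction with
  | mem x hx =>
    obtain ⟨c, hc, rfl⟩ := hx
    exact h₂ c hc
  | algebraMap r => rw [D.map_algebraMap]; exact A.zero_mem
  | add x y _ _ hx hy => rw [map_add]; exact A.add_mem hx hy
  | mul x y hx' hy' hx hy =>
    rw [Derivation.leibniz, smul_eq_mul, smul_eq_mul]
    exact A.add_mem (A.mul_mem (hle hx') hy) (A.mul_mem (hle hy') hx)

/-- Differential polynomials of order at most `k`. -/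
def ordLE (k : ℕ) : Subalgebra ℝ DiffPoly := MvPolynomial.supported ℝ {c | jetOrder c ≤ k}

theorem X_mem_ordLE {k : ℕ} {c : JetCoord} (h : jetOrder c ≤ k) :
    (MvPolynomial.X c : DiffPoly) ∈ ordLE k :=
  MvPolynomial.X_mem_supported.mpr h

theorem ordLE_mono {k l : ℕ} (h : k ≤ l) : ordLE k ≤ ordLE l :=
  MvPolynomial.supported_mono fun _ hc => le_trans hc h

theorem totalDeriv_mem_ordLE {k : ℕ} (i : Fin 3) {f : DiffPoly} (hf : f ∈ ordLE k) :
    totalDeriv i f ∈ ordLE (k + 1) := by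
  refine derivation_mem_of_supported (s := {c | jetOrder c ≤ k}) (ordLE (k + 1)) _
    (fun c hc => X_mem_ordLE (Nat.le_succ_of_le hc)) ?_ hf
  rintro (j | ⟨a, σ⟩) hc
  · simp only [totalDeriv, MvPolynomial.mkDerivation_X]
    split_ifs
    · exact one_mem _
    · exact zero_mem _
  · simp only [totalDeriv, MvPolynomial.mkDerivation_X]
    refine X_mem_ordLE ?_
    simp only [jetOrder, Set.mem_ofPred_eq] at hc ⊢
    simp [Finset.sum_add_distrib]
    exact hc

end

end ManakovSantini

namespace ManakovSantini

noncomputable section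

/-! ### The free coordinates of the equation -/

/-- Coordinates on the equation: the base coordinates, and the derivatives of order
`α`, `β`, `γ ≤ 1` with respect to `t`, `x`, `y` of the `a`-th dependent variable. -/
abbrev FreeCoord : Type := Fin 3 ⊕ (Fin 2 × ℕ × ℕ × Bool)

/-- The order of a free coordinate. -/
def freeOrder : FreeCoord → ℕ
  | Sum.inl _ => 0
  | Sum.inr (_, α, β, γ) => α + β + γ.toNat

/-- The jet coordinate underlying a free coordinate. -/
def toJet : FreeCoord → JetCoord
  | Sum.inl i => Sum.inl i
  | Sum.inr (a, α, β, γ) => Sum.inr (a, ![α, β, γ.toNat])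

theorem jetOrder_toJet (c : FreeCoord) : jetOrder (toJet c) = freeOrder c := by
  rcases c with i | ⟨a, α, β, γ⟩
  · rfl
  · simp [toJet, jetOrder, freeOrder, Fin.sum_univ_three]

/-- Polynomials in the free coordinates. -/
abbrev FreePoly : Type := MvPolynomial FreeCoord ℝ

/-- A free jet coordinate as a polynomial. -/
abbrev freeX (a : Fin 2) (α β : ℕ) (γ : Bool) : FreePoly :=
  MvPolynomial.X (Sum.inr (a, α, β, γ))

/-- The expressions of `u_yy` and `v_yy` through free coordinates. -/
def solvedRHS (a : Fin 2) : FreePoly :=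
  if a = 0 then
    freeX 0 1 1 false + freeX 0 0 1 false * freeX 0 0 0 true + freeX 0 0 0 false * freeX 0 0 1 true
      + freeX 1 0 1 false * freeX 0 0 1 false + freeX 1 0 0 false * freeX 0 0 2 false
  else
    freeX 1 1 1 false + freeX 1 0 1 false ^ 2 + freeX 1 0 0 false * freeX 1 0 2 false
      - freeX 0 0 1 false * freeX 1 0 0 true + freeX 0 0 0 false * freeX 1 0 1 true
      + 2 * freeX 0 0 0 true * freeX 1 0 1 false

/-- The total derivative with respect to `t` on the equation. -/
def freeDt : Derivation ℝ FreePoly FreePoly :=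
  MvPolynomial.mkDerivation ℝ fun c => match c with
    | Sum.inl j => if j = 0 then 1 else 0
    | Sum.inr (a, α, β, γ) => freeX a (α + 1) β γ

/-- The total derivative with respect to `x` on the equation. -/
def freeDx : Derivation ℝ FreePoly FreePoly :=
  MvPolynomial.mkDerivation ℝ fun c => match c with
    | Sum.inl j => if j = 1 then 1 else 0
    | Sum.inr (a, α, β, γ) => freeX a α (β + 1) γ

/-- The total derivative with respect to `y` on the equation. -/
def freeDy : Derivation ℝ FreePoly FreePoly :=
  MvPolynomial.mkDerivation ℝ fun c => match c with
    | Sum.inl j => if j = 2 then 1 else 0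
    | Sum.inr (a, α, β, false) => freeX a α β true
    | Sum.inr (a, α, β, true) => freeDt^[α] (freeDx^[β] (solvedRHS a))

/-- The total derivatives on the equation. -/
def freeD : Fin 3 → Derivation ℝ FreePoly FreePoly := ![freeDt, freeDx, freeDy]

@[simp] theorem freeDt_inl (j : Fin 3) :
    freeDt (MvPolynomial.X (Sum.inl j)) = if j = 0 then 1 else 0 := by
  simp [freeDt]

@[simp] theorem freeDx_inl (j : Fin 3) :
    freeDx (MvPolynomial.X (Sum.inl j)) = if j = 1 then 1 else 0 := by
  simp [freeDx]

@[simp] theorem freeDy_inl (j : Fin 3) :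
    freeDy (MvPolynomial.X (Sum.inl j)) = if j = 2 then 1 else 0 := by
  simp [freeDy]

@[simp] theorem freeDt_freeX (a : Fin 2) (α β : ℕ) (γ : Bool) :
    freeDt (freeX a α β γ) = freeX a (α + 1) β γ := by
  simp [freeDt]

@[simp] theorem freeDx_freeX (a : Fin 2) (α β : ℕ) (γ : Bool) :
    freeDx (freeX a α β γ) = freeX a α (β + 1) γ := by
  simp [freeDx]

@[simp] theorem freeDy_freeX_false (a : Fin 2) (α β : ℕ) :
    freeDy (freeX a α β false) = freeX a α β true := by
  simp [freeDy]

@[simp] theorem freeDy_freeX_true (a : Fin 2) (α β : ℕ) :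
    freeDy (freeX a α β true) = freeDt^[α] (freeDx^[β] (solvedRHS a)) := by
  simp [freeDy]

/-- The commutator is itself a derivation, so it vanishes if it vanishes on the variables. -/
theorem derivation_comm_of_X {σ : Type*} {D₁ D₂ : Derivation ℝ (MvPolynomial σ ℝ) (MvPolynomial σ ℝ)}
    (h : ∀ c, D₁ (D₂ (MvPolynomial.X c)) = D₂ (D₁ (MvPolynomial.X c))) (f : MvPolynomial σ ℝ) :
    D₁ (D₂ f) = D₂ (D₁ f) := by
  have : ⁅D₁, D₂⁆ = 0 := by
    refine MvPolynomial.derivation_ext fun c => ?_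
    rw [Derivation.commutator_apply, h, sub_self, Derivation.zero_apply]
  have h2 := congrArg (fun D : Derivation ℝ _ _ => D f) this
  simpa [Derivation.commutator_apply, sub_eq_zero] using h2

theorem freeDt_freeDx (f : FreePoly) : freeDt (freeDx f) = freeDx (freeDt f) := by
  refine derivation_comm_of_X (fun c => ?_) f
  rcases c with j | ⟨a, α, β, γ⟩
  · simp only [freeDx_inl, freeDt_inl]; split_ifs <;> simp
  · simp

/-- There are no integrability conditions: each unknown has a single equation, solved for its second
y-derivative, and its t- and x-derivatives are free. The definition of `freeDy` on coordinates
containing a y-derivative differentiates the solved right-hand side in t and x, which is exactly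
what commutation demands. -/
theorem freeDy_freeDt (f : FreePoly) : freeDy (freeDt f) = freeDt (freeDy f) := by
  refine derivation_comm_of_X (fun c => ?_) f
  rcases c with j | ⟨a, α, β, γ⟩
  · simp only [freeDy_inl, freeDt_inl]; split_ifs <;> simp
  · cases γ
    · simp
    · simp [Function.iterate_succ_apply']

theorem freeDy_freeDx (f : FreePoly) : freeDy (freeDx f) = freeDx (freeDy f) := by
  refine derivation_comm_of_X (fun c => ?_) f
  rcases c with j | ⟨a, α, β, γ⟩
  · simp only [freeDy_inl, freeDx_inl]; split_ifs <;> simp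
  · cases γ
    · simp
    · simp only [freeDx_freeX, freeDy_freeX_true]
      rw [Function.iterate_succ_apply', ← iterate_comm_apply (fun x => (freeDt_freeDx x).symm)]

theorem freeD_comm (i j : Fin 3) (f : FreePoly) : freeD i (freeD j f) = freeD j (freeD i f) := by
  fin_cases i <;> fin_cases j <;>
    simp [freeD, freeDt_freeDx, freeDy_freeDt, freeDy_freeDx]

theorem freeD_inl (i j : Fin 3) :
    freeD i (MvPolynomial.X (Sum.inl j)) = if j = i then 1 else 0 := by
  fin_cases i <;> simp [freeD]

/-- The restriction of differential polynomials to the equation. -/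
def restrictFree : DiffPoly →ₐ[ℝ] FreePoly :=
  evJet freeD (fun i => MvPolynomial.X (Sum.inl i)) (fun a => freeX a 0 0 false)

theorem restrictFree_totalDeriv (i : Fin 3) (f : DiffPoly) :
    restrictFree (totalDeriv i f) = freeD i (restrictFree f) :=
  evJet_totalDeriv freeD_comm freeD_inl i f

theorem freeDt_iterate (n : ℕ) (a : Fin 2) (α β : ℕ) (γ : Bool) :
    freeDt^[n] (freeX a α β γ) = freeX a (α + n) β γ := by
  induction n with
  | zero => rfl
  | succ n ih => rw [Function.iterate_succ_apply', ih, freeDt_freeX, add_assoc]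

theorem freeDx_iterate (n : ℕ) (a : Fin 2) (α β : ℕ) (γ : Bool) :
    freeDx^[n] (freeX a α β γ) = freeX a α (β + n) γ := by
  induction n with
  | zero => rfl
  | succ n ih => rw [Function.iterate_succ_apply', ih, freeDx_freeX, add_assoc]

theorem restrictFree_toJet (c : FreeCoord) :
    restrictFree (MvPolynomial.X (toJet c)) = MvPolynomial.X c := by
  rcases c with i | ⟨a, α, β, γ⟩
  · exact evJet_inl i
  · rw [restrictFree, toJet, evJet_inr]
    cases γ <;> simp [dIter, freeD, freeDx_iterate, freeDt_iterate]

/-- After expansion u_yy and v_yy occur with coefficient -1 in their respective equations, and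
`solvedRHS` collects the remaining terms. -/
theorem restrictFree_msEquation (a : Fin 2) : restrictFree (msEquation a) = 0 := by
  have h : ∀ a : Fin 2, restrictFree (MvPolynomial.X (Sum.inr (a, 0))) = freeX a 0 0 false :=
    fun a => evJet_inr a 0
  have h2 : restrictFree 2 = 2 := map_ofNat _ 2
  have h2' : freeDy (2 : FreePoly) = 0 := freeDy.map_natCast 2
  fin_cases a
  · simp only [msEquation, uVar, vVar, restrictFree_totalDeriv, map_sub, map_add, map_mul, h,
      Fin.zero_eta, Matrix.cons_val_zero]
    simp [freeD, solvedRHS]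
    ring
  · simp only [msEquation, uVar, vVar, restrictFree_totalDeriv, map_sub, map_add, map_mul, h,
      Fin.mk_one, Matrix.cons_val_one, Matrix.cons_val_zero, h2]
    simp [freeD, solvedRHS, h2']
    ring

theorem restrictFree_iterTotalDeriv_msEquation (σ : Fin 3 → ℕ) (a : Fin 2) :
    restrictFree (iterTotalDeriv σ (msEquation a)) = 0 := by
  rw [restrictFree, evJet_iterTotalDeriv freeD_comm freeD_inl]
  have := restrictFree_msEquation a
  rw [restrictFree] at this
  rw [this]
  have h0 : ∀ (i : Fin 3) (n : ℕ), (freeD i)^[n] (0 : FreePoly) = 0 := fun i n =>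
    Function.iterate_fixed (map_zero _) n
  simp only [dIter, h0]

/-- Polynomials in the free coordinates of order at most `k`. -/
def freeLE (k : ℕ) : Subalgebra ℝ FreePoly := MvPolynomial.supported ℝ {c | freeOrder c ≤ k}

theorem X_mem_freeLE {k : ℕ} {c : FreeCoord} (h : freeOrder c ≤ k) :
    (MvPolynomial.X c : FreePoly) ∈ freeLE k :=
  MvPolynomial.X_mem_supported.mpr h

theorem freeLE_mono {k l : ℕ} (h : k ≤ l) : freeLE k ≤ freeLE l :=
  MvPolynomial.supported_mono fun _ hc => le_trans hc h

theorem freeDt_mem_freeLE {k : ℕ} {f : FreePoly} (hf : f ∈ freeLE k) : freeDt f ∈ freeLE (k + 1) := by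
  refine derivation_mem_of_supported (s := {c | freeOrder c ≤ k}) (freeLE (k + 1)) _
    (fun c hc => X_mem_freeLE (Nat.le_succ_of_le hc)) ?_ hf
  rintro (j | ⟨a, α, β, γ⟩) hc
  · rw [freeDt_inl]; split_ifs
    · exact one_mem _
    · exact zero_mem _
  · rw [freeDt_freeX]
    refine X_mem_freeLE ?_
    simp only [freeOrder, Set.mem_ofPred_eq] at hc ⊢
    omega

theorem freeDx_mem_freeLE {k : ℕ} {f : FreePoly} (hf : f ∈ freeLE k) : freeDx f ∈ freeLE (k + 1) := by
  refine derivation_mem_of_supported (s := {c | freeOrder c ≤ k}) (freeLE (k + 1)) _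
    (fun c hc => X_mem_freeLE (Nat.le_succ_of_le hc)) ?_ hf
  rintro (j | ⟨a, α, β, γ⟩) hc
  · rw [freeDx_inl]; split_ifs
    · exact one_mem _
    · exact zero_mem _
  · rw [freeDx_freeX]
    refine X_mem_freeLE ?_
    simp only [freeOrder, Set.mem_ofPred_eq] at hc ⊢
    omega

theorem solvedRHS_mem_freeLE (a : Fin 2) : solvedRHS a ∈ freeLE 2 := by
  have h : ∀ (a : Fin 2) (α β : ℕ) (γ : Bool), α + β + γ.toNat ≤ 2 → freeX a α β γ ∈ freeLE 2 :=
    fun a α β γ h => X_mem_freeLE h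
  rw [solvedRHS]
  split_ifs
  · refine add_mem (add_mem (add_mem (add_mem ?_ (mul_mem ?_ ?_)) (mul_mem ?_ ?_))
      (mul_mem ?_ ?_)) (mul_mem ?_ ?_) <;> exact h _ _ _ _ (by simp)
  · refine add_mem (add_mem (sub_mem (add_mem (add_mem ?_ (pow_mem ?_ 2)) (mul_mem ?_ ?_))
      (mul_mem ?_ ?_)) (mul_mem ?_ ?_)) (mul_mem (mul_mem (ofNat_mem _ 2) ?_) ?_) <;>
      exact h _ _ _ _ (by simp)

theorem iterate_freeDx_mem_freeLE (n : ℕ) {k : ℕ} {f : FreePoly} (hf : f ∈ freeLE k) :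
    freeDx^[n] f ∈ freeLE (k + n) := by
  induction n with
  | zero => exact hf
  | succ n ih => rw [Function.iterate_succ_apply']; exact freeDx_mem_freeLE ih

theorem iterate_freeDt_mem_freeLE (n : ℕ) {k : ℕ} {f : FreePoly} (hf : f ∈ freeLE k) :
    freeDt^[n] f ∈ freeLE (k + n) := by
  induction n with
  | zero => exact hf
  | succ n ih => rw [Function.iterate_succ_apply']; exact freeDt_mem_freeLE ih

theorem freeDy_mem_freeLE {k : ℕ} {f : FreePoly} (hf : f ∈ freeLE k) : freeDy f ∈ freeLE (k + 1) := by
  refine derivation_mem_of_supported (s := {c | freeOrder c ≤ k}) (freeLE (k + 1)) _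
    (fun c hc => X_mem_freeLE (Nat.le_succ_of_le hc)) ?_ hf
  rintro (j | ⟨a, α, β, γ⟩) hc
  · rw [freeDy_inl]; split_ifs
    · exact one_mem _
    · exact zero_mem _
  · simp only [freeOrder, Set.mem_ofPred_eq] at hc
    cases γ
    · rw [freeDy_freeX_false]
      refine X_mem_freeLE ?_
      simp only [freeOrder, Bool.toNat_true, Bool.toNat_false] at hc ⊢
      omega
    · rw [freeDy_freeX_true]
      refine freeLE_mono ?_
        (iterate_freeDt_mem_freeLE α (iterate_freeDx_mem_freeLE β (solvedRHS_mem_freeLE a)))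
      simp only [Bool.toNat_true] at hc
      omega

theorem freeD_mem_freeLE {k : ℕ} (i : Fin 3) {f : FreePoly} (hf : f ∈ freeLE k) :
    freeD i f ∈ freeLE (k + 1) := by
  fin_cases i
  · exact freeDt_mem_freeLE hf
  · exact freeDx_mem_freeLE hf
  · exact freeDy_mem_freeLE hf

theorem iterate_freeD_mem_freeLE (i : Fin 3) (n : ℕ) {k : ℕ} {f : FreePoly} (hf : f ∈ freeLE k) :
    (freeD i)^[n] f ∈ freeLE (k + n) := by
  induction n with
  | zero => exact hf
  | succ n ih => rw [Function.iterate_succ_apply']; exact freeD_mem_freeLE i ih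

/-- Elimination does not raise the order, because the expressions replacing u_yy and v_yy are of
order 2 as well. This keeps the chart of 𝓔_k within the free coordinates of order at most k. -/
theorem restrictFree_X_mem_freeLE (c : JetCoord) :
    restrictFree (MvPolynomial.X c) ∈ freeLE (jetOrder c) := by
  rcases c with i | ⟨a, σ⟩
  · rw [restrictFree, evJet_inl]; exact X_mem_freeLE le_rfl
  · rw [restrictFree, evJet_inr]
    refine freeLE_mono ?_ (iterate_freeD_mem_freeLE 0 (σ 0) (iterate_freeD_mem_freeLE 1 (σ 1)
      (iterate_freeD_mem_freeLE 2 (σ 2) (X_mem_freeLE (k := 0) (c := Sum.inr (a, 0, 0, false)) le_rfl))))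
    simp [jetOrder, Fin.sum_univ_three]
    omega

end

end ManakovSantini

namespace ManakovSantini

noncomputable section

/-! ### The equation manifold as a graph -/

/-- The order of a jet coordinate in `y`. -/
def yOrder : JetCoord → ℕ
  | Sum.inl _ => 0
  | Sum.inr (_, σ) => σ 2

/-- Differential polynomials of order at most `k` and of order at most `m` in `y`. -/
def yordLE (m k : ℕ) : Subalgebra ℝ DiffPoly :=
  MvPolynomial.supported ℝ {c | jetOrder c ≤ k ∧ yOrder c ≤ m}

theorem X_mem_yordLE {m k : ℕ} {c : JetCoord} (h : jetOrder c ≤ k) (h' : yOrder c ≤ m) :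
    (MvPolynomial.X c : DiffPoly) ∈ yordLE m k :=
  MvPolynomial.X_mem_supported.mpr ⟨h, h'⟩

theorem yordLE_mono {m n k l : ℕ} (h : m ≤ n) (h' : k ≤ l) : yordLE m k ≤ yordLE n l :=
  MvPolynomial.supported_mono fun _ hc => ⟨le_trans hc.1 h', le_trans hc.2 h⟩

theorem totalDeriv_mem_yordLE {m k : ℕ} (i : Fin 3) {f : DiffPoly} (hf : f ∈ yordLE m k) :
    totalDeriv i f ∈ yordLE (m + if i = 2 then 1 else 0) (k + 1) := by
  refine derivation_mem_of_supported (s := {c | jetOrder c ≤ k ∧ yOrder c ≤ m}) _ _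
    (fun c hc => X_mem_yordLE (Nat.le_succ_of_le hc.1) (hc.2.trans (Nat.le_add_right _ _))) ?_ hf
  rintro (j | ⟨a, σ⟩) hc
  · simp only [totalDeriv, MvPolynomial.mkDerivation_X]
    split_ifs
    · exact one_mem _
    · exact zero_mem _
    · exact one_mem _
    · exact zero_mem _
  · simp only [totalDeriv, MvPolynomial.mkDerivation_X]
    simp only [jetOrder, yOrder, Set.mem_ofPred_eq] at hc
    refine X_mem_yordLE ?_ ?_
    · simpa [jetOrder, Finset.sum_add_distrib] using hc.1
    · simp only [yOrder, Pi.add_apply, Pi.single_apply]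
      have := hc.2
      by_cases hi : i = 2
      · subst hi; simp; exact this
      · simp [hi, Ne.symm hi]; exact this

theorem iterate_totalDeriv_mem_yordLE {m k : ℕ} (i : Fin 3) (n : ℕ) {f : DiffPoly}
    (hf : f ∈ yordLE m k) :
    (totalDeriv i)^[n] f ∈ yordLE (m + if i = 2 then n else 0) (k + n) := by
  induction n with
  | zero => simpa using hf
  | succ n ih =>
    rw [Function.iterate_succ_apply']
    refine yordLE_mono ?_ ?_ (totalDeriv_mem_yordLE i ih)
    · split_ifs <;> omega
    · omega

theorem iterTotalDeriv_mem_yordLE {m k : ℕ} (σ : Fin 3 → ℕ) {f : DiffPoly}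
    (hf : f ∈ yordLE m k) : iterTotalDeriv σ f ∈ yordLE (m + σ 2) (k + ∑ i, σ i) := by
  refine yordLE_mono ?_ ?_ (iterate_totalDeriv_mem_yordLE 0 (σ 0)
    (iterate_totalDeriv_mem_yordLE 1 (σ 1) (iterate_totalDeriv_mem_yordLE 2 (σ 2) hf)))
  · simp
  · rw [Fin.sum_univ_three]; omega

theorem totalDeriv_X_inr (i : Fin 3) (a : Fin 2) (σ : Fin 3 → ℕ) :
    totalDeriv i (MvPolynomial.X (Sum.inr (a, σ))) =
      MvPolynomial.X (Sum.inr (a, σ + Pi.single i 1)) := by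
  simp [totalDeriv]

theorem iterTotalDeriv_X_inr (a : Fin 2) (σ τ : Fin 3 → ℕ) :
    iterTotalDeriv σ (MvPolynomial.X (Sum.inr (a, τ))) = MvPolynomial.X (Sum.inr (a, τ + σ)) := by
  have h : ∀ (i : Fin 3) (n : ℕ) (τ : Fin 3 → ℕ),
      (totalDeriv i)^[n] (MvPolynomial.X (Sum.inr (a, τ))) =
        MvPolynomial.X (Sum.inr (a, τ + Pi.single i n)) := by
    intro i n
    induction n with
    | zero => intro τ; simp
    | succ n ih =>
      intro τ
      rw [Function.iterate_succ_apply', ih, totalDeriv_X_inr, add_assoc, ← Pi.single_add]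
  simp only [iterTotalDeriv, h]
  congr 3
  funext i
  fin_cases i <;> simp

theorem iterTotalDeriv_add (σ : Fin 3 → ℕ) (f g : DiffPoly) :
    iterTotalDeriv σ (f + g) = iterTotalDeriv σ f + iterTotalDeriv σ g := by
  have h : ∀ (i : Fin 3) (n : ℕ) (f g : DiffPoly), (totalDeriv i)^[n] (f + g) =
      (totalDeriv i)^[n] f + (totalDeriv i)^[n] g := fun i n =>
    iterate_map_add (totalDeriv i) n
  simp only [iterTotalDeriv, h]

/-- Removing the term with two y-derivatives leaves at most one y-derivative. This is what makes the
prolonged system triangular with respect to the order in y. -/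
theorem msEquation_add_mem (a : Fin 2) :
    msEquation a + totalDeriv 2 (totalDeriv 2 (MvPolynomial.X (Sum.inr (a, 0)))) ∈ yordLE 1 2 := by
  have hX : ∀ a : Fin 2, (MvPolynomial.X (Sum.inr (a, 0)) : DiffPoly) ∈ yordLE 0 0 := fun a =>
    X_mem_yordLE (by simp [jetOrder]) (by simp [yOrder])
  have hu : uVar ∈ yordLE 0 0 := hX 0
  have hv : vVar ∈ yordLE 0 0 := hX 1
  have up : ∀ {f : DiffPoly} {m k : ℕ}, f ∈ yordLE m k → m ≤ 1 → k ≤ 1 → f ∈ yordLE 1 1 :=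
    fun hf h1 h2 => yordLE_mono h1 h2 hf
  have h1 := fun (i : Fin 3) => totalDeriv_mem_yordLE i hu
  have h2 := fun (i : Fin 3) => totalDeriv_mem_yordLE i hv
  have h1' : ∀ i, totalDeriv i uVar ∈ yordLE 1 1 := fun i =>
    up (h1 i) (by split_ifs <;> simp) le_rfl
  have h2' : ∀ i, totalDeriv i vVar ∈ yordLE 1 1 := fun i =>
    up (h2 i) (by split_ifs <;> simp) le_rfl
  have hu' := up hu zero_le_one zero_le_one
  have hv' := up hv zero_le_one zero_le_one
  fin_cases a
  · change totalDeriv 1 (totalDeriv 0 uVar + uVar * totalDeriv 2 uVar + vVar * totalDeriv 1 uVar)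
      - totalDeriv 2 (totalDeriv 2 uVar) + totalDeriv 2 (totalDeriv 2 uVar) ∈ _
    rw [sub_add_cancel]
    exact totalDeriv_mem_yordLE 1
      (add_mem (add_mem (h1' 0) (mul_mem hu' (h1' 2))) (mul_mem hv' (h1' 1)))
  · change totalDeriv 1 (totalDeriv 0 vVar + vVar * totalDeriv 1 vVar - uVar * totalDeriv 2 vVar)
      - totalDeriv 2 (totalDeriv 2 vVar - 2 * uVar * totalDeriv 1 vVar)
      + totalDeriv 2 (totalDeriv 2 vVar) ∈ _
    rw [map_sub (totalDeriv 2), sub_sub_eq_add_sub, sub_add_cancel_right_helper]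
    refine add_mem (totalDeriv_mem_yordLE 1
      (sub_mem (add_mem (h2' 0) (mul_mem hv' (h2' 1))) (mul_mem hu' (h2' 2)))) ?_
    have : 2 * uVar * totalDeriv 1 vVar ∈ yordLE 0 1 :=
      mul_mem (mul_mem (ofNat_mem _ 2) (yordLE_mono le_rfl zero_le_one hu)) (h2 1)
    exact totalDeriv_mem_yordLE 2 this
where
  sub_add_cancel_right_helper {A B C : DiffPoly} : A + B - C + C = A + B := by ring

/-- The free coordinates of a jet (with value `0` for the coordinates of order `> k`). -/
def freePart {k : ℕ} (θ : JetSpace k) : FreeCoord → ℝ := fun c => extendJet θ (toJet c)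

theorem algHom_eq_of_mem_supported {σ A : Type*} [CommRing A] [Algebra ℝ A] {s : Set σ}
    {f g : MvPolynomial σ ℝ →ₐ[ℝ] A}
    (h : ∀ c ∈ s, f (MvPolynomial.X c) = g (MvPolynomial.X c)) {p : MvPolynomial σ ℝ}
    (hp : p ∈ MvPolynomial.supported ℝ s) : f p = g p := by
  have hle : MvPolynomial.supported ℝ s ≤ AlgHom.equalizer f g := by
    rw [MvPolynomial.supported]
    refine Algebra.adjoin_le ?_
    rintro _ ⟨c, hc, rfl⟩
    exact h c hc
  exact hle hp

/-- Induction on the order in y. The prolonged equation D^σ F_a = 0 expresses one coordinate through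
coordinates with fewer y-derivatives. The values of θ and the values computed from the free
coordinates satisfy the same recursion, and they agree when the order in y is at most 1. -/
theorem extendJet_eq_of_mem {k : ℕ} {θ : JetSpace k} (hθ : θ ∈ equationManifold k) :
    ∀ c : JetCoord, jetOrder c ≤ k →
      extendJet θ c = MvPolynomial.aeval (freePart θ) (restrictFree (MvPolynomial.X c)) := by
  suffices H : ∀ m : ℕ, ∀ c : JetCoord, yOrder c ≤ m → jetOrder c ≤ k →
      extendJet θ c = MvPolynomial.aeval (freePart θ) (restrictFree (MvPolynomial.X c)) from
    fun c hc => H _ c le_rfl hc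
  have hfree : ∀ c : FreeCoord, extendJet θ (toJet c) =
      MvPolynomial.aeval (freePart θ) (restrictFree (MvPolynomial.X (toJet c))) := by
    intro c
    rw [restrictFree_toJet, MvPolynomial.aeval_X]; rfl
  have hsmall : ∀ c : JetCoord, yOrder c ≤ 1 → ∃ c', toJet c' = c := by
    rintro (i | ⟨a, σ⟩) hc
    · exact ⟨Sum.inl i, rfl⟩
    · simp only [yOrder] at hc
      refine ⟨Sum.inr (a, σ 0, σ 1, decide (σ 2 = 1)), ?_⟩
      simp only [toJet]
      congr 2
      funext i
      fin_cases i
      · rfl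
      · rfl
      · rcases Nat.le_one_iff_eq_zero_or_eq_one.mp hc with h | h <;> simp [h]
  intro m
  induction m with
  | zero =>
    intro c hc _
    obtain ⟨c', rfl⟩ := hsmall c (by omega)
    exact hfree c'
  | succ m ih =>
    intro c hc hck
    by_cases hc1 : yOrder c ≤ 1
    · obtain ⟨c', rfl⟩ := hsmall c hc1
      exact hfree c'
    rcases c with i | ⟨a, τ⟩
    · simp [yOrder] at hc1
    simp only [yOrder, not_le] at hc hc1
    -- The multi-index τ with two y-derivatives removed, so that D^σ F_a contains the coordinate τ
    -- with coefficient -1.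
    let σ : Fin 3 → ℕ := ![τ 0, τ 1, τ 2 - 2]
    have hσ : (0 + Pi.single 2 1 + Pi.single 2 1 + σ : Fin 3 → ℕ) = τ := by
      funext i
      fin_cases i <;> simp [σ]
      omega
    have hord : (∑ i, σ i) + 2 = jetOrder (Sum.inr (a, τ)) := by
      simp only [jetOrder, Fin.sum_univ_three, σ, Matrix.cons_val_zero, Matrix.cons_val_one,
        Matrix.cons_val]
      omega
    have hmem := iterTotalDeriv_mem_yordLE σ (msEquation_add_mem a)
    have heq : iterTotalDeriv σ (msEquation a + totalDeriv 2 (totalDeriv 2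
        (MvPolynomial.X (Sum.inr (a, 0))))) =
        iterTotalDeriv σ (msEquation a) + MvPolynomial.X (Sum.inr (a, τ)) := by
      rw [iterTotalDeriv_add, totalDeriv_X_inr, totalDeriv_X_inr, iterTotalDeriv_X_inr, hσ]
    -- The sum of D^σ F_a and the coordinate τ involves only smaller orders in y, where the
    -- induction hypothesis applies. As D^σ F_a has value zero on both sides, only the coordinate τ
    -- remains.
    have key := algHom_eq_of_mem_supported (f := MvPolynomial.aeval (extendJet θ))
      (g := (MvPolynomial.aeval (freePart θ)).comp restrictFree) (fun c hc => by
        have h2 : yOrder c ≤ m := by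
          have := hc.2
          simp only [σ, Matrix.cons_val] at this
          omega
        rw [MvPolynomial.aeval_X]
        exact ih c h2 (by have := hc.1; omega)) hmem
    rw [heq, map_add, map_add, MvPolynomial.aeval_X] at key
    have h0 : MvPolynomial.aeval (extendJet θ) (iterTotalDeriv σ (msEquation a)) = 0 :=
      hθ a σ (by omega)
    have h1 : ((MvPolynomial.aeval (freePart θ)).comp restrictFree)
        (iterTotalDeriv σ (msEquation a)) = 0 := by
      rw [AlgHom.comp_apply, restrictFree_iterTotalDeriv_msEquation, map_zero]
    rw [h0, h1, zero_add, zero_add] at key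
    exact key

/-- The point of the equation with given free coordinates. -/
def pointOfFree (k : ℕ) (z : FreeCoord → ℝ) : JetSpace k := fun c =>
  MvPolynomial.aeval z (restrictFree (MvPolynomial.X c.1))

theorem aeval_extendJet_of_mem {k : ℕ} {θ : JetSpace k} (hθ : θ ∈ equationManifold k)
    {f : DiffPoly} (hf : f ∈ ordLE k) :
    MvPolynomial.aeval (extendJet θ) f = MvPolynomial.aeval (freePart θ) (restrictFree f) :=
  algHom_eq_of_mem_supported (f := MvPolynomial.aeval (extendJet θ))
    (g := (MvPolynomial.aeval (freePart θ)).comp restrictFree) (fun c hc => by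
      rw [MvPolynomial.aeval_X]; exact extendJet_eq_of_mem hθ c hc) hf

theorem iterTotalDeriv_msEquation_mem_ordLE (a : Fin 2) {k : ℕ} (σ : Fin 3 → ℕ)
    (h : (∑ i, σ i) + 2 ≤ k) : iterTotalDeriv σ (msEquation a) ∈ ordLE k := by
  have h1 : iterTotalDeriv σ (msEquation a + totalDeriv 2 (totalDeriv 2
        (MvPolynomial.X (Sum.inr (a, 0))))) ∈ ordLE k :=
    MvPolynomial.supported_mono (fun c hc => by
      have := hc.1
      simp only [Set.mem_ofPred_eq]
      omega) (iterTotalDeriv_mem_yordLE σ (msEquation_add_mem a))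
  rw [iterTotalDeriv_add, totalDeriv_X_inr, totalDeriv_X_inr, iterTotalDeriv_X_inr] at h1
  refine (add_mem_cancel_right (X_mem_ordLE ?_)).mp h1
  simp only [jetOrder, Pi.add_apply, Finset.sum_add_distrib]
  simp
  omega

theorem aeval_extendJet_pointOfFree (k : ℕ) (z : FreeCoord → ℝ) {f : DiffPoly}
    (hf : f ∈ ordLE k) :
    MvPolynomial.aeval (extendJet (pointOfFree k z)) f = MvPolynomial.aeval z (restrictFree f) :=
  algHom_eq_of_mem_supported (f := MvPolynomial.aeval (extendJet (pointOfFree k z)))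
    (g := (MvPolynomial.aeval z).comp restrictFree) (fun c hc => by
      rw [MvPolynomial.aeval_X]
      have hc' : jetOrder c ≤ k := hc
      simp [extendJet, hc', pointOfFree]) hf

theorem pointOfFree_mem (k : ℕ) (z : FreeCoord → ℝ) : pointOfFree k z ∈ equationManifold k := by
  intro a σ h
  have := aeval_extendJet_pointOfFree k z (iterTotalDeriv_msEquation_mem_ordLE a σ h)
  rw [restrictFree_iterTotalDeriv_msEquation, map_zero] at this
  exact this

/-- The restriction of polynomials on `J^k` to the equation. -/
def restrictLE (k : ℕ) : MvPolynomial (JetCoordLE k) ℝ →ₐ[ℝ] FreePoly :=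
  restrictFree.comp (MvPolynomial.rename Subtype.val)

theorem rename_val_mem_ordLE {k : ℕ} (P : MvPolynomial (JetCoordLE k) ℝ) :
    MvPolynomial.rename Subtype.val P ∈ ordLE k := by
  rw [ordLE, MvPolynomial.mem_supported]
  classical
  intro c hc
  have := MvPolynomial.vars_rename Subtype.val P hc
  obtain ⟨c', _, rfl⟩ := Finset.mem_image.mp this
  exact c'.2

theorem eval_eq_aeval_extendJet {k : ℕ} (θ : JetSpace k) (P : MvPolynomial (JetCoordLE k) ℝ) :
    MvPolynomial.eval θ P =
      MvPolynomial.aeval (extendJet θ) (MvPolynomial.rename Subtype.val P) := by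
  rw [MvPolynomial.aeval_rename, ← MvPolynomial.aeval_eq_eval]
  have : (extendJet θ ∘ Subtype.val : JetCoordLE k → ℝ) = θ := by
    funext c
    simp [extendJet, c.2]
  rw [this]

theorem eval_eq_of_mem {k : ℕ} {θ : JetSpace k} (hθ : θ ∈ equationManifold k)
    (P : MvPolynomial (JetCoordLE k) ℝ) :
    MvPolynomial.eval θ P = MvPolynomial.aeval (freePart θ) (restrictLE k P) := by
  rw [eval_eq_aeval_extendJet, aeval_extendJet_of_mem hθ (rename_val_mem_ordLE P)]
  rfl

theorem eval_pointOfFree (k : ℕ) (z : FreeCoord → ℝ) (P : MvPolynomial (JetCoordLE k) ℝ) :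
    MvPolynomial.eval (pointOfFree k z) P = MvPolynomial.aeval z (restrictLE k P) := by
  rw [eval_eq_aeval_extendJet, aeval_extendJet_pointOfFree k z (rename_val_mem_ordLE P)]
  rfl

/-- The free coordinates can be prescribed arbitrarily, and a real polynomial vanishing at all
points is zero. Hence the vanishing ideal of 𝓔_k is precisely the kernel of the restriction. -/
theorem restrictLE_eq_zero_iff (k : ℕ) (P : MvPolynomial (JetCoordLE k) ℝ) :
    restrictLE k P = 0 ↔ P ∈ MvPolynomial.vanishingIdeal ℝ (equationManifold k) := by
  rw [MvPolynomial.mem_vanishingIdeal_iff]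
  constructor
  · intro h θ hθ
    have := eval_eq_of_mem hθ P
    rw [h, map_zero] at this
    exact this
  · intro h
    refine MvPolynomial.funext fun z => ?_
    rw [map_zero]
    exact (eval_pointOfFree k z P).symm.trans (h _ (pointOfFree_mem k z))

/-- Free coordinates of order at most `k`. -/
abbrev FreeCoordLE (k : ℕ) : Type := {c : FreeCoord // freeOrder c ≤ k}

theorem restrictLE_mem_freeLE (k : ℕ) (P : MvPolynomial (JetCoordLE k) ℝ) :
    restrictLE k P ∈ freeLE k := by
  have h : (⊤ : Subalgebra ℝ (MvPolynomial (JetCoordLE k) ℝ)) ≤ (freeLE k).comap (restrictLE k) := by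
    rw [← MvPolynomial.adjoin_range_X]
    refine Algebra.adjoin_le ?_
    rintro _ ⟨c, rfl⟩
    simp only [restrictLE, Subalgebra.coe_comap, Set.mem_preimage, AlgHom.comp_apply,
      MvPolynomial.rename_X]
    exact freeLE_mono c.2 (restrictFree_X_mem_freeLE c.1)
  exact h Algebra.mem_top

/-- The restriction of polynomials on `J^k` to the equation, as polynomials in the free
coordinates of order at most `k`. -/
def chart (k : ℕ) : MvPolynomial (JetCoordLE k) ℝ →ₐ[ℝ] MvPolynomial (FreeCoordLE k) ℝ :=
  (MvPolynomial.supportedEquivMvPolynomial {c | freeOrder c ≤ k}).toAlgHom.comp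
    ((restrictLE k).codRestrict (freeLE k) (restrictLE_mem_freeLE k))

theorem coe_supportedEquivMvPolynomial_symm {σ : Type*} (s : Set σ) (q : MvPolynomial s ℝ) :
    (((MvPolynomial.supportedEquivMvPolynomial (R := ℝ) s).symm q : MvPolynomial.supported ℝ s) :
      MvPolynomial σ ℝ) = MvPolynomial.rename Subtype.val q := by
  have : (MvPolynomial.supported ℝ s).val.comp
      (MvPolynomial.supportedEquivMvPolynomial (R := ℝ) s).symm.toAlgHom =
      MvPolynomial.rename Subtype.val := by
    ext i
    simp
  exact congrArg (fun f : MvPolynomial s ℝ →ₐ[ℝ] MvPolynomial σ ℝ => f q) this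

theorem rename_chart (k : ℕ) (P : MvPolynomial (JetCoordLE k) ℝ) :
    MvPolynomial.rename Subtype.val (chart k P) = restrictLE k P := by
  have := coe_supportedEquivMvPolynomial_symm {c | freeOrder c ≤ k} (chart k P)
  refine this.symm.trans ?_
  change ((MvPolynomial.supportedEquivMvPolynomial _).symm
    (MvPolynomial.supportedEquivMvPolynomial _ _) : MvPolynomial.supported ℝ _).1 = _
  rw [AlgEquiv.symm_apply_apply]
  rfl

theorem chart_eq_zero_iff (k : ℕ) (P : MvPolynomial (JetCoordLE k) ℝ) :
    chart k P = 0 ↔ P ∈ MvPolynomial.vanishingIdeal ℝ (equationManifold k) := by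
  rw [← restrictLE_eq_zero_iff, ← rename_chart,
    map_eq_zero_iff _ (MvPolynomial.rename_injective _ Subtype.val_injective)]

/-- The embedding of the coordinate ring of the equation into the ring of polynomials in the free
coordinates. -/
def coordinateChart (k : ℕ) : CoordinateRing k →ₐ[ℝ] MvPolynomial (FreeCoordLE k) ℝ :=
  Ideal.Quotient.liftₐ _ (chart k) fun P hP => (chart_eq_zero_iff k P).mpr hP

theorem coordinateChart_injective (k : ℕ) : Function.Injective (coordinateChart k) := by
  rw [injective_iff_map_eq_zero]
  intro x hx
  obtain ⟨P, rfl⟩ := Ideal.Quotient.mk_surjective x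
  exact Ideal.Quotient.eq_zero_iff_mem.mpr ((chart_eq_zero_iff k P).mp hx)

/-- As a graph over an affine space, 𝓔_k is irreducible; its total ring of fractions is therefore a
field. -/
instance (k : ℕ) : IsDomain (CoordinateRing k) :=
  (coordinateChart_injective k).isDomain (coordinateChart k).toRingHom

theorem restrict_mem_nonZeroDivisors_iff (k : ℕ) (Q : MvPolynomial (JetCoordLE k) ℝ) :
    restrict k Q ∈ nonZeroDivisors (CoordinateRing k) ↔ chart k Q ≠ 0 := by
  rw [mem_nonZeroDivisors_iff_ne_zero, Ne, Ne, chart_eq_zero_iff, Ideal.Quotient.eq_zero_iff_mem]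

/-- The embedding of the coordinate ring of the equation into the field of rational functions of
the free coordinates. -/
def coordinateToRatFun (k : ℕ) : CoordinateRing k →ₐ[ℝ] RatFun (FreeCoordLE k) :=
  (IsScalarTower.toAlgHom ℝ (MvPolynomial (FreeCoordLE k) ℝ)
      (RatFun (FreeCoordLE k))).comp (coordinateChart k)

theorem coordinateToRatFun_injective (k : ℕ) : Function.Injective (coordinateToRatFun k) :=
  (IsFractionRing.injective (MvPolynomial (FreeCoordLE k) ℝ) (RatFun (FreeCoordLE k))).comp
    (coordinateChart_injective k)

/-- The embedding of the field of rational functions on the equation into the field of rational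
functions of the free coordinates. -/
def rationalChart (k : ℕ) : RationalFunctions k →ₐ[ℝ] RatFun (FreeCoordLE k) :=
  IsFractionRing.liftAlgHom (A := CoordinateRing k) (coordinateToRatFun_injective k)

theorem rationalChart_algebraMap (k : ℕ) (P : MvPolynomial (JetCoordLE k) ℝ) :
    rationalChart k (algebraMap (CoordinateRing k) (RationalFunctions k) (restrict k P)) =
      algebraMap _ _ (chart k P) := by
  exact IsFractionRing.lift_algebraMap (A := CoordinateRing k)
    (coordinateToRatFun_injective k) (restrict k P)

theorem aeval_chart (k : ℕ) (z : FreeCoord → ℝ) (P : MvPolynomial (JetCoordLE k) ℝ) :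
    MvPolynomial.eval (fun c : FreeCoordLE k => z c.1) (chart k P) =
      MvPolynomial.aeval z (restrictLE k P) := by
  rw [← rename_chart, MvPolynomial.aeval_rename]
  rfl

end

end ManakovSantini

/-! ### Transformation laws of jets in differential rings. -/

namespace ManakovSantini

noncomputable section

/-! ### Point transformations of differential rings and relative invariants -/

/-- A ring with commuting derivations with respect to `t, x, y`. -/
structure DiffData (R : Type) [CommRing R] [Algebra ℝ R] where
  d : Fin 3 → Derivation ℝ R R
  b : Fin 3 → R
  w : Fin 2 → R
  comm : ∀ i j h, d i (d j h) = d j (d i h)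
  d_b : ∀ i j, d i (b j) = if j = i then 1 else 0

/-- Substitution of the jet of `w` into differential polynomials. -/
def DiffData.ev {R : Type} [CommRing R] [Algebra ℝ R] (A : DiffData R) : DiffPoly →ₐ[ℝ] R :=
  evJet A.d A.b A.w

theorem DiffData.ev_totalDeriv {R : Type} [CommRing R] [Algebra ℝ R] (A : DiffData R) (i : Fin 3)
    (f : DiffPoly) : A.ev (totalDeriv i f) = A.d i (A.ev f) :=
  evJet_totalDeriv A.comm A.d_b i f

theorem DiffData.ev_uVar {R : Type} [CommRing R] [Algebra ℝ R] (A : DiffData R) :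
    A.ev uVar = A.w 0 := evJet_inr 0 0

theorem DiffData.ev_vVar {R : Type} [CommRing R] [Algebra ℝ R] (A : DiffData R) :
    A.ev vVar = A.w 1 := evJet_inr 1 0

/-- A transformation of the kind of those in the symmetry pseudogroup, between functions of the new
and of the old coordinates: `x ↦ X` with `X_x = Q`, `X_y = c`, `X_t = Xt`; `y ↦ Y` with `Y_y = P`,
`Y_t = Yt`; `t ↦ T` with `T_t = P² / Q`. -/
structure PointMap {R' R : Type} [CommRing R'] [Algebra ℝ R'] [CommRing R] [Algebra ℝ R]
    (A' : DiffData R') (A : DiffData R) where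
  φ : R' →ₐ[ℝ] R
  P : R
  Q : R
  Pi : R
  Qi : R
  c : R
  Xt : R
  Yt : R
  hP : P * Pi = 1
  hQ : Q * Qi = 1
  chain_x : ∀ h, A.d 1 (φ h) = Q * φ (A'.d 1 h)
  chain_y : ∀ h, A.d 2 (φ h) = P * φ (A'.d 2 h) + c * φ (A'.d 1 h)
  chain_t : ∀ h, A.d 0 (φ h) = P ^ 2 * Qi * φ (A'.d 0 h) + Yt * φ (A'.d 2 h) + Xt * φ (A'.d 1 h)
  dxP : A.d 1 P = 0
  dyP : A.d 2 P = 0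
  dxQ : A.d 1 Q = 0
  dyQ : A.d 2 Q = 0
  dxc : A.d 1 c = 0
  dyc : A.d 2 c = A.d 0 Q
  dxYt : A.d 1 Yt = 0
  dyYt : A.d 2 Yt = A.d 0 P
  dxXt : A.d 1 Xt = A.d 0 Q
  dyXt : A.d 2 Xt = A.d 0 c
  map_u : φ (A'.w 0) = Q * Pi * A.w 0 + Q * Pi ^ 2 * Yt - 2 * c * Pi
  map_v : φ (A'.w 1) = Q ^ 2 * Pi ^ 2 * A.w 1 + Q * Pi ^ 2 * c * A.w 0 + Q * Pi ^ 2 * Xt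
    - c ^ 2 * Pi ^ 2

namespace PointMap

variable {R' R : Type} [CommRing R'] [Algebra ℝ R'] [CommRing R] [Algebra ℝ R]
  {A' : DiffData R'} {A : DiffData R} (G : PointMap A' A)

/-- This lemma and the next two solve the chain rule for the derivatives in the new coordinates. The
inverses are carried as elements `Pi` and `Qi`, since R is only a commutative ring. -/
theorem phi_dx (h : R') : G.φ (A'.d 1 h) = G.Qi * A.d 1 (G.φ h) := by
  linear_combination -G.Qi * G.chain_x h - G.φ (A'.d 1 h) * G.hQ

theorem phi_dy (h : R') : G.φ (A'.d 2 h) = G.Pi * (A.d 2 (G.φ h) - G.c * G.Qi * A.d 1 (G.φ h)) := by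
  rw [mul_assoc G.c, ← G.phi_dx]
  linear_combination -G.Pi * G.chain_y h - G.φ (A'.d 2 h) * G.hP

theorem phi_dt (h : R') : G.φ (A'.d 0 h) = G.Pi ^ 2 * G.Q * (A.d 0 (G.φ h)
    - G.Yt * (G.Pi * (A.d 2 (G.φ h) - G.c * G.Qi * A.d 1 (G.φ h)))
    - G.Xt * (G.Qi * A.d 1 (G.φ h))) := by
  rw [← G.phi_dy, ← G.phi_dx]
  have h1 : G.P ^ 2 * G.Qi * (G.Pi ^ 2 * G.Q) = 1 := by
    linear_combination (G.P * G.Pi + 1) * G.Qi * G.Q * G.hP + G.hQ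
  linear_combination -(G.Pi ^ 2 * G.Q) * G.chain_t h - G.φ (A'.d 0 h) * h1

theorem d_inv {D : Derivation ℝ R R} {a b : R} (hab : a * b = 1) : D b = - b ^ 2 * D a := by
  have h := congrArg D hab
  rw [D.leibniz, D.map_one_eq_zero, smul_eq_mul, smul_eq_mul] at h
  linear_combination b * h - D b * hab

theorem dxPi : A.d 1 G.Pi = 0 := by rw [d_inv G.hP, G.dxP, mul_zero]
theorem dyPi : A.d 2 G.Pi = 0 := by rw [d_inv G.hP, G.dyP, mul_zero]
theorem dtPi : A.d 0 G.Pi = - G.Pi ^ 2 * A.d 0 G.P := d_inv G.hP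

theorem d_two (D : Derivation ℝ R R) : D (2 : R) = 0 := D.map_natCast 2

/-- The inhomogeneous terms in the law of u do not depend on x, so u_x is merely rescaled. The other
second-order laws follow in the same way; their corrections come from c and from the t-derivatives
of P and Q. -/
theorem phi_ux : G.φ (A'.d 1 (A'.w 0)) = G.Pi * A.d 1 (A.w 0) := by
  rw [G.phi_dx, G.map_u]
  simp only [map_add, map_sub, Derivation.leibniz, Derivation.leibniz_pow, smul_eq_mul, G.dxQ,
    G.dxPi, G.dxYt, G.dxc, d_two]
  linear_combination (A.d 1 (A.w 0) * G.Pi) * G.hQ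

theorem phi_uy : G.φ (A'.d 2 (A'.w 0)) = G.Pi ^ 2 * (G.Q * A.d 2 (A.w 0) - G.c * A.d 1 (A.w 0)
    + G.Q * G.Pi * A.d 0 G.P - 2 * A.d 0 G.Q) := by
  rw [G.phi_dy, mul_assoc G.c, ← G.phi_dx, G.phi_ux, G.map_u]
  simp only [map_add, map_sub, Derivation.leibniz, Derivation.leibniz_pow, smul_eq_mul, G.dyQ,
    G.dyPi, G.dyYt, G.dyc, d_two]
  ring

theorem phi_vx : G.φ (A'.d 1 (A'.w 1)) = G.Pi ^ 2 * (G.Q * A.d 1 (A.w 1) + G.c * A.d 1 (A.w 0)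
    + A.d 0 G.Q) := by
  rw [G.phi_dx, G.map_v]
  simp only [map_add, map_sub, Derivation.leibniz, Derivation.leibniz_pow, smul_eq_mul, G.dxQ,
    G.dxPi, G.dxXt, G.dxc]
  linear_combination (G.Pi ^ 2 * (G.Q * A.d 1 (A.w 1) + G.c * A.d 1 (A.w 0) + A.d 0 G.Q)) * G.hQ

theorem phi_uxx : G.φ (A'.d 1 (A'.d 1 (A'.w 0))) = G.Pi * G.Qi * A.d 1 (A.d 1 (A.w 0)) := by
  rw [G.phi_dx, G.phi_ux]
  simp only [Derivation.leibniz, smul_eq_mul, G.dxPi]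
  ring

theorem phi_uxy : G.φ (A'.d 2 (A'.d 1 (A'.w 0))) = G.Pi ^ 2 * (A.d 2 (A.d 1 (A.w 0))
    - G.c * G.Qi * A.d 1 (A.d 1 (A.w 0))) := by
  rw [G.phi_dy, G.phi_ux]
  simp only [Derivation.leibniz, smul_eq_mul, G.dxPi, G.dyPi]
  ring

theorem phi_vxx : G.φ (A'.d 1 (A'.d 1 (A'.w 1))) = G.Pi ^ 2 * (A.d 1 (A.d 1 (A.w 1))
    + G.c * G.Qi * A.d 1 (A.d 1 (A.w 0))) := by
  have h : A.d 1 (A.d 0 G.Q) = 0 := by rw [A.comm, G.dxQ, map_zero]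
  rw [G.phi_dx, G.phi_vx]
  simp only [map_add, Derivation.leibniz, Derivation.leibniz_pow, smul_eq_mul, G.dxPi, G.dxQ,
    G.dxc, h]
  linear_combination (G.Pi ^ 2 * A.d 1 (A.d 1 (A.w 1))) * G.hQ

theorem phi_vxy : G.φ (A'.d 2 (A'.d 1 (A'.w 1))) = G.Pi ^ 3 * (G.Q * A.d 2 (A.d 1 (A.w 1))
    + G.c * A.d 2 (A.d 1 (A.w 0)) + A.d 0 G.Q * A.d 1 (A.w 0)
    - G.c * A.d 1 (A.d 1 (A.w 1)) - G.c ^ 2 * G.Qi * A.d 1 (A.d 1 (A.w 0))) := by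
  have h : A.d 2 (A.d 0 G.Q) = 0 := by rw [A.comm, G.dyQ, map_zero]
  rw [G.phi_dy, mul_assoc G.c, ← G.phi_dx, G.phi_vxx, G.phi_vx]
  simp only [map_add, Derivation.leibniz, Derivation.leibniz_pow, smul_eq_mul, G.dyPi, G.dyQ,
    G.dyc, h]
  ring

theorem phi_uyy : G.φ (A'.d 2 (A'.d 2 (A'.w 0))) = G.Pi ^ 3 * (G.Q * A.d 2 (A.d 2 (A.w 0))
    - 2 * G.c * A.d 2 (A.d 1 (A.w 0)) - A.d 0 G.Q * A.d 1 (A.w 0)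
    + G.c ^ 2 * G.Qi * A.d 1 (A.d 1 (A.w 0))) := by
  have h : A.d 2 (A.d 0 G.Q) = 0 := by rw [A.comm, G.dyQ, map_zero]
  have h' : A.d 2 (A.d 0 G.P) = 0 := by rw [A.comm, G.dyP, map_zero]
  rw [G.phi_dy, mul_assoc G.c, ← G.phi_dx, A'.comm 1 2, G.phi_uxy, G.phi_uy]
  simp only [map_add, map_sub, Derivation.leibniz, Derivation.leibniz_pow, smul_eq_mul, G.dyPi,
    G.dyQ, G.dyc, h, h', d_two]
  ring

theorem phi_utx : G.φ (A'.d 0 (A'.d 1 (A'.w 0))) = G.Pi ^ 2 * G.Q * (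
    G.Pi * A.d 0 (A.d 1 (A.w 0)) - G.Pi ^ 2 * A.d 0 G.P * A.d 1 (A.w 0)
    - G.Yt * (G.Pi ^ 2 * (A.d 2 (A.d 1 (A.w 0)) - G.c * G.Qi * A.d 1 (A.d 1 (A.w 0))))
    - G.Xt * (G.Pi * G.Qi * A.d 1 (A.d 1 (A.w 0)))) := by
  rw [G.phi_dt, ← G.phi_dy, ← G.phi_dx, G.phi_uxy, G.phi_uxx, G.phi_ux]
  simp only [Derivation.leibniz, smul_eq_mul, G.dtPi]
  ring

end PointMap

/-- A differential polynomial `f` is a relative invariant of the weight of `u_x^i u_xx^l`. -/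
def RelInv (i l : ℕ) (f : DiffPoly) : Prop :=
  ∀ {R' R : Type} [CommRing R'] [Algebra ℝ R'] [CommRing R] [Algebra ℝ R]
    {A' : DiffData R'} {A : DiffData R} (G : PointMap A' A),
    G.φ (A'.ev f) * (G.P ^ (i + l) * G.Q ^ l) = A.ev f

/-- The differential polynomial `u_x`. -/
def uxVar : DiffPoly := totalDeriv 1 uVar
/-- The differential polynomial `u_y`. -/
def uyVar : DiffPoly := totalDeriv 2 uVar
/-- The differential polynomial `v_x`. -/
def vxVar : DiffPoly := totalDeriv 1 vVar
/-- The differential polynomial `u_xx`. -/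
def uxxVar : DiffPoly := totalDeriv 1 uxVar
/-- The differential polynomial `u_xy`. -/
def uxyVar : DiffPoly := totalDeriv 2 uxVar

/-! ### The basic relative invariants and the covariant derivations. -/

theorem relInv_ux : RelInv 1 0 uxVar := by
  intro R' R _ _ _ _ A' A G
  simp only [uxVar, DiffData.ev_totalDeriv, DiffData.ev_uVar, G.phi_ux]
  linear_combination A.d 1 (A.w 0) * G.hP

theorem relInv_uxx : RelInv 0 1 uxxVar := by
  intro R' R _ _ _ _ A' A G
  simp only [uxxVar, uxVar, DiffData.ev_totalDeriv, DiffData.ev_uVar, G.phi_uxx]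
  linear_combination A.d 1 (A.d 1 (A.w 0)) * (G.Qi * G.Q * G.hP + G.hQ)

/-- The relative invariant `v_xx + u_xy`. -/
def relJ : DiffPoly := totalDeriv 1 vxVar + uxyVar

/-- The shifts of v_xx and u_xy by multiples of c u_xx are opposite to each other. -/
theorem relInv_relJ : RelInv 2 0 relJ := by
  intro R' R _ _ _ _ A' A G
  simp only [relJ, uxyVar, vxVar, uxVar, DiffData.ev_totalDeriv, DiffData.ev_uVar, map_add,
    DiffData.ev_vVar, G.phi_uxy, G.phi_vxx]
  linear_combination (A.d 1 (A.d 1 (A.w 1)) + A.d 2 (A.d 1 (A.w 0))) * (G.P * G.Pi + 1) * G.hP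

/-- The relative invariant `u_xx (u_yy + v_xy) - u_xy (u_xy + v_xx)`. -/
def relK : DiffPoly :=
  uxxVar * (totalDeriv 2 uyVar + totalDeriv 2 vxVar) - uxyVar * (uxyVar + totalDeriv 1 vxVar)

theorem PointMap.hP_pow {R' R : Type} [CommRing R'] [Algebra ℝ R'] [CommRing R] [Algebra ℝ R]
    {A' : DiffData R'} {A : DiffData R} (G : PointMap A' A) (n : ℕ) : G.P ^ n * G.Pi ^ n = 1 := by
  rw [← mul_pow, G.hP, one_pow]

/-- In u_yy + v_xy the terms with Q_t u_x and c^2 u_xx cancel, and the remaining shift is a multiple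
of c (u_xy + v_xx). After multiplication by u_xx it is absorbed by the shift of u_xy, the factor
u_xy + v_xx being relatively invariant. -/
theorem relInv_relK : RelInv 4 0 relK := by
  intro R' R _ _ _ _ A' A G
  simp only [relK, uxxVar, uxyVar, uyVar, vxVar, uxVar, DiffData.ev_totalDeriv, DiffData.ev_uVar,
    map_add, map_sub, map_mul, DiffData.ev_vVar, G.phi_uxy, G.phi_vxx, G.phi_uxx, G.phi_uyy,
    G.phi_vxy]
  have h4 := G.hP_pow 4
  generalize A.d 1 (A.d 1 (A.w 0)) = uxx
  generalize A.d 2 (A.d 2 (A.w 0)) = uyy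
  generalize A.d 2 (A.d 1 (A.w 0)) = uxy
  generalize A.d 2 (A.d 1 (A.w 1)) = vxy
  generalize A.d 1 (A.d 1 (A.w 1)) = vxx
  linear_combination (uxx * (uyy + vxy) - uxy * (uxy + vxx)) * h4 +
    G.P ^ 4 * G.Pi ^ 4 * uxx * (uyy + vxy) * G.hQ

/-- The derivation `u_x D_x` of relative invariants. -/
def opX (f : DiffPoly) : DiffPoly := uxVar * totalDeriv 1 f

/-- The derivation `u_xx D_y - u_xy D_x` of relative invariants. -/
def opY (f : DiffPoly) : DiffPoly := uxxVar * totalDeriv 2 f - uxyVar * totalDeriv 1 f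

/-- The covariant derivative in the direction of `t` of relative invariants of the weight of
`u_x^i u_xx^l`. -/
def opT (i l : ℕ) (f : DiffPoly) : DiffPoly :=
  uxxVar ^ 2 * totalDeriv 0 f + (uVar * uxxVar ^ 2 - 2 * uxyVar * uxxVar) * totalDeriv 2 f
    + (vVar * uxxVar ^ 2 + uxyVar ^ 2) * totalDeriv 1 f
    + ((i + l : ℕ) * (uxxVar ^ 2 * (uyVar + 2 * vxVar) + uxVar * uxyVar * uxxVar)
      + (l : ℕ) * (uxxVar ^ 2 * vxVar + uxxVar * uxyVar * uxVar)) * f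

/-- The weight factor does not depend on x, so D_x f is only rescaled; the factor u_x brings the
weight of the derivation to that of u_xx. -/
theorem RelInv.opX {i l : ℕ} {f : DiffPoly} (hf : RelInv i l f) : RelInv i (l + 1) (opX f) := by
  intro R' R _ _ _ _ A' A G
  have h := congrArg (A.d 1) (hf G)
  simp only [Derivation.leibniz, Derivation.leibniz_pow, smul_eq_mul, G.dxP, G.dxQ, mul_zero,
    smul_zero, add_zero, zero_add] at h
  simp only [ManakovSantini.opX, uxVar, map_mul, DiffData.ev_totalDeriv, DiffData.ev_uVar, G.phi_ux,
    G.phi_dx, ← h]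
  linear_combination (A.d 1 (A.w 0) * G.P ^ (i + l) * G.Q ^ l * A.d 1 (G.φ (A'.ev f))) *
    (G.Qi * G.Q * G.hP + G.hQ)

/-- The derivation D_y acquires a multiple of c D_x, which the shift of u_xy by a multiple of c u_xx
cancels. -/
theorem RelInv.opY {i l : ℕ} {f : DiffPoly} (hf : RelInv i l f) :
    RelInv (i + 1) (l + 1) (opY f) := by
  intro R' R _ _ _ _ A' A G
  have h := congrArg (A.d 1) (hf G)
  have h' := congrArg (A.d 2) (hf G)
  simp only [Derivation.leibniz, Derivation.leibniz_pow, smul_eq_mul, G.dxP, G.dxQ, G.dyP, G.dyQ,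
    mul_zero, smul_zero, add_zero, zero_add] at h h'
  simp only [ManakovSantini.opY, uxVar, uxyVar, uxxVar, map_mul, map_sub, DiffData.ev_totalDeriv,
    DiffData.ev_uVar, G.phi_dx (A'.ev f), G.phi_dy (A'.ev f), G.phi_uxx, G.phi_uxy, ← h, ← h']
  linear_combination ((A.d 1 (A.d 1 (A.w 0)) * A.d 2 (G.φ (A'.ev f)) -
    A.d 2 (A.d 1 (A.w 0)) * A.d 1 (G.φ (A'.ev f))) * G.P ^ (i + l) * G.Q ^ l) *
    (G.Qi * G.Q * (G.P * G.Pi + 1) * G.hP + G.hQ)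

theorem PointMap.dt_pow {R' R : Type} [CommRing R'] [Algebra ℝ R'] [CommRing R] [Algebra ℝ R]
    {A' : DiffData R'} {A : DiffData R} (G : PointMap A' A) (m l : ℕ) :
    A.d 0 (G.P ^ m * G.Q ^ l) =
      G.P ^ m * G.Q ^ l * (m * (G.Pi * A.d 0 G.P) + l * (G.Qi * A.d 0 G.Q)) := by
  have h : ∀ {a b : R} (_ : a * b = 1) (n : ℕ), A.d 0 (a ^ n) = a ^ n * (n * (b * A.d 0 a)) := by
    intro a b hab n
    rw [Derivation.leibniz_pow]
    cases n with
    | zero => simp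
    | succ n =>
      simp only [Nat.add_sub_cancel, smul_eq_mul, nsmul_eq_mul]
      linear_combination -(a ^ n * (n + 1 : ℕ) * A.d 0 a) * hab
  rw [Derivation.leibniz, h G.hP, h G.hQ]
  simp only [smul_eq_mul]
  ring

/-- The vector field is u_xx^2 times D_t + u D_y + v D_x, corrected by u_xy / u_xx to remove c; the
inhomogeneous terms of u and v absorb Y_t and X_t. The weight factor depends on t, so D_t f also
produces logarithmic derivatives of P and Q times f. The law of u_y + 2 v_x contains that of P and
the law of v_x that of Q; the terms with u_x u_xy remove the remaining multiples of c u_x. -/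
theorem RelInv.opT {i l : ℕ} {f : DiffPoly} (hf : RelInv i l f) :
    RelInv (i + 3) (l + 1) (opT i l f) := by
  intro R' R _ _ _ _ A' A G
  have hx := congrArg (A.d 1) (hf G)
  have hy := congrArg (A.d 2) (hf G)
  have ht := congrArg (A.d 0) (hf G)
  rw [Derivation.leibniz, G.dt_pow] at ht
  simp only [Derivation.leibniz, Derivation.leibniz_pow, smul_eq_mul, G.dxP, G.dxQ, G.dyP, G.dyQ,
    mul_zero, smul_zero, add_zero, zero_add] at hx hy ht
  have h2' : A'.ev 2 = 2 := map_ofNat _ 2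
  have h2 : A.ev 2 = 2 := map_ofNat _ 2
  have h2G : G.φ 2 = 2 := map_ofNat _ 2
  simp only [ManakovSantini.opT, uxVar, uxyVar, uxxVar, uyVar, vxVar, map_mul, map_sub, map_add,
    map_pow, map_natCast, h2, h2', h2G,
    DiffData.ev_totalDeriv, DiffData.ev_uVar, DiffData.ev_vVar, G.phi_dt (A'.ev f),
    G.phi_dx (A'.ev f), G.phi_dy (A'.ev f), G.phi_uxx, G.phi_uxy, G.phi_uy, G.phi_vx, G.phi_ux,
    G.map_u, G.map_v]
  rw [← hx, ← hy, ← ht, ← hf G]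
  have hP := G.hP_pow 4
  have hQ : ∀ z, G.Qi * (G.Q * z) = z := fun z => by linear_combination z * G.hQ
  have hQ' : ∀ y z, y * G.Qi * (G.Q * z) = y * z := fun y z => by linear_combination y * z * G.hQ
  -- As Q is a unit, each quantity that meets `Qi` can be written as a multiple of Q. This
  -- eliminates `Qi` and leaves a polynomial identity modulo P^4 Pi^4 = 1.
  have ex : ∀ z, ∃ y, z = G.Q * y := fun z => ⟨G.Qi * z, by linear_combination -z * G.hQ⟩
  have e : G.P ^ (i + 3 + (l + 1)) * G.Q ^ (l + 1) = G.P ^ 4 * G.Q * (G.P ^ (i + l) * G.Q ^ l) := by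
    ring
  rw [e]
  generalize G.P ^ (i + l) * G.Q ^ l = W
  obtain ⟨fx, hfx⟩ := ex (A.d 1 (G.φ (A'.ev f)))
  obtain ⟨uxx, huxx⟩ := ex (A.d 1 (A.d 1 (A.w 0)))
  obtain ⟨Qt, hQt⟩ := ex (A.d 0 G.Q)
  rw [hfx, huxx, hQt]
  simp only [hQ, hQ']
  linear_combination ((G.Q * uxx) ^ 2 *
        (G.φ (A'.ev f) * (W * ((i + l : ℕ) * (G.Pi * A.d 0 G.P) + l * Qt)) +
          W * A.d 0 (G.φ (A'.ev f))) +
      (A.w 0 * (G.Q * uxx) ^ 2 - 2 * A.d 2 (A.d 1 (A.w 0)) * (G.Q * uxx)) *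
        (W * A.d 2 (G.φ (A'.ev f))) +
      (A.w 1 * (G.Q * uxx) ^ 2 + A.d 2 (A.d 1 (A.w 0)) ^ 2) * (W * (G.Q * fx)) +
      ((i + l : ℕ) * ((G.Q * uxx) ^ 2 * (A.d 2 (A.w 0) + 2 * A.d 1 (A.w 1)) +
          A.d 1 (A.w 0) * A.d 2 (A.d 1 (A.w 0)) * (G.Q * uxx)) +
        l * ((G.Q * uxx) ^ 2 * A.d 1 (A.w 1) +
          (G.Q * uxx) * A.d 2 (A.d 1 (A.w 0)) * A.d 1 (A.w 0))) * (G.φ (A'.ev f) * W)) * hP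

/-! ### Invariance of the equation -/

theorem PointMap.phi_msEquation_zero {R' R : Type} [CommRing R'] [Algebra ℝ R'] [CommRing R]
    [Algebra ℝ R] {A' : DiffData R'} {A : DiffData R} (G : PointMap A' A) :
    G.φ (A'.ev (msEquation 0)) = G.Pi ^ 3 * G.Q * A.ev (msEquation 0) := by
  have ex : ∀ z, ∃ y, z = G.Q * y := fun z => ⟨G.Qi * z, by linear_combination -z * G.hQ⟩
  have hQ' : ∀ y z, y * G.Qi * (G.Q * z) = y * z := fun y z => by linear_combination y * z * G.hQ
  simp only [msEquation, Matrix.cons_val_zero, map_add, map_sub, map_mul, DiffData.ev_totalDeriv,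
    DiffData.ev_uVar, DiffData.ev_vVar, Derivation.leibniz, smul_eq_mul]
  rw [A'.comm 1 0, A'.comm 1 2, A.comm 1 0, A.comm 1 2]
  rw [G.phi_utx, G.phi_uxx, G.phi_uxy, G.phi_uyy, G.phi_vx, G.phi_ux, G.phi_uy, G.map_u, G.map_v]
  obtain ⟨uxx, huxx⟩ := ex (A.d 1 (A.d 1 (A.w 0)))
  rw [huxx]
  simp only [hQ']
  ring

theorem PointMap.phi_vtx {R' R : Type} [CommRing R'] [Algebra ℝ R'] [CommRing R]
    [Algebra ℝ R] {A' : DiffData R'} {A : DiffData R} (G : PointMap A' A) :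
    G.φ (A'.d 0 (A'.d 1 (A'.w 1))) = G.Pi ^ 2 * G.Q * (
      A.d 0 (G.Pi ^ 2 * (G.Q * A.d 1 (A.w 1) + G.c * A.d 1 (A.w 0) + A.d 0 G.Q))
      - G.Yt * (G.Pi ^ 3 * (G.Q * A.d 2 (A.d 1 (A.w 1))
    + G.c * A.d 2 (A.d 1 (A.w 0)) + A.d 0 G.Q * A.d 1 (A.w 0)
    - G.c * A.d 1 (A.d 1 (A.w 1)) - G.c ^ 2 * G.Qi * A.d 1 (A.d 1 (A.w 0))))
      - G.Xt * (G.Pi ^ 2 * (A.d 1 (A.d 1 (A.w 1))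
    + G.c * G.Qi * A.d 1 (A.d 1 (A.w 0))))) := by
  rw [G.phi_dt, ← G.phi_dy, ← G.phi_dx, G.phi_vxy, G.phi_vxx, G.phi_vx]

theorem PointMap.phi_vy {R' R : Type} [CommRing R'] [Algebra ℝ R'] [CommRing R]
    [Algebra ℝ R] {A' : DiffData R'} {A : DiffData R} (G : PointMap A' A) :
    G.φ (A'.d 2 (A'.w 1)) = G.Pi * (G.Q ^ 2 * G.Pi ^ 2 * A.d 2 (A.w 1)
      + G.Q * G.Pi ^ 2 * (A.d 0 G.Q * A.w 0 + G.c * A.d 2 (A.w 0))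
      + G.Q * G.Pi ^ 2 * A.d 0 G.c - 2 * G.c * A.d 0 G.Q * G.Pi ^ 2
      - G.c * (G.Pi ^ 2 * (G.Q * A.d 1 (A.w 1) + G.c * A.d 1 (A.w 0) + A.d 0 G.Q))) := by
  rw [G.phi_dy, mul_assoc G.c, ← G.phi_dx, G.phi_vx, G.map_v]
  simp only [map_add, map_sub, Derivation.leibniz, Derivation.leibniz_pow, smul_eq_mul, G.dyQ,
    G.dyPi, G.dyXt, G.dyc]
  ring

theorem PointMap.phi_vyy {R' R : Type} [CommRing R'] [Algebra ℝ R'] [CommRing R]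
    [Algebra ℝ R] {A' : DiffData R'} {A : DiffData R} (G : PointMap A' A) :
    G.φ (A'.d 2 (A'.d 2 (A'.w 1))) = G.Pi ^ 4 * (G.Q ^ 2 * A.d 2 (A.d 2 (A.w 1))
      + G.Q * (2 * A.d 0 G.Q * A.d 2 (A.w 0) + G.c * A.d 2 (A.d 2 (A.w 0)))
      + G.Q * A.d 0 (A.d 0 G.Q) - 2 * A.d 0 G.Q ^ 2
      - A.d 0 G.Q * (G.Q * A.d 1 (A.w 1) + G.c * A.d 1 (A.w 0) + A.d 0 G.Q)
      - G.c * (G.Q * A.d 2 (A.d 1 (A.w 1)) + A.d 0 G.Q * A.d 1 (A.w 0)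
        + G.c * A.d 2 (A.d 1 (A.w 0)))
      - G.c * (G.Q * A.d 2 (A.d 1 (A.w 1))
    + G.c * A.d 2 (A.d 1 (A.w 0)) + A.d 0 G.Q * A.d 1 (A.w 0)
    - G.c * A.d 1 (A.d 1 (A.w 1)) - G.c ^ 2 * G.Qi * A.d 1 (A.d 1 (A.w 0)))) := by
  have h : A.d 2 (A.d 0 G.Q) = 0 := by rw [A.comm, G.dyQ, map_zero]
  have h' : A.d 2 (A.d 0 G.c) = A.d 0 (A.d 0 G.Q) := by rw [A.comm, G.dyc]
  rw [G.phi_dy, mul_assoc G.c, ← G.phi_dx, A'.comm 1 2, G.phi_vxy, G.phi_vy]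
  simp only [map_add, map_sub, Derivation.leibniz, Derivation.leibniz_pow, smul_eq_mul, G.dyQ,
    G.dyPi, G.dyc, h, h', PointMap.d_two]
  ring

/-- The term c u in the law of v mixes the first equation into the second. Only the system as a
whole is invariant, which suffices for the preservation of 𝓔_k. -/
theorem PointMap.phi_msEquation_one {R' R : Type} [CommRing R'] [Algebra ℝ R'] [CommRing R]
    [Algebra ℝ R] {A' : DiffData R'} {A : DiffData R} (G : PointMap A' A) :
    G.φ (A'.ev (msEquation 1)) = G.Pi ^ 4 * G.Q ^ 2 * A.ev (msEquation 1)
      + G.Pi ^ 4 * G.Q * G.c * A.ev (msEquation 0) := by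
  have ex : ∀ z, ∃ y, z = G.Q * y := fun z => ⟨G.Qi * z, by linear_combination -z * G.hQ⟩
  have hQ' : ∀ y z, y * G.Qi * (G.Q * z) = y * z := fun y z => by linear_combination y * z * G.hQ
  have h2' : A'.ev 2 = 2 := map_ofNat _ 2
  have h2 : A.ev 2 = 2 := map_ofNat _ 2
  have h2G : G.φ 2 = 2 := map_ofNat _ 2
  simp only [msEquation, Matrix.cons_val_zero, Matrix.cons_val_one, map_add, map_sub, map_mul,
    DiffData.ev_totalDeriv, h2, h2', h2G, map_zero,
    DiffData.ev_uVar, DiffData.ev_vVar, Derivation.leibniz, smul_eq_mul, PointMap.d_two]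
  rw [A'.comm 1 0, A'.comm 1 2, A.comm 1 0, A.comm 1 0, A.comm 1 2, A.comm 1 2]
  rw [G.phi_vtx, G.phi_vxx, G.phi_vxy, G.phi_vyy, G.phi_vx, G.phi_ux, G.phi_uy, G.phi_vy, G.map_u,
    G.map_v]
  simp only [map_add, Derivation.leibniz, Derivation.leibniz_pow, smul_eq_mul, G.dtPi]
  obtain ⟨uxx, huxx⟩ := ex (A.d 1 (A.d 1 (A.w 0)))
  rw [huxx]
  simp only [hQ']
  ring

end

end ManakovSantini

namespace ManakovSantini

noncomputable section

/-! ### Leading coordinates -/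

open MvPolynomial (pderiv)

/-- The ranking of the free coordinates: by order, then by dependent variable, then by the weighted
order in which `t` counts twice, `y` once and `x` not at all. -/
def freeKey : FreeCoord → ℕ ×ₗ ℕ ×ₗ ℕ
  | Sum.inl i => toLex (0, toLex (2 + i.val, 0))
  | Sum.inr (a, α, β, γ) => toLex (α + β + γ.toNat, toLex (a.val, 2 * α + γ.toNat))

theorem key_le_iff {k a d k' a' d' : ℕ} :
    (toLex (k, toLex (a, d)) : ℕ ×ₗ ℕ ×ₗ ℕ) ≤ toLex (k', toLex (a', d')) ↔
      k < k' ∨ k = k' ∧ (a < a' ∨ a = a' ∧ d ≤ d') := by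
  simp [Prod.Lex.toLex_le_toLex]

theorem key_lt_iff {k a d k' a' d' : ℕ} :
    (toLex (k, toLex (a, d)) : ℕ ×ₗ ℕ ×ₗ ℕ) < toLex (k', toLex (a', d')) ↔
      k < k' ∨ k = k' ∧ (a < a' ∨ a = a' ∧ d < d') := by
  simp [Prod.Lex.toLex_lt_toLex]

theorem exists_key (κ : ℕ ×ₗ ℕ ×ₗ ℕ) : ∃ k a d, κ = toLex (k, toLex (a, d)) :=
  ⟨κ.1, κ.2.1, κ.2.2, rfl⟩

theorem key_eq_iff {k a d k' a' d' : ℕ} :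
    (toLex (k, toLex (a, d)) : ℕ ×ₗ ℕ ×ₗ ℕ) = toLex (k', toLex (a', d')) ↔
      k = k' ∧ a = a' ∧ d = d' := by
  simp

/-- The parity of 2α + γ recovers γ, then α is determined, and the order determines β. The base
coordinates use the second entries 2, 3, 4, beyond those of the dependent variables. -/
theorem freeKey_injective : Function.Injective freeKey := by
  rintro (i | ⟨a, α, β, γ⟩) (j | ⟨a', α', β', γ'⟩) h <;> simp only [freeKey, key_eq_iff] at h
  · congr 1; omega
  · have := a'.2; omega
  · have := a.2; omega
  · have h1 : a = a' := by omega
    have h2 : γ = γ' := by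
      have h3 := h.2.2
      cases γ <;> cases γ' <;> simp at h3 ⊢ <;> omega
    subst h1 h2
    have h3 : α = α' := by omega
    have h4 : β = β' := by omega
    rw [h3, h4]

/-- The ranking of total derivatives. -/
def shiftKey (s : ℕ) (κ : ℕ ×ₗ ℕ ×ₗ ℕ) : ℕ ×ₗ ℕ ×ₗ ℕ :=
  toLex ((ofLex κ).1 + 1, toLex ((ofLex (ofLex κ).2).1, (ofLex (ofLex κ).2).2 + s))

theorem shiftKey_toLex (s k a d : ℕ) :
    shiftKey s (toLex (k, toLex (a, d))) = toLex (k + 1, toLex (a, d + s)) := rfl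

theorem shiftKey_le_iff {s : ℕ} {κ κ' : ℕ ×ₗ ℕ ×ₗ ℕ} : shiftKey s κ ≤ shiftKey s κ' ↔ κ ≤ κ' := by
  obtain ⟨k, a, d, rfl⟩ := exists_key κ
  obtain ⟨k', a', d', rfl⟩ := exists_key κ'
  simp only [shiftKey_toLex, key_le_iff]
  omega

theorem lt_shiftKey (s : ℕ) (κ : ℕ ×ₗ ℕ ×ₗ ℕ) : κ < shiftKey s κ := by
  obtain ⟨k, a, d, rfl⟩ := exists_key κ
  simp only [shiftKey_toLex, key_lt_iff]
  omega

/-- The polynomials in coordinates of rank at most `κ`. -/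
def keyLE (κ : ℕ ×ₗ ℕ ×ₗ ℕ) : Subalgebra ℝ FreePoly where
  carrier := {f | ∀ ζ, κ < freeKey ζ → pderiv ζ f = 0}
  mul_mem' := by
    intro f g hf hg ζ hζ
    rw [Derivation.leibniz, hf ζ hζ, hg ζ hζ, smul_zero, smul_zero, add_zero]
  add_mem' := by
    intro f g hf hg ζ hζ
    rw [map_add, hf ζ hζ, hg ζ hζ, add_zero]
  algebraMap_mem' r := fun _ _ => Derivation.map_algebraMap _ r

theorem mem_keyLE {κ : ℕ ×ₗ ℕ ×ₗ ℕ} {f : FreePoly} :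
    f ∈ keyLE κ ↔ ∀ ζ, κ < freeKey ζ → pderiv ζ f = 0 := Iff.rfl

theorem keyLE_mono {κ κ' : ℕ ×ₗ ℕ ×ₗ ℕ} (h : κ ≤ κ') : keyLE κ ≤ keyLE κ' :=
  fun _ hf ζ hζ => hf ζ (lt_of_le_of_lt h hζ)

theorem X_mem_keyLE {κ : ℕ ×ₗ ℕ ×ₗ ℕ} {z : FreeCoord} (h : freeKey z ≤ κ) :
    (MvPolynomial.X z : FreePoly) ∈ keyLE κ := fun ζ hζ =>
  MvPolynomial.pderiv_X_of_ne (fun e => absurd (e ▸ hζ) (not_lt.mpr h))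

theorem derivation_eq_sum {σ : Type*} (D : Derivation ℝ (MvPolynomial σ ℝ) (MvPolynomial σ ℝ))
    (f : MvPolynomial σ ℝ) : D f = ∑ z ∈ f.vars, pderiv z f * D (MvPolynomial.X z) := by
  classical
  let E : Derivation ℝ (MvPolynomial σ ℝ) (MvPolynomial σ ℝ) :=
    ∑ z ∈ f.vars, D (MvPolynomial.X z) • pderiv z
  have hE : ∀ g, E g = ∑ z ∈ f.vars, D (MvPolynomial.X z) * pderiv z g := by
    intro g
    have : (Derivation.coeFnAddMonoidHom E : MvPolynomial σ ℝ → MvPolynomial σ ℝ) =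
        ∑ z ∈ f.vars, Derivation.coeFnAddMonoidHom (D (MvPolynomial.X z) • pderiv z) :=
      map_sum _ _ _
    have h := congrFun this g
    rw [Finset.sum_apply] at h
    exact h
  have : D f = E f := by
    refine MvPolynomial.derivation_eq_of_forall_mem_vars (fun (i : σ) hi => ?_)
    rw [hE (MvPolynomial.X i : MvPolynomial σ ℝ), Finset.sum_eq_single i]
    · rw [MvPolynomial.pderiv_X_self, mul_one]
    · intro j _ hj
      rw [MvPolynomial.pderiv_X_of_ne hj.symm, mul_zero]
    · exact fun h => absurd hi h
  rw [this, hE]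
  exact Finset.sum_congr rfl fun z _ => mul_comm _ _

/-- A derivation raising ranks by `shiftKey s`. -/
def Raises (s : ℕ) (D : Derivation ℝ FreePoly FreePoly) : Prop :=
  ∀ z ζ, pderiv ζ (D (MvPolynomial.X z)) ≠ 0 → freeKey ζ ≤ shiftKey s (freeKey z)

/-- The commutator of ∂_ζ and D is a derivation whose value at a variable X_z is ∂_ζ (D X_z),
because D kills the constant ∂_ζ X_z. -/
theorem pderiv_derivation (D : Derivation ℝ FreePoly FreePoly) (ζ : FreeCoord) (f : FreePoly) :
    pderiv ζ (D f) = D (pderiv ζ f) +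
      ∑ z ∈ f.vars, pderiv z f * pderiv ζ (D (MvPolynomial.X z)) := by
  have h := derivation_eq_sum ⁅(pderiv ζ : Derivation ℝ FreePoly FreePoly), D⁆ f
  have h2 : ∀ z, ⁅(pderiv ζ : Derivation ℝ FreePoly FreePoly), D⁆ (MvPolynomial.X z) =
      pderiv ζ (D (MvPolynomial.X z)) := by
    intro z
    classical
    rw [Derivation.commutator_apply, MvPolynomial.pderiv_X, sub_eq_self]
    by_cases hz : ζ = z
    · subst hz; simp
    · rw [Pi.single_eq_of_ne (Ne.symm hz), map_zero]
  simp only [h2] at h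
  rw [← h, Derivation.commutator_apply]
  ring

theorem Raises.mem_keyLE {s : ℕ} {D : Derivation ℝ FreePoly FreePoly} (hD : Raises s D)
    {κ : ℕ ×ₗ ℕ ×ₗ ℕ} {f : FreePoly} (hf : f ∈ keyLE κ) : D f ∈ keyLE (shiftKey s κ) := by
  intro ζ hζ
  rw [pderiv_derivation, hf ζ ((lt_shiftKey s κ).trans hζ), map_zero, zero_add]
  refine Finset.sum_eq_zero fun z _ => ?_
  by_contra hne
  have h1 := hD z ζ (right_ne_zero_of_mul hne)
  have h2 : freeKey z ≤ κ := by
    by_contra hlt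
    exact left_ne_zero_of_mul hne (hf z (not_le.mp hlt))
  exact absurd (h1.trans (shiftKey_le_iff.mpr h2)) (not_le.mpr hζ)

/-- As in differential algebra, D f is governed at its top derivative by the separant ∂f/∂z. The
shift is strictly monotone in the rank, so no coordinate below z contributes to ζ. -/
theorem Raises.pderiv_lead {s : ℕ} {D : Derivation ℝ FreePoly FreePoly} (hD : Raises s D)
    {z ζ : FreeCoord} {f : FreePoly} (hf : f ∈ keyLE (freeKey z))
    (hζ : freeKey ζ = shiftKey s (freeKey z)) :
    pderiv ζ (D f) = pderiv z f * pderiv ζ (D (MvPolynomial.X z)) := by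
  rw [pderiv_derivation, hf ζ (hζ ▸ lt_shiftKey s _), map_zero, zero_add]
  refine Finset.sum_eq_single z (fun z' _ hne => ?_) fun hz => ?_
  · by_contra h0
    have h1 := hD z' ζ (right_ne_zero_of_mul h0)
    rw [hζ, shiftKey_le_iff] at h1
    have h2 : freeKey z' ≤ freeKey z := by
      by_contra hlt
      exact left_ne_zero_of_mul h0 (hf z' (not_le.mp hlt))
    exact hne (freeKey_injective (le_antisymm h2 h1))
  · rw [MvPolynomial.pderiv_eq_zero_of_notMem_vars hz, zero_mul]

theorem pderiv_const_ite (ζ : FreeCoord) (p : Prop) [Decidable p] :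
    pderiv ζ (if p then 1 else 0 : FreePoly) = 0 := by
  split_ifs <;> simp

theorem eq_of_pderiv_X_ne_zero {z ζ : FreeCoord}
    (h : pderiv ζ (MvPolynomial.X z : FreePoly) ≠ 0) : z = ζ := by
  by_contra hne
  exact h (MvPolynomial.pderiv_X_of_ne hne)

theorem raises_freeDt : Raises 2 freeDt := by
  rintro (j | ⟨a, α, β, γ⟩) ζ h
  · rw [freeDt_inl, pderiv_const_ite] at h; exact absurd rfl h
  · rw [freeDt_freeX] at h
    rw [← eq_of_pderiv_X_ne_zero h]
    simp only [freeKey, shiftKey_toLex, key_le_iff, true_and]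
    omega

theorem raises_freeDx : Raises 0 freeDx := by
  rintro (j | ⟨a, α, β, γ⟩) ζ h
  · rw [freeDx_inl, pderiv_const_ite] at h; exact absurd rfl h
  · rw [freeDx_freeX] at h
    rw [← eq_of_pderiv_X_ne_zero h]
    simp only [freeKey, shiftKey_toLex, key_le_iff, true_and]
    omega

/-- The right-hand side is led by the mixed t, x derivative of the same unknown. Derivatives of the
other unknown that occur are of order at most 1, so comparing orders first places them lower. -/
theorem solvedRHS_mem_keyLE (a : Fin 2) : solvedRHS a ∈ keyLE (toLex (2, toLex (a.val, 2))) := by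
  have h : ∀ (a' : Fin 2) (α β : ℕ) (γ : Bool), freeKey (Sum.inr (a', α, β, γ)) ≤
      toLex (2, toLex (a.val, 2)) → freeX a' α β γ ∈ keyLE (toLex (2, toLex (a.val, 2))) :=
    fun a α β γ h => X_mem_keyLE h
  rw [solvedRHS]
  split_ifs with ha
  · subst ha
    refine add_mem (add_mem (add_mem (add_mem ?_ (mul_mem ?_ ?_)) (mul_mem ?_ ?_))
      (mul_mem ?_ ?_)) (mul_mem ?_ ?_) <;> exact h _ _ _ _ (by simp [freeKey, key_le_iff])
  · have ha : a = 1 := by omega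
    subst ha
    refine add_mem (add_mem (sub_mem (add_mem (add_mem ?_ (pow_mem ?_ 2)) (mul_mem ?_ ?_))
      (mul_mem ?_ ?_)) (mul_mem ?_ ?_)) (mul_mem (mul_mem (ofNat_mem _ 2) ?_) ?_) <;>
      exact h _ _ _ _ (by simp [freeKey, key_le_iff])

theorem pderiv_solvedRHS (a : Fin 2) :
    pderiv (Sum.inr (a, 1, 1, false)) (solvedRHS a) = 1 := by
  have hX : ∀ (a' : Fin 2) (α β : ℕ) (γ : Bool),
      (a, 1, 1, false) ≠ (a', α, β, γ) →
        pderiv (Sum.inr (a, 1, 1, false)) (freeX a' α β γ) = 0 := fun a' α β γ h =>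
    MvPolynomial.pderiv_X_of_ne fun e => h (Sum.inr.inj e).symm
  have h2 : pderiv (Sum.inr (a, 1, 1, false)) (2 : FreePoly) = 0 := Derivation.map_natCast _ 2
  rw [solvedRHS]
  split_ifs with ha
  · subst ha
    simp [Derivation.leibniz, hX]
  · have ha : a = 1 := by omega
    subst ha
    simp [Derivation.leibniz, hX, h2, pow_two]

theorem iterate_freeDx_lead (a : Fin 2) (β : ℕ) :
    freeDx^[β] (solvedRHS a) ∈ keyLE (toLex (2 + β, toLex (a.val, 2))) ∧
      pderiv (Sum.inr (a, 1, β + 1, false)) (freeDx^[β] (solvedRHS a)) = 1 := by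
  induction β with
  | zero => exact ⟨solvedRHS_mem_keyLE a, pderiv_solvedRHS a⟩
  | succ β ih =>
    rw [Function.iterate_succ_apply']
    refine ⟨raises_freeDx.mem_keyLE ih.1, ?_⟩
    have hk : freeKey (Sum.inr (a, 1, β + 1, false)) = toLex (2 + β, toLex (a.val, 2)) := by
      simp [freeKey]; omega
    rw [raises_freeDx.pderiv_lead (z := Sum.inr (a, 1, β + 1, false)) (hk ▸ ih.1) (by
      simp [freeKey, shiftKey_toLex]; omega), ih.2, freeDx_freeX, MvPolynomial.pderiv_X_self, one_mul]

theorem iterate_freeDt_lead (a : Fin 2) (α β : ℕ) :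
    freeDt^[α] (freeDx^[β] (solvedRHS a)) ∈
        keyLE (toLex (2 + β + α, toLex (a.val, 2 + 2 * α))) ∧
      pderiv (Sum.inr (a, α + 1, β + 1, false)) (freeDt^[α] (freeDx^[β] (solvedRHS a))) = 1 := by
  induction α with
  | zero => exact iterate_freeDx_lead a β
  | succ α ih =>
    rw [Function.iterate_succ_apply']
    refine ⟨raises_freeDt.mem_keyLE ih.1, ?_⟩
    have hk : freeKey (Sum.inr (a, α + 1, β + 1, false)) =
        toLex (2 + β + α, toLex (a.val, 2 + 2 * α)) := by
      simp [freeKey]; omega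
    rw [raises_freeDt.pderiv_lead (z := Sum.inr (a, α + 1, β + 1, false)) (hk ▸ ih.1) (by
      simp [freeKey, shiftKey_toLex]; omega), ih.2, freeDt_freeX, MvPolynomial.pderiv_X_self, one_mul]

/-- The weights 2, 0, 1 of t, x, y are chosen so that u_yy and its replacement u_tx have equal
weight. A y-derivative therefore shifts the rank by the same amount whether or not an elimination
takes place. -/
theorem raises_freeDy : Raises 1 freeDy := by
  rintro (j | ⟨a, α, β, γ⟩) ζ h
  · rw [freeDy_inl, pderiv_const_ite] at h; exact absurd rfl h
  · cases γ
    · rw [freeDy_freeX_false] at h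
      rw [← eq_of_pderiv_X_ne_zero h]
      simp [freeKey, shiftKey_toLex, key_le_iff]
    · rw [freeDy_freeX_true] at h
      have h1 : freeKey ζ ≤ _ := not_lt.mp fun hlt => h ((iterate_freeDt_lead a α β).1 ζ hlt)
      refine h1.trans ?_
      simp only [freeKey, shiftKey_toLex, key_le_iff, true_and, Bool.toNat_true]
      omega

/-- `f` is a polynomial with leading coordinate `z`. -/
def HasLead (f : FreePoly) (z : FreeCoord) : Prop := f ∈ keyLE (freeKey z) ∧ pderiv z f ≠ 0

theorem HasLead.mul_add {f c r : FreePoly} {z : FreeCoord} {κ : ℕ ×ₗ ℕ ×ₗ ℕ} (hf : HasLead f z)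
    (hc : c ≠ 0) (hκ : κ < freeKey z) (hcκ : c ∈ keyLE κ) (hr : r ∈ keyLE κ) :
    HasLead (c * f + r) z := by
  refine ⟨add_mem (mul_mem (keyLE_mono hκ.le hcκ) hf.1) (keyLE_mono hκ.le hr), ?_⟩
  rw [map_add, hr z hκ, Derivation.leibniz, hcκ z hκ, add_zero, smul_zero, add_zero, smul_eq_mul]
  exact mul_ne_zero hc hf.2

theorem Raises.hasLead {s : ℕ} {D : Derivation ℝ FreePoly FreePoly} (hD : Raises s D)
    {f : FreePoly} {z ζ : FreeCoord} (hf : HasLead f z)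
    (hζ : freeKey ζ = shiftKey s (freeKey z)) (h : D (MvPolynomial.X z) = MvPolynomial.X ζ) :
    HasLead (D f) ζ := by
  refine ⟨hζ ▸ hD.mem_keyLE hf.1, ?_⟩
  rw [hD.pderiv_lead hf.1 hζ, h, MvPolynomial.pderiv_X_self, mul_one]
  exact hf.2

/-! ### Relative invariants with prescribed leading coordinate. -/

theorem restrictFree_uVar : restrictFree uVar = freeX 0 0 0 false := evJet_inr 0 0
theorem restrictFree_vVar : restrictFree vVar = freeX 1 0 0 false := evJet_inr 1 0

theorem restrictFree_d0 (f : DiffPoly) : restrictFree (totalDeriv 0 f) = freeDt (restrictFree f) :=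
  restrictFree_totalDeriv 0 f
theorem restrictFree_d1 (f : DiffPoly) : restrictFree (totalDeriv 1 f) = freeDx (restrictFree f) :=
  restrictFree_totalDeriv 1 f
theorem restrictFree_d2 (f : DiffPoly) : restrictFree (totalDeriv 2 f) = freeDy (restrictFree f) :=
  restrictFree_totalDeriv 2 f

theorem restrictFree_uxVar : restrictFree uxVar = freeX 0 0 1 false := by
  rw [uxVar, restrictFree_d1, restrictFree_uVar, freeDx_freeX]
theorem restrictFree_uyVar : restrictFree uyVar = freeX 0 0 0 true := by
  rw [uyVar, restrictFree_d2, restrictFree_uVar, freeDy_freeX_false]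
theorem restrictFree_vxVar : restrictFree vxVar = freeX 1 0 1 false := by
  rw [vxVar, restrictFree_d1, restrictFree_vVar, freeDx_freeX]
theorem restrictFree_uxxVar : restrictFree uxxVar = freeX 0 0 2 false := by
  rw [uxxVar, restrictFree_d1, restrictFree_uxVar, freeDx_freeX]
theorem restrictFree_uxyVar : restrictFree uxyVar = freeX 0 0 1 true := by
  rw [uxyVar, restrictFree_d2, restrictFree_uxVar, freeDy_freeX_false]

theorem uVar_mem : uVar ∈ ordLE 0 := X_mem_ordLE (by simp [jetOrder])
theorem vVar_mem : vVar ∈ ordLE 0 := X_mem_ordLE (by simp [jetOrder])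
theorem uxVar_mem : uxVar ∈ ordLE 1 := totalDeriv_mem_ordLE 1 uVar_mem
theorem uyVar_mem : uyVar ∈ ordLE 1 := totalDeriv_mem_ordLE 2 uVar_mem
theorem vxVar_mem : vxVar ∈ ordLE 1 := totalDeriv_mem_ordLE 1 vVar_mem
theorem uxxVar_mem : uxxVar ∈ ordLE 2 := totalDeriv_mem_ordLE 1 uxVar_mem
theorem uxyVar_mem : uxyVar ∈ ordLE 2 := totalDeriv_mem_ordLE 2 uxVar_mem

theorem opX_mem {k : ℕ} {f : DiffPoly} (hf : f ∈ ordLE k) : opX f ∈ ordLE (k + 1) :=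
  mul_mem (ordLE_mono (by omega) uxVar_mem) (totalDeriv_mem_ordLE 1 hf)

theorem opY_mem {k : ℕ} {f : DiffPoly} (hf : f ∈ ordLE k) (hk : 1 ≤ k) :
    opY f ∈ ordLE (k + 1) :=
  sub_mem (mul_mem (ordLE_mono (by omega) uxxVar_mem) (totalDeriv_mem_ordLE 2 hf))
    (mul_mem (ordLE_mono (by omega) uxyVar_mem) (totalDeriv_mem_ordLE 1 hf))

theorem opT_mem {k : ℕ} {f : DiffPoly} (i l : ℕ) (hf : f ∈ ordLE k) (hk : 1 ≤ k) :
    opT i l f ∈ ordLE (k + 1) := by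
  have hu : uVar ∈ ordLE (k + 1) := ordLE_mono (by omega) uVar_mem
  have hv : vVar ∈ ordLE (k + 1) := ordLE_mono (by omega) vVar_mem
  have hux : uxVar ∈ ordLE (k + 1) := ordLE_mono (by omega) uxVar_mem
  have huy : uyVar ∈ ordLE (k + 1) := ordLE_mono (by omega) uyVar_mem
  have hvx : vxVar ∈ ordLE (k + 1) := ordLE_mono (by omega) vxVar_mem
  have huxx : uxxVar ∈ ordLE (k + 1) := ordLE_mono (by omega) uxxVar_mem
  have huxy : uxyVar ∈ ordLE (k + 1) := ordLE_mono (by omega) uxyVar_mem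
  have hf' : f ∈ ordLE (k + 1) := ordLE_mono (by omega) hf
  have h2 : (2 : DiffPoly) ∈ ordLE (k + 1) := ofNat_mem _ 2
  exact add_mem (add_mem (add_mem (mul_mem (pow_mem huxx 2) (totalDeriv_mem_ordLE 0 hf))
    (mul_mem (sub_mem (mul_mem hu (pow_mem huxx 2)) (mul_mem (mul_mem h2 huxy) huxx))
      (totalDeriv_mem_ordLE 2 hf)))
    (mul_mem (add_mem (mul_mem hv (pow_mem huxx 2)) (pow_mem huxy 2)) (totalDeriv_mem_ordLE 1 hf)))
    (mul_mem (add_mem (mul_mem (natCast_mem _ _) (add_mem (mul_mem (pow_mem huxx 2)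
      (add_mem huy (mul_mem h2 hvx))) (mul_mem (mul_mem hux huxy) huxx)))
      (mul_mem (natCast_mem _ _) (add_mem (mul_mem (pow_mem huxx 2) hvx)
        (mul_mem (mul_mem huxx huxy) hux)))) hf')

/-- There is a relative invariant, of the order of `z`, whose restriction to the equation has the
leading coordinate `z`. -/
def HasInvariant (z : FreeCoord) : Prop :=
  ∃ (f : DiffPoly) (i l : ℕ), f ∈ ordLE (freeOrder z) ∧ RelInv i l f ∧ HasLead (restrictFree f) z

theorem freeX_ne_zero (a : Fin 2) (α β : ℕ) (γ : Bool) : freeX a α β γ ≠ 0 :=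
  MvPolynomial.X_ne_zero _

theorem HasInvariant.stepX {a : Fin 2} {α β : ℕ} {γ : Bool} (hk : 2 ≤ α + β + γ.toNat)
    (h : HasInvariant (Sum.inr (a, α, β, γ))) : HasInvariant (Sum.inr (a, α, β + 1, γ)) := by
  obtain ⟨f, i, l, hf, hinv, hlead⟩ := h
  refine ⟨opX f, i, l + 1, ?_, hinv.opX, ?_⟩
  · have : freeOrder (Sum.inr (a, α, β + 1, γ)) = freeOrder (Sum.inr (a, α, β, γ)) + 1 := by
      simp only [freeOrder]; omega
    rw [this]
    exact opX_mem hf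
  · rw [opX, map_mul, restrictFree_d1, restrictFree_uxVar, ← add_zero (_ * _)]
    refine (raises_freeDx.hasLead hlead ?_ (freeDx_freeX a α β γ)).mul_add (freeX_ne_zero _ _ _ _)
      (κ := toLex (1, toLex (0, 0))) ?_ (X_mem_keyLE ?_) (zero_mem _)
    · simp [freeKey, shiftKey_toLex]; omega
    · simp only [freeKey, key_lt_iff]; omega
    · simp [freeKey, key_le_iff]

/-- In `opY f` the term with D_x f has smaller weight than the term with D_y f. Order at least 2
keeps the coefficients u_xx and u_xy below the new leading coordinate. -/
theorem HasInvariant.stepY {a : Fin 2} {α β : ℕ} (hk : 2 ≤ α + β)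
    (h : HasInvariant (Sum.inr (a, α, β, false))) : HasInvariant (Sum.inr (a, α, β, true)) := by
  obtain ⟨f, i, l, hf, hinv, hlead⟩ := h
  refine ⟨opY f, i + 1, l + 1, opY_mem (k := freeOrder (Sum.inr (a, α, β, false))) hf
    (by simp only [freeOrder]; omega), hinv.opY, ?_⟩
  rw [opY, map_sub, map_mul, map_mul, restrictFree_d1, restrictFree_d2, restrictFree_uxxVar,
    restrictFree_uxyVar, sub_eq_add_neg]
  have hx := raises_freeDx.mem_keyLE hlead.1
  refine (raises_freeDy.hasLead hlead ?_ (freeDy_freeX_false a α β)).mul_add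
    (freeX_ne_zero _ _ _ _) (κ := toLex (α + β + 1, toLex (a.val, 2 * α))) ?_ (X_mem_keyLE ?_)
    (neg_mem (mul_mem (X_mem_keyLE ?_) (keyLE_mono ?_ hx)))
  · simp [freeKey, shiftKey_toLex]
  · simp [freeKey, key_lt_iff]
  · simp only [freeKey, key_le_iff, Bool.toNat_false]; omega
  · simp only [freeKey, key_le_iff, Bool.toNat_true]; omega
  · simp [freeKey, shiftKey_toLex]

/-- Differentiation in t adds 2 to the weight, against 1 for y and 0 for x, so `opT` has its lead in
the t-derivative. The hypothesis on the order places u_xx and u_xy below it. -/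
theorem HasInvariant.stepT {a : Fin 2} {α β : ℕ} {γ : Bool} (hk : 2 ≤ α + β + γ.toNat)
    (h : HasInvariant (Sum.inr (a, α, β, γ))) : HasInvariant (Sum.inr (a, α + 1, β, γ)) := by
  obtain ⟨f, i, l, hf, hinv, hlead⟩ := h
  refine ⟨opT i l f, i + 3, l + 1, ?_, hinv.opT, ?_⟩
  · have : freeOrder (Sum.inr (a, α + 1, β, γ)) = freeOrder (Sum.inr (a, α, β, γ)) + 1 := by
      simp only [freeOrder]; omega
    rw [this]
    exact opT_mem i l hf (by simp only [freeOrder]; omega)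
  · set κ : ℕ ×ₗ ℕ ×ₗ ℕ := toLex (α + β + γ.toNat + 1, toLex (a.val, 2 * α + γ.toNat + 1)) with hκ
    have hX : ∀ (a' : Fin 2) (α' β' : ℕ) (γ' : Bool), α' + β' + γ'.toNat ≤ 2 →
        freeX a' α' β' γ' ∈ keyLE κ := by
      intro a' α' β' γ' h
      refine X_mem_keyLE ?_
      simp only [freeKey, hκ, key_le_iff]
      omega
    have hu := hX 0 0 0 false (by simp)
    have hv := hX 1 0 0 false (by simp)
    have hux := hX 0 0 1 false (by simp)
    have huy := hX 0 0 0 true (by simp)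
    have hvx := hX 1 0 1 false (by simp)
    have huxx := hX 0 0 2 false (by simp)
    have huxy := hX 0 0 1 true (by simp)
    have h2 : (2 : FreePoly) ∈ keyLE κ := ofNat_mem _ 2
    have h2' : restrictFree 2 = 2 := map_ofNat _ 2
    have hx : freeDx (restrictFree f) ∈ keyLE κ :=
      keyLE_mono (by simp only [freeKey, shiftKey_toLex, hκ, key_le_iff, true_and]; omega)
        (raises_freeDx.mem_keyLE hlead.1)
    have hy : freeDy (restrictFree f) ∈ keyLE κ :=
      keyLE_mono (by simp only [freeKey, shiftKey_toLex, hκ, key_le_iff, true_and]; omega)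
        (raises_freeDy.mem_keyLE hlead.1)
    have h0 : restrictFree f ∈ keyLE κ :=
      keyLE_mono (by simp only [freeKey, hκ, key_le_iff]; omega) hlead.1
    simp only [opT, map_add, map_sub, map_mul, map_pow, map_natCast, restrictFree_d0,
      restrictFree_d1, restrictFree_d2, restrictFree_uVar, restrictFree_vVar, restrictFree_uxVar,
      restrictFree_uyVar, restrictFree_vxVar, restrictFree_uxxVar, restrictFree_uxyVar, h2']
    rw [add_assoc, add_assoc]
    refine (raises_freeDt.hasLead hlead ?_ (freeDt_freeX a α β γ)).mul_add
      (pow_ne_zero 2 (freeX_ne_zero _ _ _ _)) (κ := κ) ?_ (pow_mem huxx 2) ?_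
    · simp [freeKey, shiftKey_toLex]; omega
    · simp only [freeKey, hκ, key_lt_iff, true_and]; omega
    · exact add_mem (mul_mem (sub_mem (mul_mem hu (pow_mem huxx 2))
        (mul_mem (mul_mem h2 huxy) huxx)) hy)
        (add_mem (mul_mem (add_mem (mul_mem hv (pow_mem huxx 2)) (pow_mem huxy 2)) hx)
        (mul_mem (add_mem (mul_mem (natCast_mem _ _) (add_mem (mul_mem (pow_mem huxx 2)
        (add_mem huy (mul_mem h2 hvx))) (mul_mem (mul_mem hux huxy) huxx)))
        (mul_mem (natCast_mem _ _) (add_mem (mul_mem (pow_mem huxx 2) hvx)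
        (mul_mem (mul_mem huxx huxy) hux)))) h0))

theorem hasLead_X (z : FreeCoord) : HasLead (MvPolynomial.X z) z :=
  ⟨X_mem_keyLE le_rfl, by rw [MvPolynomial.pderiv_X_self]; exact one_ne_zero⟩

theorem hasInvariant_uxx : HasInvariant (Sum.inr (0, 0, 2, false)) :=
  ⟨uxxVar, 0, 1, uxxVar_mem, relInv_uxx, restrictFree_uxxVar ▸ hasLead_X _⟩

/-- The step in t does not apply to u_x, which is of order 1: its coefficients u_xx and u_xy have
the same order as u_tx. The comparison is made directly, by the weights 0, 1 and 2. -/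
theorem hasInvariant_utx : HasInvariant (Sum.inr (0, 1, 1, false)) := by
  refine ⟨opT 1 0 uxVar, 4, 1, opT_mem 1 0 uxVar_mem le_rfl, relInv_ux.opT, ?_⟩
  set κ : ℕ ×ₗ ℕ ×ₗ ℕ := toLex (2, toLex (0, 1)) with hκ
  have hX : ∀ (a' : Fin 2) (α' β' : ℕ) (γ' : Bool), freeKey (Sum.inr (a', α', β', γ')) ≤ κ →
      freeX a' α' β' γ' ∈ keyLE κ := fun a' α' β' γ' h => X_mem_keyLE h
  have hu := hX 0 0 0 false (by simp [freeKey, hκ, key_le_iff])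
  have hv := hX 1 0 0 false (by simp [freeKey, hκ, key_le_iff])
  have hux := hX 0 0 1 false (by simp [freeKey, hκ, key_le_iff])
  have huy := hX 0 0 0 true (by simp [freeKey, hκ, key_le_iff])
  have hvx := hX 1 0 1 false (by simp [freeKey, hκ, key_le_iff])
  have huxx := hX 0 0 2 false (by simp [freeKey, hκ, key_le_iff])
  have huxy := hX 0 0 1 true (by simp [freeKey, hκ, key_le_iff])
  have h2 : (2 : FreePoly) ∈ keyLE κ := ofNat_mem _ 2
  have h2' : restrictFree 2 = 2 := map_ofNat _ 2
  simp only [opT, map_add, map_sub, map_mul, map_pow, map_natCast, restrictFree_d0,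
    restrictFree_d1, restrictFree_d2, restrictFree_uVar, restrictFree_vVar, restrictFree_uxVar,
    restrictFree_uyVar, restrictFree_vxVar, restrictFree_uxxVar, restrictFree_uxyVar, h2',
    freeDt_freeX, freeDx_freeX, freeDy_freeX_false, zero_add]
  rw [add_assoc, add_assoc]
  refine (hasLead_X _).mul_add (pow_ne_zero 2 (freeX_ne_zero _ _ _ _)) (κ := κ) ?_
    (pow_mem huxx 2) ?_
  · simp [freeKey, hκ, key_lt_iff]
  · exact add_mem (mul_mem (sub_mem (mul_mem hu (pow_mem huxx 2))
      (mul_mem (mul_mem h2 huxy) huxx)) huxy)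
      (add_mem (mul_mem (add_mem (mul_mem hv (pow_mem huxx 2)) (pow_mem huxy 2)) huxx)
      (mul_mem (add_mem (mul_mem (natCast_mem _ _) (add_mem (mul_mem (pow_mem huxx 2)
      (add_mem huy (mul_mem h2 hvx))) (mul_mem (mul_mem hux huxy) huxx)))
      (mul_mem (natCast_mem _ _) (add_mem (mul_mem (pow_mem huxx 2) hvx)
      (mul_mem (mul_mem huxx huxy) hux)))) hux))

theorem hasInvariant_vxx : HasInvariant (Sum.inr (1, 0, 2, false)) := by
  refine ⟨relJ, 2, 0, add_mem (totalDeriv_mem_ordLE 1 vxVar_mem) uxyVar_mem, relInv_relJ, ?_⟩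
  rw [relJ, map_add, restrictFree_d1, restrictFree_vxVar, restrictFree_uxyVar, freeDx_freeX,
    ← one_mul (freeX 1 _ _ _)]
  refine (hasLead_X _).mul_add one_ne_zero (κ := toLex (2, toLex (0, 1))) ?_ (one_mem _)
    (X_mem_keyLE ?_) <;> simp [freeKey, key_lt_iff, key_le_iff]

/-- A start other than the y-step is needed, since no relative invariant led by v_x is available. On
the equation u_yy becomes an expression led by u_tx, and derivatives of u rank below those of v of
the same order. -/
theorem hasInvariant_vxy : HasInvariant (Sum.inr (1, 0, 1, true)) := by
  refine ⟨relK, 4, 0, sub_mem (mul_mem uxxVar_mem (add_mem (totalDeriv_mem_ordLE 2 uyVar_mem)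
    (totalDeriv_mem_ordLE 2 vxVar_mem))) (mul_mem uxyVar_mem (add_mem uxyVar_mem
      (totalDeriv_mem_ordLE 1 vxVar_mem))), relInv_relK, ?_⟩
  have e : restrictFree relK = freeX 0 0 2 false * freeX 1 0 1 true +
      (freeX 0 0 2 false * solvedRHS 0 - freeX 0 0 1 true * (freeX 0 0 1 true
        + freeX 1 0 2 false)) := by
    simp only [relK, map_sub, map_mul, map_add, restrictFree_d1, restrictFree_d2,
      restrictFree_vxVar, restrictFree_uyVar, restrictFree_uxyVar, restrictFree_uxxVar,
      freeDx_freeX, freeDy_freeX_true, freeDy_freeX_false, Function.iterate_zero, id]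
    ring
  rw [e]
  refine (hasLead_X _).mul_add (freeX_ne_zero _ _ _ _) (κ := toLex (2, toLex (1, 0))) ?_
    (X_mem_keyLE ?_) (sub_mem (mul_mem (X_mem_keyLE ?_) (keyLE_mono ?_ (solvedRHS_mem_keyLE 0)))
      (mul_mem (X_mem_keyLE ?_) (add_mem (X_mem_keyLE ?_) (X_mem_keyLE ?_)))) <;>
    simp [freeKey, key_lt_iff, key_le_iff]

theorem HasInvariant.iterateX {a : Fin 2} {α β : ℕ} {γ : Bool} (hk : 2 ≤ α + β + γ.toNat)
    (h : HasInvariant (Sum.inr (a, α, β, γ))) (n : ℕ) :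
    HasInvariant (Sum.inr (a, α, β + n, γ)) := by
  induction n with
  | zero => exact h
  | succ n ih => exact HasInvariant.stepX (β := β + n) (by omega) ih

theorem HasInvariant.iterateT {a : Fin 2} {α β : ℕ} {γ : Bool} (hk : 2 ≤ α + β + γ.toNat)
    (h : HasInvariant (Sum.inr (a, α, β, γ))) (n : ℕ) :
    HasInvariant (Sum.inr (a, α + n, β, γ)) := by
  induction n with
  | zero => exact h
  | succ n ih => exact HasInvariant.stepT (α := α + n) (by omega) ih

/-- The index set of the parameters of the pseudogroup: the base point, and the Taylor coefficients
of the functional parameters `A, B, C, D', E`. -/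
abbrev GroupIndex : Type := Fin 3 ⊕ (ℕ × Fin 5)

/-- The coordinates normalized by the group parameters. -/
def pivot : GroupIndex → FreeCoord
  | Sum.inl i => Sum.inl i
  | Sum.inr (j, 0) => Sum.inr (1, j, 0, false)
  | Sum.inr (j, 1) => Sum.inr (0, j, 0, false)
  -- Taylor coefficients of degree j + 1 of C, D', E enter v_y, u_y, v_x, differentiated j times in
  -- t, additively. The values of C, D', E themselves act on jets through shears and scalings, and
  -- are normalized by u_xy, u_x, u_xx at points where u_x and u_xx do not vanish.
  | Sum.inr (0, 2) => Sum.inr (0, 0, 1, true)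
  | Sum.inr (j + 1, 2) => Sum.inr (1, j, 0, true)
  | Sum.inr (0, 3) => Sum.inr (0, 0, 1, false)
  | Sum.inr (j + 1, 3) => Sum.inr (0, j, 0, true)
  | Sum.inr (0, 4) => Sum.inr (0, 0, 2, false)
  | Sum.inr (j + 1, 4) => Sum.inr (1, j, 1, false)

/-- Derivatives in x and t are taken first, starting from u_xx or u_tx. The derivative in y comes
last, since free coordinates contain at most one. -/
theorem hasInvariant_u {α β : ℕ} {γ : Bool} (hβ : 1 ≤ β)
    (h : 1 ≤ α ∨ 2 ≤ β ∧ 3 ≤ β + γ.toNat) : HasInvariant (Sum.inr (0, α, β, γ)) := by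
  rcases α with _ | α
  · obtain ⟨b, rfl⟩ : ∃ b, β = 2 + b := ⟨β - 2, by omega⟩
    have h1 : HasInvariant (Sum.inr (0, 0, 2 + b, false)) :=
      hasInvariant_uxx.iterateX (by simp) b
    cases γ
    · exact h1
    · exact h1.stepY (by omega)
  · obtain ⟨b, rfl⟩ : ∃ b, β = 1 + b := ⟨β - 1, by omega⟩
    have h1 : HasInvariant (Sum.inr (0, 1 + α, 1 + b, false)) :=
      (hasInvariant_utx.iterateX (by simp) b).iterateT (by simp; omega) α
    rw [add_comm 1 α] at h1
    cases γ
    · exact h1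
    · exact h1.stepY (by omega)

theorem hasInvariant_v {α β : ℕ} {γ : Bool} (hβ : 1 ≤ β) (h : 2 ≤ β + γ.toNat) :
    HasInvariant (Sum.inr (1, α, β, γ)) := by
  have key : HasInvariant (Sum.inr (1, 0, β, γ)) := by
    by_cases h1 : β = 1
    · subst h1
      cases γ
      · simp at h
      · exact hasInvariant_vxy
    · obtain ⟨b, rfl⟩ : ∃ b, β = 2 + b := ⟨β - 2, by omega⟩
      have h2 := hasInvariant_vxx.iterateX (by simp) b
      cases γ
      · exact h2
      · exact h2.stepY (by omega)
  have := key.iterateT (by omega) α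
  rwa [zero_add] at this

theorem hasInvariant_of_notMem_range_pivot {z : FreeCoord} (hz : z ∉ Set.range pivot) :
    HasInvariant z := by
  have hz' : ∀ s, pivot s ≠ z := fun s h => hz ⟨s, h⟩
  rcases z with i | ⟨a, α, β, γ⟩
  · exact absurd rfl (hz' (Sum.inl i))
  · obtain rfl | rfl : a = 0 ∨ a = 1 := by omega
    · rcases β with _ | β
      · cases γ
        · exact absurd rfl (hz' (Sum.inr (α, 1)))
        · exact absurd rfl (hz' (Sum.inr (α + 1, 3)))
      · refine hasInvariant_u (by omega) ?_
        by_contra hc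
        obtain rfl : α = 0 := by omega
        cases γ
        · obtain rfl | rfl : β = 0 ∨ β = 1 := by simp at hc; omega
          · exact hz' (Sum.inr (0, 3)) rfl
          · exact hz' (Sum.inr (0, 4)) rfl
        · obtain rfl : β = 0 := by simp at hc; omega
          exact hz' (Sum.inr (0, 2)) rfl
    · rcases β with _ | β
      · cases γ
        · exact absurd rfl (hz' (Sum.inr (α, 0)))
        · exact absurd rfl (hz' (Sum.inr (α + 1, 2)))
      · refine hasInvariant_v (by omega) ?_
        by_contra hc
        cases γ
        · obtain rfl : β = 0 := by simp at hc; omega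
          exact hz' (Sum.inr (α + 1, 4)) rfl
        · simp at hc

end

end ManakovSantini

namespace ManakovSantini

noncomputable section

/-! ### The ring of germs of smooth functions -/

open Filter Topology

theorem eventually_differentiableAt {p : Fin 3 → ℝ} {f : (Fin 3 → ℝ) → ℝ} (hf : ContDiffAt ℝ ∞ f p) :
    ∀ᶠ q in 𝓝 p, DifferentiableAt ℝ f q := by
  have h : ContDiffAt ℝ 1 f p := hf.of_le (by norm_cast)
  filter_upwards [h.eventually (by norm_num)] with q hq using hq.differentiableAt (by norm_num)

theorem contDiffAt_partialDeriv {p : Fin 3 → ℝ} {f : (Fin 3 → ℝ) → ℝ} (hf : ContDiffAt ℝ ∞ f p)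
    (i : Fin 3) : ContDiffAt ℝ ∞ (partialDeriv i f) p :=
  (hf.fderiv_right (m := ∞) (by norm_num)).clm_apply contDiffAt_const

theorem partialDeriv_congr {p : Fin 3 → ℝ} {f g : (Fin 3 → ℝ) → ℝ} (h : f =ᶠ[𝓝 p] g) (i : Fin 3) :
    partialDeriv i f =ᶠ[𝓝 p] partialDeriv i g := by
  filter_upwards [h.fderiv (𝕜 := ℝ)] with q hq
  rw [partialDeriv, partialDeriv, hq]

/-- The functions which are smooth at `p`. -/
def smoothAt (p : Fin 3 → ℝ) : Subalgebra ℝ ((Fin 3 → ℝ) → ℝ) where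
  carrier := {f | ContDiffAt ℝ ∞ f p}
  mul_mem' {f g} hf hg := by
    rw [Set.mem_ofPred_eq] at hf hg ⊢
    exact hf.mul hg
  add_mem' {f g} hf hg := by
    rw [Set.mem_ofPred_eq] at hf hg ⊢
    exact hf.add hg
  algebraMap_mem' r := by
    rw [Set.mem_ofPred_eq]
    exact contDiffAt_const

/-- The ideal of functions vanishing near `p`. -/
def germIdeal (p : Fin 3 → ℝ) : Ideal (smoothAt p) where
  carrier := {f | f.1 =ᶠ[𝓝 p] 0}
  add_mem' {f g} hf hg := by
    filter_upwards [hf, hg] with q h1 h2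
    change f.1 q + g.1 q = 0
    rw [h1, h2]; simp
  zero_mem' := EventuallyEq.rfl
  smul_mem' c f hf := by
    filter_upwards [hf] with q h
    change c.1 q * f.1 q = 0
    rw [h]; simp

/-- The ring of germs at `p` of smooth functions. -/
def SGerm (p : Fin 3 → ℝ) : Type := smoothAt p ⧸ germIdeal p

instance (p : Fin 3 → ℝ) : CommRing (SGerm p) := inferInstanceAs (CommRing (smoothAt p ⧸ germIdeal p))

instance (p : Fin 3 → ℝ) : Algebra ℝ (SGerm p) := inferInstanceAs (Algebra ℝ (smoothAt p ⧸ germIdeal p))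

variable {p : Fin 3 → ℝ}

/-- The germ of a smooth function. -/
def germ (f : (Fin 3 → ℝ) → ℝ) (hf : ContDiffAt ℝ ∞ f p) : SGerm p :=
  Ideal.Quotient.mk (germIdeal p) ⟨f, hf⟩

theorem germ_eq_iff {f g : (Fin 3 → ℝ) → ℝ} {hf : ContDiffAt ℝ ∞ f p} {hg : ContDiffAt ℝ ∞ g p} :
    germ f hf = germ g hg ↔ f =ᶠ[𝓝 p] g := by
  refine (Ideal.Quotient.eq (I := germIdeal p) (x := ⟨f, hf⟩) (y := ⟨g, hg⟩)).trans ?_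
  constructor
  · intro h
    filter_upwards [h] with q hq
    exact sub_eq_zero.mp hq
  · intro h
    change _ =ᶠ[𝓝 p] _
    filter_upwards [h] with q hq
    exact sub_eq_zero.mpr hq

theorem exists_germ (g : SGerm p) : ∃ f, ∃ hf : ContDiffAt ℝ ∞ f p, g = germ f hf := by
  obtain ⟨⟨f, hf⟩, rfl⟩ := Ideal.Quotient.mk_surjective g
  exact ⟨f, hf, rfl⟩

theorem germ_add {f g : (Fin 3 → ℝ) → ℝ} (hf : ContDiffAt ℝ ∞ f p) (hg : ContDiffAt ℝ ∞ g p) :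
    germ f hf + germ g hg = germ (fun q => f q + g q) (hf.add hg) := rfl

theorem germ_mul {f g : (Fin 3 → ℝ) → ℝ} (hf : ContDiffAt ℝ ∞ f p) (hg : ContDiffAt ℝ ∞ g p) :
    germ f hf * germ g hg = germ (fun q => f q * g q) (hf.mul hg) := rfl

theorem germ_sub {f g : (Fin 3 → ℝ) → ℝ} (hf : ContDiffAt ℝ ∞ f p) (hg : ContDiffAt ℝ ∞ g p) :
    germ f hf - germ g hg = germ (fun q => f q - g q) (hf.sub hg) := rfl

theorem germ_pow {f : (Fin 3 → ℝ) → ℝ} (hf : ContDiffAt ℝ ∞ f p) (n : ℕ) :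
    germ f hf ^ n = germ (fun q => f q ^ n) (hf.pow n) := rfl

theorem algebraMap_germ (r : ℝ) : algebraMap ℝ (SGerm p) r = germ (fun _ => r) contDiffAt_const :=
  rfl

theorem germ_smul (r : ℝ) {f : (Fin 3 → ℝ) → ℝ} (hf : ContDiffAt ℝ ∞ f p) :
    r • germ f hf = germ (fun q => r * f q) (contDiffAt_const.mul hf) := rfl

/-- Partial differentiation of germs. -/
def germDerivFun (i : Fin 3) (g : SGerm p) : SGerm p :=
  germ _ (contDiffAt_partialDeriv (exists_germ g).choose_spec.choose i)

theorem germDerivFun_germ (i : Fin 3) {f : (Fin 3 → ℝ) → ℝ} (hf : ContDiffAt ℝ ∞ f p) :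
    germDerivFun i (germ f hf) = germ _ (contDiffAt_partialDeriv hf i) := by
  rw [germDerivFun, germ_eq_iff]
  exact partialDeriv_congr (germ_eq_iff.mp (exists_germ (germ f hf)).choose_spec.choose_spec.symm) i

/-- Partial differentiation of germs, as a derivation. -/
def germDeriv (p : Fin 3 → ℝ) (i : Fin 3) : Derivation ℝ (SGerm p) (SGerm p) :=
  Derivation.mk'
    { toFun := germDerivFun i
      map_add' := by
        intro g h
        obtain ⟨f, hf, rfl⟩ := exists_germ g
        obtain ⟨f', hf', rfl⟩ := exists_germ h
        rw [germ_add, germDerivFun_germ, germDerivFun_germ, germDerivFun_germ, germ_add, germ_eq_iff]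
        filter_upwards [eventually_differentiableAt hf, eventually_differentiableAt hf'] with q h h'
        simp only [partialDeriv]
        rw [fderiv_fun_add h h']; rfl
      map_smul' := by
        intro r g
        obtain ⟨f, hf, rfl⟩ := exists_germ g
        rw [germ_smul, germDerivFun_germ, germDerivFun_germ, RingHom.id_apply, germ_smul,
          germ_eq_iff]
        filter_upwards [eventually_differentiableAt hf] with q h
        simp only [partialDeriv]
        rw [fderiv_const_mul h]; rfl }
    (by
      intro g h
      obtain ⟨f, hf, rfl⟩ := exists_germ g
      obtain ⟨f', hf', rfl⟩ := exists_germ h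
      change germDerivFun i _ = _ * germDerivFun i _ + _ * germDerivFun i _
      rw [germ_mul, germDerivFun_germ, germDerivFun_germ, germDerivFun_germ, germ_mul, germ_mul,
        germ_add, germ_eq_iff]
      filter_upwards [eventually_differentiableAt hf, eventually_differentiableAt hf'] with q h h'
      simp only [partialDeriv]
      rw [fderiv_fun_mul h h']; rfl)

theorem germDeriv_germ (i : Fin 3) {f : (Fin 3 → ℝ) → ℝ} (hf : ContDiffAt ℝ ∞ f p) :
    germDeriv p i (germ f hf) = germ _ (contDiffAt_partialDeriv hf i) :=
  germDerivFun_germ i hf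

theorem germDeriv_comm (i j : Fin 3) (g : SGerm p) :
    germDeriv p i (germDeriv p j g) = germDeriv p j (germDeriv p i g) := by
  obtain ⟨f, hf, rfl⟩ := exists_germ g
  simp only [germDeriv_germ]
  rw [germ_eq_iff]
  have h2 : ContDiffAt ℝ 2 f p := hf.of_le (by norm_cast)
  filter_upwards [h2.eventually (by norm_num)] with q hq
  have hs : IsSymmSndFDerivAt ℝ f q := hq.isSymmSndFDerivAt (by simp)
  have hd : DifferentiableAt ℝ (fderiv ℝ f) q :=
    (hq.fderiv_right (m := 1) (by norm_num)).differentiableAt (by norm_num)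
  have key : ∀ i j, partialDeriv i (partialDeriv j f) q =
      fderiv ℝ (fderiv ℝ f) q (Pi.single i 1) (Pi.single j 1) := by
    intro i j
    unfold partialDeriv
    rw [fderiv_clm_apply hd (differentiableAt_const _)]
    simp
  rw [key, key, hs]

/-- Evaluation of germs. -/
def germEval (p : Fin 3 → ℝ) : SGerm p →ₐ[ℝ] ℝ :=
  Ideal.Quotient.liftₐ (germIdeal p) ((Pi.evalAlgHom ℝ (fun _ => ℝ) p).comp (smoothAt p).val)
    (fun _ hf => EventuallyEq.eq_of_nhds hf)

theorem germEval_germ {f : (Fin 3 → ℝ) → ℝ} (hf : ContDiffAt ℝ ∞ f p) :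
    germEval p (germ f hf) = f p := rfl

/-- The germ of a coordinate function. -/
def coordGerm (p : Fin 3 → ℝ) (i : Fin 3) : SGerm p :=
  germ (fun q => q i) (contDiffAt_apply ℝ ℝ i p)

theorem germDeriv_coordGerm (i j : Fin 3) :
    germDeriv p i (coordGerm p j) = if j = i then 1 else 0 := by
  rw [coordGerm, germDeriv_germ]
  have : ∀ q : Fin 3 → ℝ, partialDeriv i (fun q => q j) q = if j = i then 1 else 0 := by
    intro q
    rw [partialDeriv, (hasFDerivAt_apply (𝕜 := ℝ) j q).fderiv]
    simp [Pi.single_apply]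
  have e : (if j = i then 1 else 0 : SGerm p) =
      germ (fun _ => if j = i then 1 else 0) contDiffAt_const := by
    split_ifs <;> rfl
  rw [e, germ_eq_iff]
  exact Eventually.of_forall this

theorem contDiffAt_component {s : (Fin 3 → ℝ) → (Fin 2 → ℝ)} (hs : ContDiffAt ℝ ∞ s p) (a : Fin 2) :
    ContDiffAt ℝ ∞ (fun q => s q a) p := contDiffAt_pi.mp hs a

/-- The differential ring of germs, with the germ of a section. -/
def germData (s : (Fin 3 → ℝ) → (Fin 2 → ℝ)) (hs : ContDiffAt ℝ ∞ s p) : DiffData (SGerm p) where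
  d := germDeriv p
  b := coordGerm p
  w a := germ _ (contDiffAt_component hs a)
  comm := germDeriv_comm
  d_b := germDeriv_coordGerm

theorem exists_iterate_partialDeriv (i : Fin 3) (n : ℕ) {f : (Fin 3 → ℝ) → ℝ}
    (hf : ContDiffAt ℝ ∞ f p) :
    ∃ h : ContDiffAt ℝ ∞ ((partialDeriv i)^[n] f) p, (germDeriv p i)^[n] (germ f hf) = germ _ h := by
  induction n generalizing f with
  | zero => exact ⟨hf, rfl⟩
  | succ n ih =>
    simp only [Function.iterate_succ_apply, germDeriv_germ]
    exact ih (contDiffAt_partialDeriv hf i)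

theorem germEval_dIter (σ : Fin 3 → ℕ) {f : (Fin 3 → ℝ) → ℝ} (hf : ContDiffAt ℝ ∞ f p) :
    germEval p (dIter (germDeriv p) σ (germ f hf)) = iterPartialDeriv σ f p := by
  obtain ⟨h2, e2⟩ := exists_iterate_partialDeriv 2 (σ 2) hf
  obtain ⟨h1, e1⟩ := exists_iterate_partialDeriv 1 (σ 1) h2
  obtain ⟨h0, e0⟩ := exists_iterate_partialDeriv 0 (σ 0) h1
  rw [dIter, e2, e1, e0, germEval_germ, iterPartialDeriv]

/-- The bridge between algebra and analysis: polynomial identities in the differential ring of germs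
become identities between the actual jets of a section. -/
theorem germEval_ev (k : ℕ) {s : (Fin 3 → ℝ) → (Fin 2 → ℝ)} (hs : ContDiffAt ℝ ∞ s p) {f : DiffPoly}
    (hf : f ∈ ordLE k) :
    germEval p ((germData s hs).ev f) = MvPolynomial.aeval (extendJet (jet k s p)) f := by
  refine algHom_eq_of_mem_supported (f := (germEval p).comp (germData s hs).ev) ?_ hf
  rintro (i | ⟨a, σ⟩) hc
  · simp only [AlgHom.comp_apply, DiffData.ev, evJet_inl, MvPolynomial.aeval_X, extendJet, jetOrder,
      zero_le, jet]
    rfl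
  · have hc' : jetOrder (Sum.inr (a, σ)) ≤ k := hc
    simp only [AlgHom.comp_apply, DiffData.ev, evJet_inr, MvPolynomial.aeval_X, extendJet, hc',
      dif_pos, jet]
    exact germEval_dIter σ _

/-- Pullback of germs by a smooth map. -/
def germPull (Φ : (Fin 3 → ℝ) → (Fin 3 → ℝ)) (hΦ : ContDiffAt ℝ ∞ Φ p) :
    SGerm (Φ p) →ₐ[ℝ] SGerm p :=
  Ideal.Quotient.liftₐ (germIdeal (Φ p))
    { toFun := fun f => germ (fun q => f.1 (Φ q)) (ContDiffAt.comp p f.2 hΦ)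
      map_one' := rfl
      map_mul' := fun _ _ => rfl
      map_zero' := rfl
      map_add' := fun _ _ => rfl
      commutes' := fun _ => rfl }
    (fun _ hf => germ_eq_iff (hg := contDiffAt_const).mpr (hΦ.continuousAt.eventually hf))

theorem germPull_germ {Φ : (Fin 3 → ℝ) → (Fin 3 → ℝ)} (hΦ : ContDiffAt ℝ ∞ Φ p)
    {f : (Fin 3 → ℝ) → ℝ} (hf : ContDiffAt ℝ ∞ f (Φ p)) :
    germPull Φ hΦ (germ f hf) = germ (fun q => f (Φ q)) (ContDiffAt.comp p hf hΦ) := rfl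

theorem germEval_germPull {Φ : (Fin 3 → ℝ) → (Fin 3 → ℝ)} (hΦ : ContDiffAt ℝ ∞ Φ p)
    (g : SGerm (Φ p)) : germEval p (germPull Φ hΦ g) = germEval (Φ p) g := by
  obtain ⟨f, hf, rfl⟩ := exists_germ g
  rfl

theorem germDeriv_germPull {Φ : (Fin 3 → ℝ) → (Fin 3 → ℝ)} (hΦ : ContDiffAt ℝ ∞ Φ p)
    (i : Fin 3) (g : SGerm (Φ p)) :
    germDeriv p i (germPull Φ hΦ g) = ∑ j, germPull Φ hΦ (germDeriv (Φ p) j g) *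
      germDeriv p i (germ (fun q => Φ q j) (contDiffAt_pi.mp hΦ j)) := by
  obtain ⟨f, hf, rfl⟩ := exists_germ g
  simp only [germPull_germ, germDeriv_germ, germ_mul, Fin.sum_univ_three, germ_add]
  rw [germ_eq_iff]
  have h1 : ContDiffAt ℝ 1 Φ p := hΦ.of_le (by norm_cast)
  filter_upwards [hΦ.continuousAt.eventually (eventually_differentiableAt hf),
    h1.eventually (by norm_num)] with q hq hΦq
  have hΦd : DifferentiableAt ℝ Φ q := hΦq.differentiableAt (by norm_num)
  have e : partialDeriv i (fun q => f (Φ q)) q =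
      fderiv ℝ f (Φ q) (fderiv ℝ Φ q (Pi.single i 1)) := by
    rw [partialDeriv, fderiv_fun_comp q hq hΦd]; rfl
  have e2 : ∀ j, partialDeriv i (fun q => Φ q j) q = fderiv ℝ Φ q (Pi.single i 1) j := by
    intro j
    rw [partialDeriv, (hasFDerivAt_pi'.mp hΦd.hasFDerivAt j).fderiv]
    rfl
  rw [e, e2, e2, e2]
  have e3 : fderiv ℝ Φ q (Pi.single i 1) = ∑ j, fderiv ℝ Φ q (Pi.single i 1) j • Pi.single j (1:ℝ) := by
    ext k
    simp [Finset.sum_apply, Pi.single_apply]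
  conv_lhs => rw [e3, map_sum]
  simp only [map_smul, smul_eq_mul, Fin.sum_univ_three, partialDeriv]
  ring

end

end ManakovSantini

namespace ManakovSantini

noncomputable section

set_option linter.unusedSimpArgs false

/-! ### The pseudogroup acts by point maps of the rings of germs -/

open Filter Topology

theorem contDiffAt_deriv {h : ℝ → ℝ} {t : ℝ} (hh : ContDiffAt ℝ ∞ h t) : ContDiffAt ℝ ∞ (deriv h) t :=
  (hh.fderiv_right (m := ∞) (by norm_num)).clm_apply contDiffAt_const

theorem contDiffAt_comp_zero {p : Fin 3 → ℝ} {h : ℝ → ℝ} (hh : ContDiffAt ℝ ∞ h (p 0)) :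
    ContDiffAt ℝ ∞ (fun q : Fin 3 → ℝ => h (q 0)) p :=
  ContDiffAt.comp (g := h) p hh (contDiffAt_apply ℝ ℝ 0 p)

/-- The germ of a function of `t`. -/
def tGerm (p : Fin 3 → ℝ) (h : ℝ → ℝ) (hh : ContDiffAt ℝ ∞ h (p 0)) : SGerm p :=
  germ _ (contDiffAt_comp_zero hh)

theorem germDeriv_tGerm {p : Fin 3 → ℝ} {h : ℝ → ℝ} (hh : ContDiffAt ℝ ∞ h (p 0)) (i : Fin 3) :
    germDeriv p i (tGerm p h hh) = if i = 0 then tGerm p (deriv h) (contDiffAt_deriv hh) else 0 := by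
  have e : (if i = 0 then tGerm p (deriv h) (contDiffAt_deriv hh) else 0) =
      germ (fun q => if i = 0 then deriv h (q 0) else 0) (by
        split_ifs
        · exact contDiffAt_comp_zero (contDiffAt_deriv hh)
        · exact contDiffAt_const) := by
    by_cases hi : i = 0
    · subst hi; rfl
    · simp only [hi, if_false]; rfl
  rw [e, tGerm, germDeriv_germ, germ_eq_iff]
  have h1 : ContDiffAt ℝ 1 h (p 0) := hh.of_le (by norm_cast)
  filter_upwards [(continuous_apply (0 : Fin 3)).continuousAt.eventually
    (h1.eventually (by norm_num))] with q hq
  have hd : HasFDerivAt (fun q : Fin 3 → ℝ => h (q 0)) _ q :=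
    ((hq.differentiableAt (by norm_num)).hasFDerivAt).comp q (hasFDerivAt_apply (𝕜 := ℝ) 0 q)
  rw [partialDeriv, hd.fderiv]
  by_cases hi : i = 0
  · subst hi; simp
  · simp [hi]

theorem germDeriv_zero_tGerm {p : Fin 3 → ℝ} {h : ℝ → ℝ} (hh : ContDiffAt ℝ ∞ h (p 0)) :
    germDeriv p 0 (tGerm p h hh) = tGerm p (deriv h) (contDiffAt_deriv hh) := germDeriv_tGerm hh 0

theorem germDeriv_one_tGerm {p : Fin 3 → ℝ} {h : ℝ → ℝ} (hh : ContDiffAt ℝ ∞ h (p 0)) :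
    germDeriv p 1 (tGerm p h hh) = 0 := germDeriv_tGerm hh 1

theorem germDeriv_two_tGerm {p : Fin 3 → ℝ} {h : ℝ → ℝ} (hh : ContDiffAt ℝ ∞ h (p 0)) :
    germDeriv p 2 (tGerm p h hh) = 0 := germDeriv_tGerm hh 2

theorem sign_mul_self (ε : ℤˣ) : (((ε : ℤ) : ℝ)) * ((ε : ℤ) : ℝ) = 1 := by
  rcases Int.units_eq_one_or ε with rfl | rfl <;> simp

namespace TopParameters

variable (g : TopParameters)

theorem mem_nhds {t : ℝ} (ht : t ∈ g.dom) : g.dom ∈ 𝓝 t := g.isOpen_dom.mem_nhds ht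
theorem smoothD {t : ℝ} (ht : t ∈ g.dom) : ContDiffAt ℝ ∞ g.D t :=
  g.smooth_D.contDiffAt (g.mem_nhds ht)
theorem smoothA {t : ℝ} (ht : t ∈ g.dom) : ContDiffAt ℝ ∞ g.A t :=
  g.smooth_A.contDiffAt (g.mem_nhds ht)
theorem smoothB {t : ℝ} (ht : t ∈ g.dom) : ContDiffAt ℝ ∞ g.B t :=
  g.smooth_B.contDiffAt (g.mem_nhds ht)
theorem smoothC {t : ℝ} (ht : t ∈ g.dom) : ContDiffAt ℝ ∞ g.C t :=
  g.smooth_C.contDiffAt (g.mem_nhds ht)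
theorem smoothE {t : ℝ} (ht : t ∈ g.dom) : ContDiffAt ℝ ∞ g.E t :=
  g.smooth_E.contDiffAt (g.mem_nhds ht)

/-- The function `√D'`. -/
def m (t : ℝ) : ℝ := √(deriv g.D t)

theorem m_pos {t : ℝ} (ht : t ∈ g.dom) : 0 < g.m t := Real.sqrt_pos.mpr (g.deriv_D_pos t ht)

theorem m_sq {t : ℝ} (ht : t ∈ g.dom) : g.m t ^ 2 = deriv g.D t :=
  Real.sq_sqrt (g.deriv_D_pos t ht).le

theorem smooth_m {t : ℝ} (ht : t ∈ g.dom) : ContDiffAt ℝ ∞ g.m t :=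
  (contDiffAt_deriv (g.smoothD ht)).sqrt (g.deriv_D_pos t ht).ne'

theorem smooth_mi {t : ℝ} (ht : t ∈ g.dom) : ContDiffAt ℝ ∞ (fun τ => (g.m τ)⁻¹) t :=
  (g.smooth_m ht).inv (g.m_pos ht).ne'

theorem smooth_Ei {t : ℝ} (ht : t ∈ g.dom) : ContDiffAt ℝ ∞ (fun τ => (g.E τ)⁻¹) t :=
  (g.smoothE ht).inv (g.E_pos t ht).ne'

theorem diffE {t : ℝ} (ht : t ∈ g.dom) : DifferentiableAt ℝ g.E t :=
  (g.smoothE ht).differentiableAt (by simp)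
theorem diffC {t : ℝ} (ht : t ∈ g.dom) : DifferentiableAt ℝ g.C t :=
  (g.smoothC ht).differentiableAt (by simp)
theorem diff_m {t : ℝ} (ht : t ∈ g.dom) : DifferentiableAt ℝ g.m t :=
  (g.smooth_m ht).differentiableAt (by simp)

theorem deriv_cube_div {t : ℝ} (ht : t ∈ g.dom) :
    deriv (fun τ => g.E τ ^ 3 / √(deriv g.D τ)) t =
      (3 * g.E t ^ 2 * deriv g.E t * g.m t - g.E t ^ 3 * deriv g.m t) / g.m t ^ 2 := by
  have h := (((g.diffE ht).hasDerivAt.pow 3).div (g.diff_m ht).hasDerivAt (g.m_pos ht).ne').deriv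
  have e : (fun τ => g.E τ ^ 3 / √(deriv g.D τ)) = (g.E ^ 3 / g.m) := rfl
  rw [e, h]
  simp

theorem deriv_div_fourth {t : ℝ} (ht : t ∈ g.dom) :
    deriv (fun τ => g.C τ / g.E τ ^ 4) t =
      (deriv g.C t * g.E t - 4 * g.C t * deriv g.E t) / g.E t ^ 5 := by
  have hE := (g.E_pos t ht).ne'
  have h := ((g.diffC ht).hasDerivAt.div ((g.diffE ht).hasDerivAt.pow 4) (pow_ne_zero 4 hE)).deriv
  have e : (fun τ => g.C τ / g.E τ ^ 4) = (g.C / g.E ^ 4) := rfl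
  rw [e, h]
  simp only [Pi.pow_apply]
  field_simp
  push_cast
  ring

variable {g} {p : Fin 3 → ℝ} (ε δ : ℤˣ) (hp : p 0 ∈ g.dom)

/-- A transformation of the symmetry pseudogroup. -/
abbrev trafo (g : TopParameters) (ε δ : ℤˣ) : LocalTransformation :=
  (reflection ε δ).comp g.toTransformation

/-- Germs at p of functions of t alone: m stands for √D', primes denote derivatives in t, and a
final i denotes the reciprocal. -/
abbrev gE : SGerm p := tGerm p g.E (g.smoothE hp)
abbrev gEi : SGerm p := tGerm p _ (g.smooth_Ei hp)
abbrev gE' : SGerm p := tGerm p _ (contDiffAt_deriv (g.smoothE hp))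
abbrev gE'' : SGerm p := tGerm p _ (contDiffAt_deriv (contDiffAt_deriv (g.smoothE hp)))
abbrev gm : SGerm p := tGerm p _ (g.smooth_m hp)
abbrev gmi : SGerm p := tGerm p _ (g.smooth_mi hp)
abbrev gm' : SGerm p := tGerm p _ (contDiffAt_deriv (g.smooth_m hp))
abbrev gA : SGerm p := tGerm p g.A (g.smoothA hp)
abbrev gA' : SGerm p := tGerm p _ (contDiffAt_deriv (g.smoothA hp))
abbrev gB : SGerm p := tGerm p g.B (g.smoothB hp)
abbrev gB' : SGerm p := tGerm p _ (contDiffAt_deriv (g.smoothB hp))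
abbrev gC : SGerm p := tGerm p g.C (g.smoothC hp)
abbrev gC' : SGerm p := tGerm p _ (contDiffAt_deriv (g.smoothC hp))
abbrev gD : SGerm p := tGerm p g.D (g.smoothD hp)
/-- The germ of a constant sign. -/
abbrev gs (p : Fin 3 → ℝ) (ε : ℤˣ) : SGerm p := algebraMap ℝ (SGerm p) ((ε : ℤ) : ℝ)

/-- The germ of the coordinate `x` of the transformed point. -/
def gX : SGerm p := gs p ε * (gE hp ^ 2 * coordGerm p 1 + gE hp * gE' hp * coordGerm p 2 ^ 2
  + gC hp * coordGerm p 2 + gA hp)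

/-- The germ of the coordinate `y` of the transformed point. -/
def gY : SGerm p := gs p ε * gs p δ * (gm hp * gE hp * coordGerm p 2 + gB hp)

theorem smooth_base (hp : p 0 ∈ g.dom) : ContDiffAt ℝ ∞ (g.trafo ε δ).base p := by
  have hc : ∀ i, ContDiffAt ℝ ∞ (fun q : Fin 3 → ℝ => q i) p := fun i => contDiffAt_apply ℝ ℝ i p
  have hE := contDiffAt_comp_zero (g.smoothE hp)
  have hE' := contDiffAt_comp_zero (contDiffAt_deriv (g.smoothE hp))
  refine contDiffAt_pi.mpr fun i => ?_
  fin_cases i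
  · exact contDiffAt_const.mul (contDiffAt_comp_zero (g.smoothD hp))
  · exact contDiffAt_const.mul (((((hE.pow 2).mul (hc 1)).add ((hE.mul hE').mul ((hc 2).pow 2))).add
      ((contDiffAt_comp_zero (g.smoothC hp)).mul (hc 2))).add (contDiffAt_comp_zero (g.smoothA hp)))
  · exact contDiffAt_const.mul ((((contDiffAt_comp_zero (g.smooth_m hp)).mul hE).mul (hc 2)).add
      (contDiffAt_comp_zero (g.smoothB hp)))

theorem germ_base_zero (h : ContDiffAt ℝ ∞ (fun q => (g.trafo ε δ).base q 0) p) :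
    germ _ h = gs p ε * gD hp := rfl

theorem germ_base_one (h : ContDiffAt ℝ ∞ (fun q => (g.trafo ε δ).base q 1) p) :
    germ _ h = gX ε hp := rfl

theorem germ_base_two (h : ContDiffAt ℝ ∞ (fun q => (g.trafo ε δ).base q 2) p) :
    germ _ h = gY ε δ hp := rfl

theorem gs_mul_self (ε : ℤˣ) : gs p ε * gs p ε = 1 := by
  rw [← map_mul, sign_mul_self, map_one]

theorem gE_mul_gEi : gE hp * gEi hp = 1 := by
  refine germ_eq_iff (hg := contDiffAt_const).mpr ?_
  filter_upwards [(continuous_apply (0 : Fin 3)).continuousAt.eventually (g.mem_nhds hp)] with q hq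
  exact mul_inv_cancel₀ (g.E_pos _ hq).ne'

theorem gm_mul_gmi : gm hp * gmi hp = 1 := by
  refine germ_eq_iff (hg := contDiffAt_const).mpr ?_
  filter_upwards [(continuous_apply (0 : Fin 3)).continuousAt.eventually (g.mem_nhds hp)] with q hq
  exact mul_inv_cancel₀ (g.m_pos hq).ne'

theorem germDeriv_gD : germDeriv p 0 (gD hp) = gm hp ^ 2 := by
  rw [germDeriv_zero_tGerm]
  refine germ_eq_iff.mpr ?_
  filter_upwards [(continuous_apply (0 : Fin 3)).continuousAt.eventually (g.mem_nhds hp)] with q hq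
  exact (g.m_sq hq).symm

theorem germDeriv_gs (i : Fin 3) (ε : ℤˣ) : germDeriv p i (gs p ε) = 0 := Derivation.map_algebraMap _ _

theorem germDeriv_germ_two (i : Fin 3) : germDeriv p i (2 : SGerm p) = 0 :=
  Derivation.map_natCast _ 2

theorem two_germ : (2 : SGerm p) = germ (fun _ => 2) contDiffAt_const := rfl

/-- The germ of `Y_y`. -/
def gP : SGerm p := gs p ε * gs p δ * (gm hp * gE hp)

/-- The germ of `X_x`. -/
def gQ : SGerm p := gs p ε * gE hp ^ 2

/-- The inverse of `Y_y`. -/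
def gPi : SGerm p := gs p ε * gs p δ * (gmi hp * gEi hp)

/-- The inverse of `X_x`. -/
def gQi : SGerm p := gs p ε * gEi hp ^ 2

/-- The germ of `X_y`. -/
def gc : SGerm p := gs p ε * (2 * gE hp * gE' hp * coordGerm p 2 + gC hp)

/-- The germ of `X_t`. -/
def gXt : SGerm p := gs p ε * (2 * gE hp * gE' hp * coordGerm p 1 +
  (gE' hp ^ 2 + gE hp * gE'' hp) * coordGerm p 2 ^ 2 + gC' hp * coordGerm p 2 + gA' hp)

/-- The germ of `Y_t`. -/
def gYt : SGerm p := gs p ε * gs p δ * ((gm' hp * gE hp + gm hp * gE' hp) * coordGerm p 2 + gB' hp)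

/-- With P = ε δ √D' E and Q = ε E^2 the quotient P^2 / Q is ε D'; this is the relation between the
three scalings on which the notion of point map rests. -/
theorem d0_gT : germDeriv p 0 (gs p ε * gD hp) = gP ε δ hp ^ 2 * gQi ε hp := by
  simp only [gP, gQi, Derivation.leibniz, smul_eq_mul, germDeriv_gs, germDeriv_gD]
  have h1 := gE_mul_gEi hp
  have h2 := gs_mul_self (p := p) ε
  have h3 := gs_mul_self (p := p) δ
  generalize gE hp = E at *
  generalize gEi hp = Ei at *
  generalize gs p ε = e at *
  generalize gs p δ = d at *
  linear_combination (-(e * (gm hp) ^ 2 * (e * e) * (d * d) * (E * Ei + 1))) * h1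
    - (e * (gm hp) ^ 2) * (d * d) * h2 - (e * (gm hp) ^ 2) * h3

theorem d1_gT : germDeriv p 1 (gs p ε * gD hp) = 0 := by
  simp only [mul_zero, Derivation.leibniz, Derivation.leibniz_pow, smul_eq_mul, map_add, germDeriv_gs,
    germDeriv_zero_tGerm, germDeriv_one_tGerm, germDeriv_two_tGerm, germDeriv_coordGerm,
    germDeriv_germ_two, germDeriv_gD, Fin.isValue, Fin.reduceEq, reduceIte]
  ring

theorem d2_gT : germDeriv p 2 (gs p ε * gD hp) = 0 := by
  simp only [mul_zero, Derivation.leibniz, Derivation.leibniz_pow, smul_eq_mul, map_add, germDeriv_gs,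
    germDeriv_zero_tGerm, germDeriv_one_tGerm, germDeriv_two_tGerm, germDeriv_coordGerm,
    germDeriv_germ_two, germDeriv_gD, Fin.isValue, Fin.reduceEq, reduceIte]
  ring

theorem d0_gX : germDeriv p 0 (gX ε hp) = gXt ε hp := by
  simp only [gX, gXt, Derivation.leibniz, Derivation.leibniz_pow, smul_eq_mul, map_add, germDeriv_gs,
    germDeriv_zero_tGerm, germDeriv_one_tGerm, germDeriv_two_tGerm, germDeriv_coordGerm,
    germDeriv_germ_two, germDeriv_gD, Fin.isValue, Fin.reduceEq, reduceIte]
  ring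

theorem d1_gX : germDeriv p 1 (gX ε hp) = gQ ε hp := by
  simp only [gX, gQ, Derivation.leibniz, Derivation.leibniz_pow, smul_eq_mul, map_add, germDeriv_gs,
    germDeriv_zero_tGerm, germDeriv_one_tGerm, germDeriv_two_tGerm, germDeriv_coordGerm,
    germDeriv_germ_two, germDeriv_gD, Fin.isValue, Fin.reduceEq, reduceIte]
  ring

theorem d2_gX : germDeriv p 2 (gX ε hp) = gc ε hp := by
  simp only [gX, gc, Derivation.leibniz, Derivation.leibniz_pow, smul_eq_mul, map_add, germDeriv_gs,
    germDeriv_zero_tGerm, germDeriv_one_tGerm, germDeriv_two_tGerm, germDeriv_coordGerm,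
    germDeriv_germ_two, germDeriv_gD, Fin.isValue, Fin.reduceEq, reduceIte]
  ring

theorem d0_gY : germDeriv p 0 (gY ε δ hp) = gYt ε δ hp := by
  simp only [gY, gYt, Derivation.leibniz, Derivation.leibniz_pow, smul_eq_mul, map_add, germDeriv_gs,
    germDeriv_zero_tGerm, germDeriv_one_tGerm, germDeriv_two_tGerm, germDeriv_coordGerm,
    germDeriv_germ_two, germDeriv_gD, Fin.isValue, Fin.reduceEq, reduceIte]
  ring

theorem d1_gY : germDeriv p 1 (gY ε δ hp) = 0 := by
  simp only [gY, Derivation.leibniz, Derivation.leibniz_pow, smul_eq_mul, map_add, germDeriv_gs,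
    germDeriv_zero_tGerm, germDeriv_one_tGerm, germDeriv_two_tGerm, germDeriv_coordGerm,
    germDeriv_germ_two, germDeriv_gD, Fin.isValue, Fin.reduceEq, reduceIte]
  ring

theorem d2_gY : germDeriv p 2 (gY ε δ hp) = gP ε δ hp := by
  simp only [gY, gP, Derivation.leibniz, Derivation.leibniz_pow, smul_eq_mul, map_add, germDeriv_gs,
    germDeriv_zero_tGerm, germDeriv_one_tGerm, germDeriv_two_tGerm, germDeriv_coordGerm,
    germDeriv_germ_two, germDeriv_gD, Fin.isValue, Fin.reduceEq, reduceIte]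
  ring

theorem d1_gP : germDeriv p 1 (gP ε δ hp) = 0 := by
  simp only [gP, Derivation.leibniz, Derivation.leibniz_pow, smul_eq_mul, map_add, germDeriv_gs,
    germDeriv_zero_tGerm, germDeriv_one_tGerm, germDeriv_two_tGerm, germDeriv_coordGerm,
    germDeriv_germ_two, germDeriv_gD, Fin.isValue, Fin.reduceEq, reduceIte]
  ring

theorem d2_gP : germDeriv p 2 (gP ε δ hp) = 0 := by
  simp only [gP, Derivation.leibniz, Derivation.leibniz_pow, smul_eq_mul, map_add, germDeriv_gs,
    germDeriv_zero_tGerm, germDeriv_one_tGerm, germDeriv_two_tGerm, germDeriv_coordGerm,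
    germDeriv_germ_two, germDeriv_gD, Fin.isValue, Fin.reduceEq, reduceIte]
  ring

theorem d1_gQ : germDeriv p 1 (gQ ε hp) = 0 := by
  simp only [gQ, Derivation.leibniz, Derivation.leibniz_pow, smul_eq_mul, map_add, germDeriv_gs,
    germDeriv_zero_tGerm, germDeriv_one_tGerm, germDeriv_two_tGerm, germDeriv_coordGerm,
    germDeriv_germ_two, germDeriv_gD, Fin.isValue, Fin.reduceEq, reduceIte]
  ring

theorem d2_gQ : germDeriv p 2 (gQ ε hp) = 0 := by
  simp only [gQ, Derivation.leibniz, Derivation.leibniz_pow, smul_eq_mul, map_add, germDeriv_gs,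
    germDeriv_zero_tGerm, germDeriv_one_tGerm, germDeriv_two_tGerm, germDeriv_coordGerm,
    germDeriv_germ_two, germDeriv_gD, Fin.isValue, Fin.reduceEq, reduceIte]
  ring

theorem d1_gc : germDeriv p 1 (gc ε hp) = 0 := by
  simp only [gc, Derivation.leibniz, Derivation.leibniz_pow, smul_eq_mul, map_add, germDeriv_gs,
    germDeriv_zero_tGerm, germDeriv_one_tGerm, germDeriv_two_tGerm, germDeriv_coordGerm,
    germDeriv_germ_two, germDeriv_gD, Fin.isValue, Fin.reduceEq, reduceIte]
  ring

theorem d1_gYt : germDeriv p 1 (gYt ε δ hp) = 0 := by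
  simp only [gYt, Derivation.leibniz, Derivation.leibniz_pow, smul_eq_mul, map_add, germDeriv_gs,
    germDeriv_zero_tGerm, germDeriv_one_tGerm, germDeriv_two_tGerm, germDeriv_coordGerm,
    germDeriv_germ_two, germDeriv_gD, Fin.isValue, Fin.reduceEq, reduceIte]
  ring

theorem d2_gc : germDeriv p 2 (gc ε hp) = germDeriv p 0 (gQ ε hp) := by
  simp only [gc, gQ, Derivation.leibniz, Derivation.leibniz_pow, smul_eq_mul, map_add, germDeriv_gs,
    germDeriv_zero_tGerm, germDeriv_one_tGerm, germDeriv_two_tGerm, germDeriv_coordGerm,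
    germDeriv_germ_two, germDeriv_gD, Fin.isValue, Fin.reduceEq, reduceIte]
  ring

theorem d2_gYt : germDeriv p 2 (gYt ε δ hp) = germDeriv p 0 (gP ε δ hp) := by
  simp only [gYt, gP, Derivation.leibniz, Derivation.leibniz_pow, smul_eq_mul, map_add, germDeriv_gs,
    germDeriv_zero_tGerm, germDeriv_one_tGerm, germDeriv_two_tGerm, germDeriv_coordGerm,
    germDeriv_germ_two, germDeriv_gD, Fin.isValue, Fin.reduceEq, reduceIte]
  ring

theorem d1_gXt : germDeriv p 1 (gXt ε hp) = germDeriv p 0 (gQ ε hp) := by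
  simp only [gXt, gQ, Derivation.leibniz, Derivation.leibniz_pow, smul_eq_mul, map_add, germDeriv_gs,
    germDeriv_zero_tGerm, germDeriv_one_tGerm, germDeriv_two_tGerm, germDeriv_coordGerm,
    germDeriv_germ_two, germDeriv_gD, Fin.isValue, Fin.reduceEq, reduceIte]
  ring

theorem d2_gXt : germDeriv p 2 (gXt ε hp) = germDeriv p 0 (gc ε hp) := by
  simp only [gXt, gc, Derivation.leibniz, Derivation.leibniz_pow, smul_eq_mul, map_add, germDeriv_gs,
    germDeriv_zero_tGerm, germDeriv_one_tGerm, germDeriv_two_tGerm, germDeriv_coordGerm,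
    germDeriv_germ_two, germDeriv_gD, Fin.isValue, Fin.reduceEq, reduceIte]
  ring

/-- The explicit formula for u agrees with the uniform expression in P, Q, c and Y_t. All signs
cancel because ε^2 = δ^2 = 1. -/
theorem pull_u {s s' : (Fin 3 → ℝ) → (Fin 2 → ℝ)} (hs : ContDiffAt ℝ ∞ s p)
    (hs' : ContDiffAt ℝ ∞ s' ((g.trafo ε δ).base p))
    (h : ∀ᶠ q in 𝓝 p, s' ((g.trafo ε δ).base q) = (g.trafo ε δ).fibre q (s q)) :
    germPull _ (smooth_base ε δ hp) ((germData s' hs').w 0) =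
      gQ ε hp * gPi ε δ hp * (germData s hs).w 0 + gQ ε hp * gPi ε δ hp ^ 2 * gYt ε δ hp
        - 2 * gc ε hp * gPi ε δ hp := by
  have hδ := sign_mul_self δ
  have hε := sign_mul_self ε
  change germPull _ (smooth_base ε δ hp) (germ _ _) = _ * germ _ _ + _ - _
  rw [germPull_germ]
  simp only [gQ, gPi, gYt, gc, coordGerm, tGerm, gs, algebraMap_germ, two_germ, germ_mul, germ_sub, germ_add, germ_pow]
  rw [germ_eq_iff]
  filter_upwards [h, (continuous_apply (0 : Fin 3)).continuousAt.eventually (g.mem_nhds hp)]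
    with q hq hd
  have hE := (g.E_pos _ hd).ne'
  have hm := (g.m_pos hd).ne'
  rw [hq]
  change ((δ : ℤ) : ℝ) * (g.E (q 0) / g.m (q 0) * s q 0
      - q 2 / g.E (q 0) ^ 2 * deriv (fun τ => g.E τ ^ 3 / √(deriv g.D τ)) (q 0)
      + deriv g.B (q 0) / deriv g.D (q 0)
      - 2 * g.C (q 0) / (g.E (q 0) * g.m (q 0))) = _
  rw [g.deriv_cube_div hd, ← g.m_sq hd]
  generalize ((ε : ℤ) : ℝ) = e at *
  generalize ((δ : ℤ) : ℝ) = d at *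
  have he : e ^ 2 = 1 := by rw [pow_two, hε]
  have hd' : d ^ 2 = 1 := by rw [pow_two, hδ]
  have hd3 : d ^ 3 = d := by rw [pow_succ, hd', one_mul]
  field_simp
  simp only [he, hd', hd3]
  ring

theorem pull_v {s s' : (Fin 3 → ℝ) → (Fin 2 → ℝ)} (hs : ContDiffAt ℝ ∞ s p)
    (hs' : ContDiffAt ℝ ∞ s' ((g.trafo ε δ).base p))
    (h : ∀ᶠ q in 𝓝 p, s' ((g.trafo ε δ).base q) = (g.trafo ε δ).fibre q (s q)) :
    germPull _ (smooth_base ε δ hp) ((germData s' hs').w 1) =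
      gQ ε hp ^ 2 * gPi ε δ hp ^ 2 * (germData s hs).w 1
        + gQ ε hp * gPi ε δ hp ^ 2 * gc ε hp * (germData s hs).w 0
        + gQ ε hp * gPi ε δ hp ^ 2 * gXt ε hp - gc ε hp ^ 2 * gPi ε δ hp ^ 2 := by
  have hδ := sign_mul_self δ
  have hε := sign_mul_self ε
  change germPull _ (smooth_base ε δ hp) (germ _ _) = _ * germ _ _ + _ * germ _ _ + _ - _
  rw [germPull_germ]
  simp only [gQ, gPi, gXt, gc, coordGerm, tGerm, gs, algebraMap_germ, two_germ, germ_mul, germ_sub, germ_add, germ_pow]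
  rw [germ_eq_iff]
  filter_upwards [h, (continuous_apply (0 : Fin 3)).continuousAt.eventually (g.mem_nhds hp)]
    with q hq hd
  have hE := (g.E_pos _ hd).ne'
  have hm := (g.m_pos hd).ne'
  rw [hq]
  change g.E (q 0) ^ 2 / deriv g.D (q 0) * s q 1
      + (g.C (q 0) + 2 * g.E (q 0) * deriv g.E (q 0) * q 2) / deriv g.D (q 0) * s q 0
      + (g.E (q 0) * deriv (deriv g.E) (q 0) - 3 * deriv g.E (q 0) ^ 2) / deriv g.D (q 0) * q 2 ^ 2
      + g.E (q 0) ^ 4 / deriv g.D (q 0) * deriv (fun τ => g.C τ / g.E τ ^ 4) (q 0) * q 2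
      + 2 * g.E (q 0) * deriv g.E (q 0) / deriv g.D (q 0) * q 1
      + (g.E (q 0) ^ 2 * deriv g.A (q 0) - g.C (q 0) ^ 2) / (deriv g.D (q 0) * g.E (q 0) ^ 2) = _
  rw [g.deriv_div_fourth hd, ← g.m_sq hd]
  generalize ((ε : ℤ) : ℝ) = e at *
  generalize ((δ : ℤ) : ℝ) = d at *
  have he : e ^ 2 = 1 := by rw [pow_two, hε]
  have hd' : d ^ 2 = 1 := by rw [pow_two, hδ]
  have he4 : e ^ 4 = 1 := by rw [show e ^ 4 = (e ^ 2) ^ 2 by ring, he, one_pow]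
  have hd4 : d ^ 4 = 1 := by rw [show d ^ 4 = (d ^ 2) ^ 2 by ring, hd', one_pow]
  field_simp
  simp only [he, hd', he4, hd4]
  ring

/-- The point map of germs defined by a transformation of the symmetry pseudogroup. -/
def pointMap {s s' : (Fin 3 → ℝ) → (Fin 2 → ℝ)} (hs : ContDiffAt ℝ ∞ s p)
    (hs' : ContDiffAt ℝ ∞ s' ((g.trafo ε δ).base p))
    (h : ∀ᶠ q in 𝓝 p, s' ((g.trafo ε δ).base q) = (g.trafo ε δ).fibre q (s q)) :
    PointMap (germData s' hs') (germData s hs) where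
  φ := germPull _ (smooth_base ε δ hp)
  P := gP ε δ hp
  Q := gQ ε hp
  Pi := gPi ε δ hp
  Qi := gQi ε hp
  c := gc ε hp
  Xt := gXt ε hp
  Yt := gYt ε δ hp
  hP := by
    rw [gP, gPi]
    linear_combination (gs p ε * gs p ε * gs p δ * gs p δ * gE hp * gEi hp) * gm_mul_gmi hp +
      (gs p ε * gs p ε * gs p δ * gs p δ) * gE_mul_gEi hp +
      gs p δ * gs p δ * gs_mul_self (p := p) ε + gs_mul_self (p := p) δ
  hQ := by
    rw [gQ, gQi]
    linear_combination (gs p ε * gs p ε) * (gE hp * gEi hp + 1) * gE_mul_gEi hp +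
      gs_mul_self (p := p) ε
  chain_x k := by
    simp only [germData, germDeriv_germPull, Fin.sum_univ_three, germ_base_zero ε δ hp,
      germ_base_one ε δ hp, germ_base_two ε δ hp, d1_gT ε hp, d1_gX, d1_gY]
    ring
  chain_y k := by
    simp only [germData, germDeriv_germPull, Fin.sum_univ_three, germ_base_zero ε δ hp,
      germ_base_one ε δ hp, germ_base_two ε δ hp, d2_gT ε hp, d2_gX, d2_gY]
    ring
  chain_t k := by
    simp only [germData, germDeriv_germPull, Fin.sum_univ_three, germ_base_zero ε δ hp,
      germ_base_one ε δ hp, germ_base_two ε δ hp, d0_gT ε δ hp, d0_gX, d0_gY]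
    ring
  dxP := d1_gP ε δ hp
  dyP := d2_gP ε δ hp
  dxQ := d1_gQ ε hp
  dyQ := d2_gQ ε hp
  dxc := d1_gc ε hp
  dyc := d2_gc ε hp
  dxYt := d1_gYt ε δ hp
  dyYt := d2_gYt ε δ hp
  dxXt := d1_gXt ε hp
  dyXt := d2_gXt ε hp
  map_u := pull_u ε δ hp hs hs' h
  map_v := pull_v ε δ hp hs hs' h

end TopParameters

end

end ManakovSantini

/-! ### Lower bound: independent invariants for all non-pivot coordinates. -/

namespace ManakovSantini

noncomputable section

/-! ### Rational invariants from relative invariants -/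

theorem exists_pointMap {k : ℕ} {Φ : LocalTransformation} (hΦ : Φ ∈ symmetryPseudogroup)
    {θ θ' : JetSpace k} (h : ProlongedMaps k Φ θ θ') :
    ∃ (p p' : Fin 3 → ℝ) (s s' : (Fin 3 → ℝ) → (Fin 2 → ℝ)) (hs : ContDiffAt ℝ ∞ s p)
      (hs' : ContDiffAt ℝ ∞ s' p') (G : PointMap (germData s' hs') (germData s hs)),
      (∀ a, germEval p (G.φ a) = germEval p' a) ∧ jet k s p = θ ∧ jet k s' p' = θ' := by
  obtain ⟨ε, δ, g, rfl⟩ := hΦ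
  obtain ⟨p, s, s', hp, hs, hs', he, hθ, hθ'⟩ := h
  exact ⟨p, _, s, s', hs, hs', TopParameters.pointMap ε δ hp.1 hs hs' he,
    germEval_germPull (TopParameters.smooth_base ε δ hp.1), hθ, hθ'⟩

theorem exists_rename_val {k : ℕ} {f : DiffPoly} (hf : f ∈ ordLE k) :
    ∃ P : MvPolynomial (JetCoordLE k) ℝ, MvPolynomial.rename Subtype.val P = f := by
  refine ⟨MvPolynomial.supportedEquivMvPolynomial {c | jetOrder c ≤ k} ⟨f, hf⟩, ?_⟩
  refine (coe_supportedEquivMvPolynomial_symm {c | jetOrder c ≤ k} _).symm.trans ?_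
  rw [AlgEquiv.symm_apply_apply]

/-- The numerator and the monomial in u_x, u_xx have equal weight, and the weight is a unit; hence
the quotient takes equal values at θ and at its image. -/
theorem isDifferentialInvariant_of_relInv {k i l : ℕ} {f : DiffPoly}
    {P Q : MvPolynomial (JetCoordLE k) ℝ} (hP : MvPolynomial.rename Subtype.val P = f)
    (hQ : MvPolynomial.rename Subtype.val Q = uxVar ^ i * uxxVar ^ l) (hf : RelInv i l f)
    {F : RationalFunctions k} (hQ0 : restrict k Q ∈ nonZeroDivisors (CoordinateRing k))
    (hF : F * algebraMap (CoordinateRing k) (RationalFunctions k) (restrict k Q) =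
      algebraMap (CoordinateRing k) (RationalFunctions k) (restrict k P)) :
    IsDifferentialInvariant k F := by
  refine ⟨P, Q, hQ0, hF, ?_⟩
  intro Φ hΦ θ _ θ' _ h h1 h2
  obtain ⟨p, p', s, s', hs, hs', G, hχ, rfl, rfl⟩ := exists_pointMap hΦ h
  have ev : ∀ (R : MvPolynomial (JetCoordLE k) ℝ) {f : DiffPoly},
      MvPolynomial.rename Subtype.val R = f →
      MvPolynomial.eval (jet k s p) R = germEval p ((germData s hs).ev f) ∧
      MvPolynomial.eval (jet k s' p') R = germEval p (G.φ ((germData s' hs').ev f)) := by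
    rintro R f rfl
    rw [eval_eq_aeval_extendJet, eval_eq_aeval_extendJet, hχ,
      ← germEval_ev k hs (rename_val_mem_ordLE R), ← germEval_ev k hs' (rename_val_mem_ordLE R)]
    exact ⟨rfl, rfl⟩
  have hPu : germEval p G.P ≠ 0 := by
    have := congrArg (germEval p) G.hP
    rw [map_mul, map_one] at this
    exact left_ne_zero_of_mul_eq_one this
  have hQu : germEval p G.Q ≠ 0 := by
    have := congrArg (germEval p) G.hQ
    rw [map_mul, map_one] at this
    exact left_ne_zero_of_mul_eq_one this
  have r1 := congrArg (germEval p) (relInv_ux G)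
  have r2 := congrArg (germEval p) (relInv_uxx G)
  have r3 := congrArg (germEval p) (hf G)
  simp only [map_mul, map_pow] at r1 r2 r3
  rw [(ev Q hQ).2] at h2
  rw [(ev P hP).1, (ev P hP).2, (ev Q hQ).1, (ev Q hQ).2, ← r3]
  simp only [map_mul, map_pow] at h2 ⊢
  rw [← r1, ← r2]
  have h3 := left_ne_zero_of_mul h2
  have h4 := right_ne_zero_of_mul h2
  rw [div_eq_div_iff _ h2]
  · ring
  · simp only [add_zero, zero_add, pow_zero, mul_one, pow_one, mul_pow]
    refine mul_ne_zero (mul_ne_zero h3 (pow_ne_zero _ hPu)) (mul_ne_zero h4 ?_)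
    exact mul_ne_zero (pow_ne_zero _ hPu) (pow_ne_zero _ hQu)

/-- The coordinates of order at most `k` that are not normalized by the group parameters. -/
abbrev InvariantCoord (k : ℕ) : Type := {z : FreeCoordLE k // z.1 ∉ Set.range pivot}

/-- Every free coordinate of order at most 1 is a pivot; this accounts for s_0 = s_1 = 0. -/
theorem two_le_freeOrder {z : FreeCoord} (hz : z ∉ Set.range pivot) : 2 ≤ freeOrder z := by
  have hz' : ∀ s, pivot s ≠ z := fun s h => hz ⟨s, h⟩
  by_contra! hlt
  rcases z with i | ⟨a, α, β, γ⟩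
  · exact hz' (Sum.inl i) rfl
  · simp only [freeOrder] at hlt
    obtain rfl | rfl : a = 0 ∨ a = 1 := by omega
    · rcases β with _ | β
      · cases γ
        · exact hz' (Sum.inr (α, 1)) rfl
        · exact hz' (Sum.inr (α + 1, 3)) rfl
      · obtain rfl : α = 0 := by omega
        obtain rfl : β = 0 := by omega
        cases γ
        · exact hz' (Sum.inr (0, 3)) rfl
        · exact hz' (Sum.inr (0, 2)) rfl
    · rcases β with _ | β
      · cases γ
        · exact hz' (Sum.inr (α, 0)) rfl
        · exact hz' (Sum.inr (α + 1, 2)) rfl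
      · obtain rfl : α = 0 := by omega
        obtain rfl : β = 0 := by omega
        cases γ
        · exact hz' (Sum.inr (1, 4)) rfl
        · simp at hlt

/-- The form needed for the Jacobian: the numerator is led by z, and the denominator is a monomial
in the pivots u_x and u_xx, so it behaves as a constant under differentiation in non-pivot
directions. -/
theorem exists_invariant {k : ℕ} (z : InvariantCoord k) :
    ∃ (F : differentialInvariants k) (a b : MvPolynomial (FreeCoordLE k) ℝ), b ≠ 0 ∧
      rationalChart k F.1 * algebraMap _ _ b = algebraMap _ _ a ∧
      MvPolynomial.pderiv z.1 a ≠ 0 ∧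
      (∀ ζ, freeKey z.1.1 < freeKey ζ.1 → MvPolynomial.pderiv ζ a = 0) ∧
      ∀ ζ : FreeCoordLE k, ζ.1 ∉ Set.range pivot → MvPolynomial.pderiv ζ b = 0 := by
  obtain ⟨f, i, l, hf, hinv, hlead⟩ := hasInvariant_of_notMem_range_pivot z.2
  have hk : 2 ≤ k := (two_le_freeOrder z.2).trans z.1.2
  obtain ⟨P, hP⟩ := exists_rename_val (ordLE_mono z.1.2 hf)
  obtain ⟨Q, hQ⟩ := exists_rename_val (k := k) (f := uxVar ^ i * uxxVar ^ l)
    (mul_mem (pow_mem (ordLE_mono (by omega) uxVar_mem) i) (pow_mem (ordLE_mono hk uxxVar_mem) l))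
  have hcP : MvPolynomial.rename Subtype.val (chart k P) = restrictFree f := by
    rw [rename_chart, restrictLE, AlgHom.comp_apply, hP]
  have hcQ : MvPolynomial.rename Subtype.val (chart k Q) =
      freeX 0 0 1 false ^ i * freeX 0 0 2 false ^ l := by
    rw [rename_chart, restrictLE, AlgHom.comp_apply, hQ, map_mul, map_pow, map_pow,
      restrictFree_uxVar, restrictFree_uxxVar]
  have hQ0 : chart k Q ≠ 0 := by
    intro h0
    rw [h0, map_zero] at hcQ
    exact mul_ne_zero (pow_ne_zero _ (freeX_ne_zero _ _ _ _)) (pow_ne_zero _ (freeX_ne_zero _ _ _ _))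
      hcQ.symm
  have hren : ∀ (ζ : FreeCoordLE k) (R : MvPolynomial (FreeCoordLE k) ℝ),
      MvPolynomial.pderiv ζ.1 (MvPolynomial.rename Subtype.val R) =
        MvPolynomial.rename Subtype.val (MvPolynomial.pderiv ζ R) := fun ζ R =>
    MvPolynomial.pderiv_rename Subtype.val_injective ζ R
  have hinj := MvPolynomial.rename_injective (R := ℝ)
    (Subtype.val : FreeCoordLE k → FreeCoord) Subtype.val_injective
  have hQn := (restrict_mem_nonZeroDivisors_iff k Q).mpr hQ0
  set q := algebraMap (CoordinateRing k) (RationalFunctions k) (restrict k Q) with hq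
  have hq0 : q ≠ 0 := by
    rw [hq, Ne, map_eq_zero_iff _ (IsFractionRing.injective _ _)]
    exact nonZeroDivisors.ne_zero hQn
  have hF := div_mul_cancel₀
    (algebraMap (CoordinateRing k) (RationalFunctions k) (restrict k P)) hq0
  refine ⟨⟨_, isDifferentialInvariant_of_relInv hP hQ hinv hQn hF⟩, chart k P, chart k Q, hQ0, ?_,
    ?_, ?_, ?_⟩
  · rw [← rationalChart_algebraMap, ← rationalChart_algebraMap, ← map_mul, hF]
  · intro h0
    have := hren z.1 (chart k P)
    rw [h0, map_zero, hcP] at this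
    exact hlead.2 this
  · intro ζ hζ
    apply hinj
    rw [← hren, hcP, map_zero]
    exact hlead.1 ζ.1 hζ
  · intro ζ hζ
    apply hinj
    have h1 : MvPolynomial.pderiv ζ.1 (freeX 0 0 1 false) = 0 :=
      MvPolynomial.pderiv_X_of_ne fun h => hζ ⟨Sum.inr (0, 3), h⟩
    have h2 : MvPolynomial.pderiv ζ.1 (freeX 0 0 2 false) = 0 :=
      MvPolynomial.pderiv_X_of_ne fun h => hζ ⟨Sum.inr (0, 4), h⟩
    rw [← hren, hcQ, map_zero]
    simp only [Derivation.leibniz, Derivation.leibniz_pow, h1, h2, smul_zero, add_zero]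

/-- The enumeration of the free coordinates of order at most `k`. -/
def freeCoordLEEquiv (k : ℕ) :
    FreeCoordLE k ≃ Fin 3 ⊕ (Fin 2 × Fin (k + 1) × Fin (k + 1)) where
  toFun
    | ⟨Sum.inl i, _⟩ => Sum.inl i
    -- The pairs (α, α + β) without y-derivative fill the part i ≤ j of a square of side k + 1, and
    -- the pairs (α + β + 1, α) with a y-derivative fill the part i > j.
    | ⟨Sum.inr (a, α, β, false), h⟩ => Sum.inr (a,
        ⟨α, by simp only [freeOrder, Bool.toNat_false] at h; omega⟩,
        ⟨α + β, by simp only [freeOrder, Bool.toNat_false] at h; omega⟩)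
    | ⟨Sum.inr (a, α, β, true), h⟩ => Sum.inr (a,
        ⟨α + β + 1, by simp only [freeOrder, Bool.toNat_true] at h; omega⟩,
        ⟨α, by simp only [freeOrder, Bool.toNat_true] at h; omega⟩)
  invFun
    | Sum.inl i => ⟨Sum.inl i, Nat.zero_le k⟩
    | Sum.inr (a, i, j) => if h : i ≤ j then
        ⟨Sum.inr (a, i, j - i, false), by simp only [freeOrder, Bool.toNat_false]; omega⟩
      else ⟨Sum.inr (a, j, i - j - 1, true), by simp only [freeOrder, Bool.toNat_true]; omega⟩
  left_inv := by
    rintro ⟨i | ⟨a, α, β, γ⟩, h⟩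
    · rfl
    · cases γ
      · simp
      · simp only [Fin.mk_le_mk]
        rw [dif_neg (by omega)]
        simp only [Subtype.mk.injEq, Sum.inr.injEq, Prod.mk.injEq, true_and, and_true]
        omega
  right_inv := by
    rintro (i | ⟨a, i, j⟩)
    · rfl
    · by_cases h : i ≤ j
      · simp only [h, dif_pos, Sum.inr.injEq, Prod.mk.injEq, true_and]
        refine Fin.ext ?_
        simp only
        omega
      · simp only [h, dif_neg, not_false_eq_true, Sum.inr.injEq, Prod.mk.injEq, true_and, and_true]
        refine Fin.ext ?_
        simp only
        omega

instance (k : ℕ) : Finite (FreeCoordLE k) := Finite.of_equiv _ (freeCoordLEEquiv k).symm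

/-! ### Counting free, pivot and non-pivot coordinates. -/

theorem card_freeCoordLE (k : ℕ) : Nat.card (FreeCoordLE k) = 3 + 2 * (k + 1) ^ 2 := by
  rw [Nat.card_congr (freeCoordLEEquiv k)]
  simp
  ring

theorem pivot_injective : Function.Injective pivot := by
  rintro (i | ⟨j, a⟩) (i' | ⟨j', a'⟩) h
  · simpa [pivot] using h
  · fin_cases a' <;> rcases j' with _ | j' <;> simp [pivot] at h
  · fin_cases a <;> rcases j with _ | j <;> simp [pivot] at h
  · fin_cases a <;> fin_cases a' <;> rcases j with _ | j <;> rcases j' with _ | j' <;>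
      simp [pivot] at h ⊢ <;> omega

/-- The pivot of a parameter of degree j has order j, except in degree 0, where the orders go up to
2. This is the reason for k ≥ 2, and for the irregular values at k ≤ 1. -/
theorem freeOrder_pivot_le {k j : ℕ} (hk : 2 ≤ k) (a : Fin 5) :
    freeOrder (pivot (Sum.inr (j, a))) ≤ k ↔ j ≤ k := by
  fin_cases a <;> rcases j with _ | j <;> simp [pivot, freeOrder] <;> omega

/-- The group parameters acting effectively on `k`-jets. -/
abbrev GroupIndexLE (k : ℕ) : Type := {s : GroupIndex // freeOrder (pivot s) ≤ k}

theorem finite_groupIndexLE (k : ℕ) : Finite (GroupIndexLE k) :=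
  Finite.of_injective (fun s : GroupIndexLE k => (⟨pivot s.1, s.2⟩ : FreeCoordLE k))
    fun _ _ h => Subtype.ext (pivot_injective (Subtype.mk.inj h))

theorem card_groupIndexLE {k : ℕ} (hk : 2 ≤ k) : Nat.card (GroupIndexLE k) = 5 * k + 8 := by
  let e : GroupIndexLE k ≃ Fin 3 ⊕ (Fin (k + 1) × Fin 5) :=
    { toFun := fun s => match s with
        | ⟨Sum.inl i, _⟩ => Sum.inl i
        | ⟨Sum.inr (j, a), h⟩ => Sum.inr (⟨j, by have := (freeOrder_pivot_le hk a).mp h; omega⟩, a)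
      invFun := fun s => match s with
        | Sum.inl i => ⟨Sum.inl i, Nat.zero_le k⟩
        | Sum.inr (j, a) => ⟨Sum.inr (j, a), (freeOrder_pivot_le hk a).mpr (by omega)⟩
      left_inv := by rintro ⟨i | ⟨j, a⟩, h⟩ <;> rfl
      right_inv := by rintro (i | ⟨j, a⟩) <;> rfl }
  rw [Nat.card_congr e]
  simp
  ring

theorem card_invariantCoord_add (k : ℕ) :
    Nat.card (InvariantCoord k) + Nat.card (GroupIndexLE k) = Nat.card (FreeCoordLE k) := by
  have e : GroupIndexLE k ≃ {z : FreeCoordLE k // z.1 ∈ Set.range pivot} :=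
    Equiv.ofBijective (fun s => ⟨⟨pivot s.1, s.2⟩, s.1, rfl⟩) ⟨fun s s' h =>
      Subtype.ext (pivot_injective (congrArg (fun z => z.1.1) h)), by
        rintro ⟨⟨z, h⟩, s, hs⟩
        have hs' : pivot s = z := hs
        subst hs'
        exact ⟨⟨s, h⟩, rfl⟩⟩
  rw [Nat.card_congr e, ← Nat.card_sum]
  classical
  exact Nat.card_congr ((Equiv.sumComm _ _).trans
    (Equiv.sumCompl (fun z : FreeCoordLE k => z.1 ∈ Set.range pivot)))

theorem isEmpty_invariantCoord {k : ℕ} (hk : k ≤ 1) : IsEmpty (InvariantCoord k) :=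
  ⟨fun z => absurd ((two_le_freeOrder z.2).trans z.1.2) (by omega)⟩

/-- Among the non-pivot columns the Jacobian matrix of the constructed invariants is triangular for
the ranking of the coordinates, with nonzero diagonal. -/
theorem mk_invariantCoord_le (k : ℕ) : Cardinal.mk (InvariantCoord k) ≤ invariantRank k := by
  have : Fintype (FreeCoordLE k) := Fintype.ofFinite _
  have : Fintype (InvariantCoord k) := Fintype.ofFinite _
  choose F a b hb hF hdiag hlt hpiv using exists_invariant (k := k)
  have halg : AlgebraicIndependent ℝ fun z => rationalChart k (F z).1 := by
    apply algebraicIndependent_of_jacobian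
    have hD : ∀ (z ζ : InvariantCoord k), ratDeriv ζ.1 (rationalChart k (F z).1) *
        algebraMap _ _ (b z) = algebraMap _ _ (MvPolynomial.pderiv ζ.1 (a z)) := by
      intro z ζ
      have h := congrArg (ratDeriv ζ.1) (hF z)
      rw [Derivation.leibniz, ratDeriv_algebraMap, ratDeriv_algebraMap, hpiv z ζ.1 ζ.2, map_zero,
        smul_zero, zero_add, smul_eq_mul, mul_comm] at h
      exact h
    have hb' : ∀ z, algebraMap _ (RatFun (FreeCoordLE k)) (b z) ≠ 0 := fun z =>
      (map_ne_zero_iff _ (IsFractionRing.injective _ _)).mpr (hb z)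
    refine linearIndependent_of_triangular (fun z => freeKey z.1.1) (fun z z' h =>
      Subtype.ext (Subtype.ext (freeKey_injective h))) (fun z => z.1) _ ?_ ?_
    · intro z ζ h
      have := hD z ζ
      rw [hlt z ζ.1 h, map_zero] at this
      exact (mul_eq_zero.mp this).resolve_right (hb' z)
    · intro z h0
      have := hD z z
      rw [h0, zero_mul] at this
      exact hdiag z ((map_eq_zero_iff _ (IsFractionRing.injective _ _)).mp this.symm)
  have h2 : AlgebraicIndependent ℝ F :=
    AlgebraicIndependent.of_comp ((rationalChart k).comp (differentialInvariants k).val) halg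
  exact h2.cardinalMk_le_trdeg

end

end ManakovSantini

/-! ### Upper bound: finite-order calculus at a point of the equation. -/

namespace ManakovSantini

noncomputable section

/-! ### Vanishing order -/

section Van

variable {R : Type} [CommRing R] [Algebra ℝ R] (A : DiffData R) (χ : R →ₐ[ℝ] ℝ)

/-- All derivatives of `g` of order less than `n` vanish at the point `χ`. -/
def IsVan : ℕ → R → Prop
  | 0, _ => True
  | n + 1, g => χ g = 0 ∧ ∀ i, IsVan n (A.d i g)

variable {A χ}

theorem IsVan.of_succ {n : ℕ} {g : R} (h : IsVan A χ (n + 1) g) : IsVan A χ n g := by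
  induction n generalizing g with
  | zero => trivial
  | succ n ih => exact ⟨h.1, fun i => ih (h.2 i)⟩

theorem IsVan.add {n : ℕ} {g h : R} (hg : IsVan A χ n g) (hh : IsVan A χ n h) :
    IsVan A χ n (g + h) := by
  induction n generalizing g h with
  | zero => trivial
  | succ n ih =>
    refine ⟨by rw [map_add, hg.1, hh.1, add_zero], fun i => ?_⟩
    rw [map_add]
    exact ih (hg.2 i) (hh.2 i)

theorem IsVan.mul_left {n : ℕ} {g : R} (hg : IsVan A χ n g) (h : R) : IsVan A χ n (h * g) := by
  induction n generalizing g h with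
  | zero => trivial
  | succ n ih =>
    refine ⟨by rw [map_mul, hg.1, mul_zero], fun i => ?_⟩
    rw [Derivation.leibniz, smul_eq_mul, smul_eq_mul, mul_comm g]
    exact (ih (hg.2 i) h).add (ih hg.of_succ _)

theorem IsVan.mul_right {n : ℕ} {g : R} (hg : IsVan A χ n g) (h : R) : IsVan A χ n (g * h) :=
  mul_comm h g ▸ hg.mul_left h

theorem IsVan.neg {n : ℕ} {g : R} (hg : IsVan A χ n g) : IsVan A χ n (-g) :=
  neg_one_mul g ▸ hg.mul_left (-1)

theorem IsVan.sub {n : ℕ} {g h : R} (hg : IsVan A χ n g) (hh : IsVan A χ n h) :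
    IsVan A χ n (g - h) :=
  sub_eq_add_neg g h ▸ hg.add hh.neg

theorem IsVan.mul {m n : ℕ} {g h : R} (hg : IsVan A χ m g) (hh : IsVan A χ n h) :
    IsVan A χ (m + n) (g * h) := by
  obtain ⟨N, hN⟩ : ∃ N, m + n = N := ⟨_, rfl⟩
  induction N generalizing m n g h with
  | zero => rw [hN]; trivial
  | succ N ih =>
    rcases m with _ | m
    · rw [zero_add]; exact hh.mul_left g
    rcases n with _ | n
    · exact hg.mul_right h
    rw [show m + 1 + (n + 1) = (m + 1 + n) + 1 by omega]
    refine ⟨by rw [map_mul, hg.1, zero_mul], fun i => ?_⟩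
    rw [Derivation.leibniz, smul_eq_mul, smul_eq_mul, mul_comm h]
    refine (ih hg (hh.2 i) (by omega)).add ?_
    have := ih (hg.2 i) hh (by omega)
    rwa [show m + (n + 1) = m + 1 + n by omega] at this

theorem IsVan.pow {g : R} (hg : IsVan A χ 1 g) (n : ℕ) : IsVan A χ n (g ^ n) := by
  induction n with
  | zero => trivial
  | succ n ih => rw [pow_succ]; exact ih.mul hg

theorem IsVan.mono {m n : ℕ} (hmn : m ≤ n) {g : R} (hg : IsVan A χ n g) : IsVan A χ m g := by
  induction hmn with
  | refl => exact hg
  | step _ ih => exact ih hg.of_succ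

theorem IsVan.iterate {n : ℕ} (k : ℕ) (i : Fin 3) {g : R} (hg : IsVan A χ (n + k) g) :
    IsVan A χ n ((A.d i)^[k] g) := by
  induction k generalizing g with
  | zero => exact hg
  | succ k ih => rw [Function.iterate_succ_apply]; exact ih (hg.2 i)

theorem IsVan.eval_dIter {n : ℕ} {σ : Fin 3 → ℕ} (hσ : ∑ i, σ i < n) {g : R}
    (hg : IsVan A χ n g) : χ (dIter A.d σ g) = 0 := by
  rw [Fin.sum_univ_three] at hσ
  have h : IsVan A χ (1 + σ 0 + σ 1 + σ 2) g := hg.mono (by omega)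
  exact (((h.iterate (σ 2) 2).iterate (σ 1) 1).iterate (σ 0) 0).1

theorem isVan_of_eval_dIter {n : ℕ} {g : R}
    (h : ∀ σ : Fin 3 → ℕ, ∑ i, σ i < n → χ (dIter A.d σ g) = 0) : IsVan A χ n g := by
  induction n generalizing g with
  | zero => trivial
  | succ n ih =>
    refine ⟨h 0 (by simp), fun i => ih fun σ hσ => ?_⟩
    rw [dIter_d A.comm, d_dIter A.comm]
    refine h _ ?_
    simp only [Pi.add_apply, Finset.sum_add_distrib, Finset.sum_pi_single', Finset.mem_univ, if_true]
    omega

/-- Point maps preserve the vanishing order. -/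
theorem IsVan.of_phi {R' : Type} [CommRing R'] [Algebra ℝ R'] {A' : DiffData R'} {χ' : R' →ₐ[ℝ] ℝ}
    (G : PointMap A' A) (hχ : ∀ a, χ (G.φ a) = χ' a) {n : ℕ} {g : R'}
    (h : IsVan A χ n (G.φ g)) : IsVan A' χ' n g := by
  induction n generalizing g with
  | zero => trivial
  | succ n ih =>
    refine ⟨(hχ g).symm.trans h.1, fun i => ih ?_⟩
    have h1 : IsVan A χ n (G.φ (A'.d 1 g)) := by
      rw [G.phi_dx]; exact (h.2 1).mul_left _
    have h2 : IsVan A χ n (G.φ (A'.d 2 g)) := by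
      rw [G.phi_dy]; exact ((h.2 2).sub ((h.2 1).mul_left _)).mul_left _
    have h0 : IsVan A χ n (G.φ (A'.d 0 g)) := by
      rw [G.phi_dt, ← G.phi_dy, ← G.phi_dx]
      exact (((h.2 0).sub (h2.mul_left _)).sub (h1.mul_left _)).mul_left _
    fin_cases i
    exacts [h0, h1, h2]

/-- A jet in 𝓔_k is represented by a section satisfying the system only to finite order at the
point. Vanishing order is preserved by point maps, and the transformed equations are combinations of
the original ones, so the image jet also lies on the equation. -/
theorem isVan_msEquation_of_pointMap {R' : Type} [CommRing R'] [Algebra ℝ R'] {A' : DiffData R'}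
    {χ' : R' →ₐ[ℝ] ℝ} (G : PointMap A' A) (hχ : ∀ a, χ (G.φ a) = χ' a) {n : ℕ}
    (h : ∀ a, IsVan A χ n (A.ev (msEquation a))) (a : Fin 2) :
    IsVan A' χ' n (A'.ev (msEquation a)) := by
  refine IsVan.of_phi G hχ ?_
  fin_cases a
  · change IsVan A χ n (G.φ (A'.ev (msEquation 0)))
    rw [G.phi_msEquation_zero]
    exact (h 0).mul_left _
  · change IsVan A χ n (G.φ (A'.ev (msEquation 1)))
    rw [G.phi_msEquation_one]
    exact ((h 1).mul_left _).add ((h 0).mul_left _)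

end Van

/-! ### First order expansions of families -/

section Expansion

variable {R : Type} [CommRing R] [Algebra ℝ R] (A : DiffData R) (χ : R →ₐ[ℝ] ℝ)

/-- The derivatives of order at most `n` of the family `h`, at the point `χ`, are differentiable
with respect to the parameter at `0`, with the derivatives of `h₁` as their derivatives. -/
def HasExp : ℕ → (ℝ → R) → R → Prop
  | 0, h, h₁ => HasDerivAt (fun l => χ (h l)) (χ h₁) 0
  | n + 1, h, h₁ => HasDerivAt (fun l => χ (h l)) (χ h₁) 0 ∧
      ∀ i, HasExp n (fun l => A.d i (h l)) (A.d i h₁)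

/-- `h l = h 0 + l * h₁` up to terms of higher order in `l`. -/
def Expands (h : ℝ → R) (h₁ : R) : Prop := ∀ n, HasExp A χ n h h₁

variable {A χ}

theorem HasExp.hasDerivAt {n : ℕ} {h : ℝ → R} {h₁ : R} (H : HasExp A χ n h h₁) :
    HasDerivAt (fun l => χ (h l)) (χ h₁) 0 := by
  cases n with
  | zero => exact H
  | succ n => exact H.1

theorem HasExp.of_succ {n : ℕ} {h : ℝ → R} {h₁ : R} (H : HasExp A χ (n + 1) h h₁) :
    HasExp A χ n h h₁ := by
  induction n generalizing h h₁ with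
  | zero => exact H.1
  | succ n ih => exact ⟨H.1, fun i => ih (H.2 i)⟩

theorem HasExp.congr {n : ℕ} {h g : ℝ → R} {h₁ : R} (H : HasExp A χ n h h₁)
    (e : ∀ᶠ l in nhds 0, g l = h l) : HasExp A χ n g h₁ := by
  have e0 : HasDerivAt (fun l => χ (g l)) (χ h₁) 0 :=
    H.hasDerivAt.congr_of_eventuallyEq (e.mono fun l hl => congrArg χ hl)
  induction n generalizing h g h₁ with
  | zero => exact e0
  | succ n ih =>
    refine ⟨e0, fun i => ?_⟩
    have e' : ∀ᶠ l in nhds 0, A.d i (g l) = A.d i (h l) := e.mono fun l hl => congrArg _ hl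
    exact ih (H.2 i) e' ((H.2 i).hasDerivAt.congr_of_eventuallyEq
      (e'.mono fun l hl => congrArg χ hl))

theorem HasExp.add {n : ℕ} {h g : ℝ → R} {h₁ g₁ : R} (H : HasExp A χ n h h₁)
    (K : HasExp A χ n g g₁) : HasExp A χ n (fun l => h l + g l) (h₁ + g₁) := by
  have e0 : HasDerivAt (fun l => χ (h l + g l)) (χ (h₁ + g₁)) 0 := by
    simp only [map_add]; exact H.hasDerivAt.add K.hasDerivAt
  induction n generalizing h g h₁ g₁ with
  | zero => exact e0
  | succ n ih =>
    refine ⟨e0, fun i => ?_⟩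
    simp only [map_add]
    refine ih (H.2 i) (K.2 i) ?_
    simp only [map_add]
    exact (H.2 i).hasDerivAt.add (K.2 i).hasDerivAt

theorem HasExp.mul {n : ℕ} {h g : ℝ → R} {h₁ g₁ : R} (H : HasExp A χ n h h₁)
    (K : HasExp A χ n g g₁) : HasExp A χ n (fun l => h l * g l) (h 0 * g₁ + g 0 * h₁) := by
  have e0 : ∀ {h g : ℝ → R} {h₁ g₁ : R}, HasDerivAt (fun l => χ (h l)) (χ h₁) 0 →
      HasDerivAt (fun l => χ (g l)) (χ g₁) 0 →
      HasDerivAt (fun l => χ (h l * g l)) (χ (h 0 * g₁ + g 0 * h₁)) 0 := by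
    intro h g h₁ g₁ H K
    have e : χ (h 0 * g₁ + g 0 * h₁) = χ h₁ * χ (g 0) + χ (h 0) * χ g₁ := by
      simp only [map_mul, map_add]; ring
    rw [e]
    simp only [map_mul]
    exact H.mul K
  induction n generalizing h g h₁ g₁ with
  | zero => exact e0 H K
  | succ n ih =>
    refine ⟨e0 H.1 K.1, fun i => ?_⟩
    have := (ih H.of_succ (K.2 i)).add (ih K.of_succ (H.2 i))
    have e : A.d i (h 0 * g₁ + g 0 * h₁) = h 0 * A.d i g₁ + A.d i (g 0) * h₁ +
        (g 0 * A.d i h₁ + A.d i (h 0) * g₁) := by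
      simp only [Derivation.leibniz, smul_eq_mul, map_add]; ring
    rw [e]
    simp only [Derivation.leibniz, smul_eq_mul]
    exact this

theorem hasExp_const (n : ℕ) (g : R) : HasExp A χ n (fun _ => g) 0 := by
  have e0 : ∀ g : R, HasDerivAt (fun _ : ℝ => χ g) (χ 0) 0 := fun g => by
    rw [map_zero]; exact hasDerivAt_const _ _
  induction n generalizing g with
  | zero => exact e0 g
  | succ n ih => exact ⟨e0 g, fun i => by rw [map_zero]; exact ih _⟩

theorem hasExp_smul (n : ℕ) (g : R) : HasExp A χ n (fun l => l • g) g := by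
  have e0 : ∀ g : R, HasDerivAt (fun l : ℝ => χ (l • g)) (χ g) 0 := fun g => by
    simp only [map_smul, smul_eq_mul]
    simpa using (hasDerivAt_id (0 : ℝ)).mul_const (χ g)
  induction n generalizing g with
  | zero => exact e0 g
  | succ n ih => exact ⟨e0 g, fun i => by simp only [Derivation.map_smul]; exact ih _⟩

/-- The induction on the order uses d g = -g^2 d h, valid wherever h g = 1. It is enough to have
this for parameters near 0. -/
theorem HasExp.inv {n : ℕ} {h g : ℝ → R} {h₁ : R} (H : HasExp A χ n h h₁)
    (e : ∀ᶠ l in nhds 0, h l * g l = 1) : HasExp A χ n g (-(g 0 ^ 2 * h₁)) := by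
  have e1 := e.self_of_nhds
  have hne : χ (h 0) * χ (g 0) = 1 := by rw [← map_mul, e1, map_one]
  have e0 : HasDerivAt (fun l => χ (h l)) (χ h₁) 0 →
      HasDerivAt (fun l => χ (g l)) (χ (-(g 0 ^ 2 * h₁))) 0 := by
    intro H
    have h3 := H.inv (left_ne_zero_of_mul_eq_one hne)
    have h4 : -χ h₁ / χ (h 0) ^ 2 = χ (-(g 0 ^ 2 * h₁)) := by
      rw [map_neg, map_mul, map_pow, ← inv_eq_of_mul_eq_one_right hne]
      field_simp
    rw [h4] at h3
    refine h3.congr_of_eventuallyEq (e.mono fun l hl => ?_)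
    have : χ (h l) * χ (g l) = 1 := by rw [← map_mul, hl, map_one]
    exact (inv_eq_of_mul_eq_one_right this).symm
  induction n with
  | zero => exact e0 H
  | succ n ih =>
    refine ⟨e0 H.1, fun i => ?_⟩
    have hg := ih H.of_succ
    have := (((hasExp_const n (-1)).mul (hg.mul hg)).mul (H.2 i))
    have h5 : A.d i (-(g 0 ^ 2 * h₁)) = -1 * (g 0 * g 0) * A.d i h₁ + A.d i (h 0) *
        (-1 * (g 0 * -(g 0 ^ 2 * h₁) + g 0 * -(g 0 ^ 2 * h₁)) + g 0 * g 0 * 0) := by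
      rw [map_neg, Derivation.leibniz, Derivation.leibniz_pow, PointMap.d_inv e1]
      simp only [smul_eq_mul, nsmul_eq_mul]
      push_cast
      ring
    rw [h5]
    refine this.congr (e.mono fun l hl => ?_)
    rw [PointMap.d_inv hl]
    ring

theorem Expands.add {h g : ℝ → R} {h₁ g₁ : R} (H : Expands A χ h h₁) (K : Expands A χ g g₁) :
    Expands A χ (fun l => h l + g l) (h₁ + g₁) := fun n => (H n).add (K n)

theorem Expands.mul {h g : ℝ → R} {h₁ g₁ : R} (H : Expands A χ h h₁) (K : Expands A χ g g₁) :
    Expands A χ (fun l => h l * g l) (h 0 * g₁ + g 0 * h₁) := fun n => (H n).mul (K n)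

theorem expands_const (g : R) : Expands A χ (fun _ => g) 0 := fun n => hasExp_const n g

theorem expands_smul (g : R) : Expands A χ (fun l => l • g) g := fun n => hasExp_smul n g

theorem Expands.inv {h g : ℝ → R} {h₁ : R} (H : Expands A χ h h₁)
    (e : ∀ᶠ l in nhds 0, h l * g l = 1) : Expands A χ g (-(g 0 ^ 2 * h₁)) := fun n => (H n).inv e

theorem Expands.d {h : ℝ → R} {h₁ : R} (H : Expands A χ h h₁) (i : Fin 3) :
    Expands A χ (fun l => A.d i (h l)) (A.d i h₁) := fun n => (H (n + 1)).2 i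

theorem Expands.const_mul {h : ℝ → R} {h₁ : R} (H : Expands A χ h h₁) (g : R) :
    Expands A χ (fun l => g * h l) (g * h₁) := by
  have := (expands_const g).mul H
  rwa [mul_zero, add_zero] at this

theorem Expands.sub {h g : ℝ → R} {h₁ g₁ : R} (H : Expands A χ h h₁) (K : Expands A χ g g₁) :
    Expands A χ (fun l => h l - g l) (h₁ - g₁) := by
  have := H.add (K.const_mul (-1))
  simpa only [neg_mul, one_mul, ← sub_eq_add_neg] using this

theorem Expands.pow {h : ℝ → R} {h₁ : R} (H : Expands A χ h h₁) (n : ℕ) :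
    Expands A χ (fun l => h l ^ n) (n * h 0 ^ (n - 1) * h₁) := by
  induction n with
  | zero => simpa using expands_const (A := A) (χ := χ) 1
  | succ n ih =>
    have := ih.mul H
    simp only [← pow_succ] at this
    convert this using 1
    rcases n with _ | n
    · simp
    · simp only [Nat.add_sub_cancel]
      push_cast
      ring

end Expansion

end

end ManakovSantini

namespace ManakovSantini

noncomputable section

/-! ### Prolongation of infinitesimal transformations -/

theorem Expands.of_eq {R : Type} [CommRing R] [Algebra ℝ R] {A : DiffData R} {χ : R →ₐ[ℝ] ℝ}
    {h : ℝ → R} {h₁ h₂ : R} (H : Expands A χ h h₁) (e : h₁ = h₂) : Expands A χ h h₂ := e ▸ H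

/-- The coefficients of a family of point maps, with the infinitesimal transformation
`T₁ ∂_t + X₁ ∂_x + Y₁ ∂_y` of the base. -/
structure Variation {R : Type} [CommRing R] [Algebra ℝ R] (A : DiffData R) (χ : R →ₐ[ℝ] ℝ) where
  Q : ℝ → R
  Pi : ℝ → R
  Qi : ℝ → R
  c : ℝ → R
  Xt : ℝ → R
  Yt : ℝ → R
  T₁ : R
  X₁ : R
  Y₁ : R
  expQ : Expands A χ Q (A.d 1 X₁)
  expPi : Expands A χ Pi (-A.d 2 Y₁)
  expQi : Expands A χ Qi (-A.d 1 X₁)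
  expc : Expands A χ c (A.d 2 X₁)
  expXt : Expands A χ Xt (A.d 0 X₁)
  expYt : Expands A χ Yt (A.d 0 Y₁)
  Q0 : Q 0 = 1
  Pi0 : Pi 0 = 1
  Qi0 : Qi 0 = 1
  c0 : c 0 = 0
  Xt0 : Xt 0 = 0
  Yt0 : Yt 0 = 0
  d0T : A.d 0 T₁ = 2 * A.d 2 Y₁ - A.d 1 X₁
  d1T : A.d 1 T₁ = 0
  d2T : A.d 2 T₁ = 0
  d1Y : A.d 1 Y₁ = 0

namespace Variation

variable {R : Type} [CommRing R] [Algebra ℝ R] {A : DiffData R} {χ : R →ₐ[ℝ] ℝ}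
  (S : Variation A χ)

/-- The derivatives with respect to the new coordinates, for families of functions of the old
coordinates. -/
def opD : Fin 3 → (ℝ → R) → ℝ → R
  | 0, h => fun l => S.Pi l ^ 2 * S.Q l * (A.d 0 (h l)
      - S.Yt l * (S.Pi l * (A.d 2 (h l) - S.c l * S.Qi l * A.d 1 (h l)))
      - S.Xt l * (S.Qi l * A.d 1 (h l)))
  | 1, h => fun l => S.Qi l * A.d 1 (h l)
  | 2, h => fun l => S.Pi l * (A.d 2 (h l) - S.c l * S.Qi l * A.d 1 (h l))

theorem opD_zero (i : Fin 3) (h : ℝ → R) : S.opD i h 0 = A.d i (h 0) := by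
  fin_cases i <;> simp [opD, S.Pi0, S.Qi0, S.Q0, S.c0, S.Xt0, S.Yt0]

/-- The family `h` has the first order expansion given by the prolongation of the infinitesimal
transformation, with characteristic `C`. -/
def Prolongs (h : ℝ → R) (C : R) : Prop :=
  Expands A χ h (C + S.T₁ * A.d 0 (h 0) + S.X₁ * A.d 1 (h 0) + S.Y₁ * A.d 2 (h 0))

variable {S}

/-- The prolongation formula in evolutionary form: once the transport term along T₁, X₁, Y₁ is split
off, the corrections from differentiating T₁, X₁, Y₁ cancel against the variation of the chain-rule
coefficients. Only the characteristic gets differentiated. -/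
theorem Prolongs.opD {h : ℝ → R} {C : R} (H : S.Prolongs h C) (i : Fin 3) :
    S.Prolongs (S.opD i h) (A.d i C) := by
  have h1 := S.expQi.mul (H.d 1)
  have h2 := S.expPi.mul ((H.d 2).sub ((S.expc.mul S.expQi).mul (H.d 1)))
  have h0 := ((S.expPi.pow 2).mul S.expQ).mul (((H.d 0).sub (S.expYt.mul h2)).sub (S.expXt.mul h1))
  rw [Prolongs, S.opD_zero]
  fin_cases i
  · refine h0.of_eq ?_
    simp only [S.Pi0, S.Qi0, S.Q0, S.c0, S.Xt0, S.Yt0, map_add, Derivation.leibniz, smul_eq_mul,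
      S.d0T, A.comm 1 0, A.comm 2 0, Fin.zero_eta]
    push_cast
    ring
  · refine h1.of_eq ?_
    simp only [S.Qi0, map_add, Derivation.leibniz, smul_eq_mul, S.d1T, S.d1Y, A.comm 1 0, A.comm 2 1,
      Fin.mk_one]
    ring
  · refine h2.of_eq ?_
    simp only [S.Pi0, S.Qi0, S.c0, map_add, Derivation.leibniz, smul_eq_mul, S.d2T, A.comm 1 2,
      A.comm 2 0, Fin.reduceFinMk]
    ring

variable (S)

/-- Iterated derivatives with respect to the new coordinates. -/
def opIter (σ : Fin 3 → ℕ) (h : ℝ → R) : ℝ → R :=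
  (S.opD 0)^[σ 0] ((S.opD 1)^[σ 1] ((S.opD 2)^[σ 2] h))

variable {S}

theorem iterate_opD_zero (i : Fin 3) (n : ℕ) (h : ℝ → R) :
    ((S.opD i)^[n] h) 0 = (A.d i)^[n] (h 0) := by
  induction n generalizing h with
  | zero => rfl
  | succ n ih => rw [Function.iterate_succ_apply, ih, S.opD_zero, Function.iterate_succ_apply]

theorem opIter_zero (σ : Fin 3 → ℕ) (h : ℝ → R) : S.opIter σ h 0 = dIter A.d σ (h 0) := by
  simp only [opIter, iterate_opD_zero, dIter]

theorem Prolongs.iterate {h : ℝ → R} {C : R} (H : S.Prolongs h C) (i : Fin 3) (n : ℕ) :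
    S.Prolongs ((S.opD i)^[n] h) ((A.d i)^[n] C) := by
  induction n generalizing h C with
  | zero => exact H
  | succ n ih => rw [Function.iterate_succ_apply, Function.iterate_succ_apply]; exact ih (H.opD i)

theorem Prolongs.opIter {h : ℝ → R} {C : R} (H : S.Prolongs h C) (σ : Fin 3 → ℕ) :
    S.Prolongs (S.opIter σ h) (dIter A.d σ C) :=
  ((H.iterate 2 (σ 2)).iterate 1 (σ 1)).iterate 0 (σ 0)

variable (S)

/-- The families of transformed dependent variables. -/
def fibre : Fin 2 → ℝ → R :=
  ![fun l => S.Q l * S.Pi l * A.w 0 + S.Q l * S.Pi l ^ 2 * S.Yt l - 2 * S.c l * S.Pi l,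
    fun l => S.Q l ^ 2 * S.Pi l ^ 2 * A.w 1 + S.Q l * S.Pi l ^ 2 * S.c l * A.w 0
      + S.Q l * S.Pi l ^ 2 * S.Xt l - S.c l ^ 2 * S.Pi l ^ 2]

/-- The infinitesimal transformation of the dependent variables. -/
def fibre₁ : Fin 2 → R :=
  ![(A.d 1 S.X₁ - A.d 2 S.Y₁) * A.w 0 + A.d 0 S.Y₁ - 2 * A.d 2 S.X₁,
    2 * (A.d 1 S.X₁ - A.d 2 S.Y₁) * A.w 1 + A.d 2 S.X₁ * A.w 0 + A.d 0 S.X₁]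

/-- The characteristic of the infinitesimal transformation. -/
def char (a : Fin 2) : R :=
  S.fibre₁ a - S.T₁ * A.d 0 (A.w a) - S.X₁ * A.d 1 (A.w a) - S.Y₁ * A.d 2 (A.w a)

theorem fibre_zero (a : Fin 2) : S.fibre a 0 = A.w a := by
  fin_cases a <;> simp [fibre, S.Pi0, S.Q0, S.c0, S.Xt0, S.Yt0]

theorem prolongs_fibre (a : Fin 2) : S.Prolongs (S.fibre a) (S.char a) := by
  rw [Prolongs, S.fibre_zero, char]
  have key : Expands A χ (S.fibre a) (S.fibre₁ a) := by
    fin_cases a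
    · refine ((((S.expQ.mul S.expPi).mul (expands_const (A.w 0))).add
        ((S.expQ.mul (S.expPi.pow 2)).mul S.expYt)).sub
        (((expands_const 2).mul S.expc).mul S.expPi)).of_eq ?_
      simp [fibre₁, S.Pi0, S.Q0, S.c0, S.Yt0]
      ring
    · refine (((((S.expQ.pow 2).mul (S.expPi.pow 2)).mul (expands_const (A.w 1))).add
        (((S.expQ.mul (S.expPi.pow 2)).mul S.expc).mul (expands_const (A.w 0)))).add
        ((S.expQ.mul (S.expPi.pow 2)).mul S.expXt)).sub
        ((S.expc.pow 2).mul (S.expPi.pow 2)) |>.of_eq ?_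
      simp [fibre₁, S.Pi0, S.Q0, S.c0, S.Xt0]
      ring
  exact key.of_eq (by ring)

/-- The first order variation of the jet coordinates. -/
def jetVar (a : Fin 2) (σ : Fin 3 → ℕ) : R :=
  dIter A.d σ (S.char a) + S.T₁ * A.d 0 (dIter A.d σ (A.w a))
    + S.X₁ * A.d 1 (dIter A.d σ (A.w a)) + S.Y₁ * A.d 2 (dIter A.d σ (A.w a))

theorem expands_opIter_fibre (a : Fin 2) (σ : Fin 3 → ℕ) :
    Expands A χ (S.opIter σ (S.fibre a)) (S.jetVar a σ) := by
  have := (S.prolongs_fibre a).opIter σ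
  rwa [Prolongs, opIter_zero, S.fibre_zero] at this

theorem hasDerivAt_opIter_fibre (a : Fin 2) (σ : Fin 3 → ℕ) :
    HasDerivAt (fun l => χ (S.opIter σ (S.fibre a) l)) (χ (S.jetVar a σ)) 0 :=
  S.expands_opIter_fibre a σ 0

/-- The point map `G` has the coefficients of the family `S` at the parameter `l`. -/
structure Matches {R' : Type} [CommRing R'] [Algebra ℝ R'] {A' : DiffData R'} (G : PointMap A' A)
    (l : ℝ) : Prop where
  Q : G.Q = S.Q l
  Pi : G.Pi = S.Pi l
  Qi : G.Qi = S.Qi l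
  c : G.c = S.c l
  Xt : G.Xt = S.Xt l
  Yt : G.Yt = S.Yt l

variable {S} {R' : Type} [CommRing R'] [Algebra ℝ R'] {A' : DiffData R'} {G : PointMap A' A} {l : ℝ}

theorem Matches.phi_d (M : S.Matches G l) (i : Fin 3) {h : R'} {H : ℝ → R} (e : G.φ h = H l) :
    G.φ (A'.d i h) = S.opD i H l := by
  fin_cases i
  · refine (G.phi_dt h).trans ?_
    rw [M.Q, M.Pi, M.Qi, M.c, M.Xt, M.Yt, e]; rfl
  · refine (G.phi_dx h).trans ?_
    rw [M.Qi, e]; rfl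
  · refine (G.phi_dy h).trans ?_
    rw [M.Pi, M.Qi, M.c, e]; rfl

theorem Matches.phi_iterate (M : S.Matches G l) (i : Fin 3) (n : ℕ) {h : R'} {H : ℝ → R}
    (e : G.φ h = H l) : G.φ ((A'.d i)^[n] h) = (S.opD i)^[n] H l := by
  induction n generalizing h H with
  | zero => exact e
  | succ n ih => rw [Function.iterate_succ_apply, Function.iterate_succ_apply]; exact ih (M.phi_d i e)

/-- The jet coordinates of the transformed section are thus given by one explicit family in the old
ring, even though the transformed section and its ring of germs vary with the parameter. -/
theorem Matches.phi_dIter (M : S.Matches G l) (a : Fin 2) (σ : Fin 3 → ℕ) :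
    G.φ (dIter A'.d σ (A'.w a)) = S.opIter σ (S.fibre a) l := by
  refine M.phi_iterate 0 _ (M.phi_iterate 1 _ (M.phi_iterate 2 _ ?_))
  fin_cases a
  · refine G.map_u.trans ?_
    rw [M.Q, M.Pi, M.c, M.Yt]; rfl
  · refine G.map_v.trans ?_
    rw [M.Q, M.Pi, M.c, M.Xt]; rfl

end Variation

end

end ManakovSantini

namespace ManakovSantini

noncomputable section

set_option linter.unusedSimpArgs false

/-! ### Infinitesimal symmetries -/

/-- Parameters of a curve in the pseudogroup, with first order terms concentrated in degree `j`. -/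
structure CurveParam where
  j : ℕ
  n : ℝ
  e : ℝ
  c : ℝ
  b : ℝ
  a : ℝ
  t₀ : ℝ
  x₀ : ℝ
  y₀ : ℝ

section Infinitesimal

variable {R : Type} [CommRing R] [Algebra ℝ R] (A : DiffData R) (χ : R →ₐ[ℝ] ℝ)

/-- The base coordinates centered at the point `χ`. -/
def centered (i : Fin 3) : R := A.b i - algebraMap ℝ R (χ (A.b i))

variable {A χ}

theorem d_centered (i j : Fin 3) : A.d i (centered A χ j) = if j = i then 1 else 0 := by
  rw [centered, map_sub, Derivation.map_algebraMap, sub_zero, A.d_b]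

theorem eval_centered (i : Fin 3) : χ (centered A χ i) = 0 := by
  rw [centered, map_sub, AlgHom.commutes]
  exact sub_self _

theorem isVan_centered (i : Fin 3) : IsVan A χ 1 (centered A χ i) :=
  ⟨eval_centered i, fun _ => trivial⟩

theorem isVan_pow_centered (i : Fin 3) (n : ℕ) : IsVan A χ n (centered A χ i ^ n) :=
  (isVan_centered i).pow n

theorem iterate_d_pow_centered (i : Fin 3) (n : ℕ) :
    (A.d i)^[n] (centered A χ i ^ n) = (n.factorial : R) := by
  induction n with
  | zero => simp
  | succ n ih =>
    have hn : ∀ (k : ℕ) (x : R), (A.d i)^[k] (((n + 1 : ℕ) : R) * x) =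
        ((n + 1 : ℕ) : R) * (A.d i)^[k] x := by
      intro k
      induction k with
      | zero => intro x; rfl
      | succ k ih =>
        intro x
        rw [Function.iterate_succ_apply, Function.iterate_succ_apply, Derivation.leibniz,
          Derivation.map_natCast, smul_zero, add_zero, smul_eq_mul, ih]
    rw [Function.iterate_succ_apply, Derivation.leibniz_pow, d_centered, if_pos rfl, nsmul_eq_mul,
      Nat.add_sub_cancel, smul_eq_mul, mul_one, hn, ih, Nat.factorial_succ, Nat.cast_mul]

variable (A χ) (κ : CurveParam)

/-- The infinitesimal transformation of `t`. -/
def infT : R := algebraMap ℝ R (2 * κ.n / (κ.j + 1)) * centered A χ 0 ^ (κ.j + 1)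
  + algebraMap ℝ R κ.t₀

/-- The infinitesimal transformation of `x`. -/
def infX : R := algebraMap ℝ R κ.e * (2 * centered A χ 0 ^ κ.j * centered A χ 1
    + A.d 0 (centered A χ 0 ^ κ.j) * centered A χ 2 ^ 2)
  + algebraMap ℝ R κ.c * centered A χ 0 ^ κ.j * centered A χ 2
  + algebraMap ℝ R κ.a * centered A χ 0 ^ (κ.j + 1) + algebraMap ℝ R κ.x₀

/-- The infinitesimal transformation of `y`. -/
def infY : R := algebraMap ℝ R (κ.n + κ.e) * centered A χ 0 ^ κ.j * centered A χ 2
  + algebraMap ℝ R κ.b * centered A χ 0 ^ (κ.j + 1) + algebraMap ℝ R κ.y₀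

variable {A χ}

theorem d0_centered (j : Fin 3) : A.d 0 (centered A χ j) = if j = 0 then 1 else 0 := d_centered 0 j
theorem d1_centered (j : Fin 3) : A.d 1 (centered A χ j) = if j = 1 then 1 else 0 := d_centered 1 j
theorem d2_centered (j : Fin 3) : A.d 2 (centered A χ j) = if j = 2 then 1 else 0 := d_centered 2 j

theorem d0_pow_succ (j : ℕ) : A.d 0 (centered A χ 0 ^ (j + 1)) =
    ((j : R) + 1) * centered A χ 0 ^ j := by
  simp [Derivation.leibniz_pow, d0_centered]

theorem d1_pow (j : ℕ) : A.d 1 (centered A χ 0 ^ j) = 0 := by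
  simp [Derivation.leibniz_pow, d1_centered]

theorem d2_pow (j : ℕ) : A.d 2 (centered A χ 0 ^ j) = 0 := by
  simp [Derivation.leibniz_pow, d2_centered]

variable (A χ) in
theorem exists_pow (j : ℕ) : ∃ τ, centered A χ 0 ^ j = τ ∧ A.d 1 τ = 0 ∧ A.d 2 τ = 0 ∧
    A.d 1 (A.d 0 τ) = 0 ∧ A.d 2 (A.d 0 τ) = 0 ∧ A.d 1 (A.d 0 (A.d 0 τ)) = 0 ∧
    A.d 2 (A.d 0 (A.d 0 τ)) = 0 :=
  ⟨_, rfl, d1_pow j, d2_pow j, by rw [A.comm, d1_pow, map_zero], by rw [A.comm, d2_pow, map_zero],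
    by rw [A.comm, A.comm 1 0, d1_pow, map_zero, map_zero],
    by rw [A.comm, A.comm 2 0, d2_pow, map_zero, map_zero]⟩

theorem d0_infT : A.d 0 (infT A χ κ) = algebraMap ℝ R (2 * κ.n) * centered A χ 0 ^ κ.j := by
  rw [infT, map_add, Derivation.leibniz, d0_pow_succ, Derivation.map_algebraMap,
    Derivation.map_algebraMap, smul_zero, add_zero, add_zero, smul_eq_mul, ← mul_assoc]
  congr 1
  have h : ((κ.j : R) + 1) = algebraMap ℝ R (κ.j + 1) := by simp
  rw [h, ← map_mul]
  congr 1
  have : (κ.j : ℝ) + 1 ≠ 0 := by positivity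
  field_simp

theorem d1_infT : A.d 1 (infT A χ κ) = 0 := by
  rw [infT, map_add, Derivation.leibniz, d1_pow, Derivation.map_algebraMap,
    Derivation.map_algebraMap, smul_zero, smul_zero, add_zero, add_zero]

theorem d2_infT : A.d 2 (infT A χ κ) = 0 := by
  rw [infT, map_add, Derivation.leibniz, d2_pow, Derivation.map_algebraMap,
    Derivation.map_algebraMap, smul_zero, smul_zero, add_zero, add_zero]

theorem d1_infX : A.d 1 (infX A χ κ) = algebraMap ℝ R (2 * κ.e) * centered A χ 0 ^ κ.j := by
  obtain ⟨τ, hτ, h1, h2, h10, h20, h100, h200⟩ := exists_pow A χ κ.j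
  obtain ⟨ρ, hρ, r1, r2, r10, r20, r100, r200⟩ := exists_pow A χ (κ.j + 1)
  rw [infX]
  simp only [hτ, hρ, map_add, map_sub, Derivation.leibniz, Derivation.map_algebraMap, smul_zero,
    Derivation.map_natCast, Derivation.map_one_eq_zero, add_zero, smul_eq_mul, d1_centered,
    PointMap.d_two, pow_two, h1, h10, h100, r1, Fin.reduceEq, reduceIte, map_mul, map_ofNat]
  ring

theorem d2_infX : A.d 2 (infX A χ κ) =
    algebraMap ℝ R (2 * κ.e) * A.d 0 (centered A χ 0 ^ κ.j) * centered A χ 2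
      + algebraMap ℝ R κ.c * centered A χ 0 ^ κ.j := by
  obtain ⟨τ, hτ, h1, h2, h10, h20, h100, h200⟩ := exists_pow A χ κ.j
  obtain ⟨ρ, hρ, r1, r2, r10, r20, r100, r200⟩ := exists_pow A χ (κ.j + 1)
  rw [infX]
  simp only [hτ, hρ, map_add, map_sub, Derivation.leibniz, Derivation.map_algebraMap, smul_zero,
    Derivation.map_natCast, Derivation.map_one_eq_zero, add_zero, smul_eq_mul, d2_centered,
    PointMap.d_two, pow_two, h2, h20, h200, r2, Fin.reduceEq, reduceIte, map_mul, map_ofNat]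
  ring

theorem d0_infX : A.d 0 (infX A χ κ) =
    algebraMap ℝ R κ.e * (2 * A.d 0 (centered A χ 0 ^ κ.j) * centered A χ 1
      + A.d 0 (A.d 0 (centered A χ 0 ^ κ.j)) * centered A χ 2 ^ 2)
    + algebraMap ℝ R κ.c * A.d 0 (centered A χ 0 ^ κ.j) * centered A χ 2
    + algebraMap ℝ R κ.a * (((κ.j : R) + 1) * centered A χ 0 ^ κ.j) := by
  rw [infX]
  generalize hp : centered A χ 0 ^ κ.j = τ
  simp only [map_add, Derivation.leibniz, Derivation.map_algebraMap, d0_pow_succ, smul_zero,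
    add_zero, smul_eq_mul, d0_centered, PointMap.d_two, hp, pow_two]
  simp
  ring

theorem d1_infY : A.d 1 (infY A χ κ) = 0 := by
  obtain ⟨τ, hτ, h1, h2, h10, h20, h100, h200⟩ := exists_pow A χ κ.j
  obtain ⟨ρ, hρ, r1, r2, r10, r20, r100, r200⟩ := exists_pow A χ (κ.j + 1)
  rw [infY]
  simp only [hτ, hρ, map_add, map_sub, Derivation.leibniz, Derivation.map_algebraMap, smul_zero,
    Derivation.map_natCast, Derivation.map_one_eq_zero, add_zero, smul_eq_mul, d1_centered,
    PointMap.d_two, pow_two, h1, h10, h100, r1, Fin.reduceEq, reduceIte, map_mul, map_ofNat]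
  ring

theorem d2_infY : A.d 2 (infY A χ κ) = algebraMap ℝ R (κ.n + κ.e) * centered A χ 0 ^ κ.j := by
  obtain ⟨τ, hτ, h1, h2, h10, h20, h100, h200⟩ := exists_pow A χ κ.j
  obtain ⟨ρ, hρ, r1, r2, r10, r20, r100, r200⟩ := exists_pow A χ (κ.j + 1)
  rw [infY]
  simp only [hτ, hρ, map_add, map_sub, Derivation.leibniz, Derivation.map_algebraMap, smul_zero,
    Derivation.map_natCast, Derivation.map_one_eq_zero, add_zero, smul_eq_mul, d2_centered,
    PointMap.d_two, pow_two, h2, h20, h200, r2, Fin.reduceEq, reduceIte, map_mul, map_ofNat]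
  ring

theorem d0_infY : A.d 0 (infY A χ κ) =
    algebraMap ℝ R (κ.n + κ.e) * A.d 0 (centered A χ 0 ^ κ.j) * centered A χ 2
    + algebraMap ℝ R κ.b * (((κ.j : R) + 1) * centered A χ 0 ^ κ.j) := by
  rw [infY]
  generalize hp : centered A χ 0 ^ κ.j = τ
  simp only [map_add, Derivation.leibniz, Derivation.map_algebraMap, d0_pow_succ, smul_zero,
    add_zero, smul_eq_mul, d0_centered, hp]
  simp
  ring

/-- The infinitesimal transformation of the base is given by the parameters `κ`. -/
structure Variation.HasParam (S : Variation A χ) (κ : CurveParam) : Prop where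
  T : S.T₁ = infT A χ κ
  X : S.X₁ = infX A χ κ
  Y : S.Y₁ = infY A χ κ

namespace Variation

variable {κ} {S : Variation A χ}

theorem dIter_010 (h : R) : dIter A.d ![0, 1, 0] h = A.d 1 h := rfl
theorem dIter_020 (h : R) : dIter A.d ![0, 2, 0] h = A.d 1 (A.d 1 h) := rfl
theorem dIter_011 (h : R) : dIter A.d ![0, 1, 1] h = A.d 1 (A.d 2 h) := rfl

theorem d_three (i : Fin 3) : A.d i 3 = 0 := mod_cast (A.d i).map_natCast 3

theorem fibre₁_zero (hS : S.HasParam κ) : S.fibre₁ 0 =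
    algebraMap ℝ R (κ.e - κ.n) * centered A χ 0 ^ κ.j * A.w 0
    + algebraMap ℝ R (κ.n - 3 * κ.e) * A.d 0 (centered A χ 0 ^ κ.j) * centered A χ 2
    + (algebraMap ℝ R κ.b * ((κ.j : R) + 1) - 2 * algebraMap ℝ R κ.c) * centered A χ 0 ^ κ.j := by
  simp only [fibre₁, Matrix.cons_val_zero, hS.X, hS.Y, d1_infX, d2_infY, d0_infY, d2_infX]
  simp only [map_add, map_sub, map_mul, map_ofNat]
  ring

theorem fibre₁_one (hS : S.HasParam κ) : S.fibre₁ 1 =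
    algebraMap ℝ R (2 * (κ.e - κ.n)) * centered A χ 0 ^ κ.j * A.w 1
    + (algebraMap ℝ R (2 * κ.e) * A.d 0 (centered A χ 0 ^ κ.j) * centered A χ 2
      + algebraMap ℝ R κ.c * centered A χ 0 ^ κ.j) * A.w 0
    + algebraMap ℝ R κ.e * (2 * A.d 0 (centered A χ 0 ^ κ.j) * centered A χ 1
      + A.d 0 (A.d 0 (centered A χ 0 ^ κ.j)) * centered A χ 2 ^ 2)
    + algebraMap ℝ R κ.c * A.d 0 (centered A χ 0 ^ κ.j) * centered A χ 2
    + algebraMap ℝ R κ.a * (((κ.j : R) + 1) * centered A χ 0 ^ κ.j) := by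
  simp only [fibre₁, Matrix.cons_val_one, Matrix.cons_val_zero, Matrix.cons_val_fin_one, hS.X, hS.Y, d1_infX, d2_infY, d0_infX,
    d2_infX]
  simp only [map_add, map_sub, map_mul, map_ofNat]
  ring

theorem d1_fibre₁_zero (hS : S.HasParam κ) : A.d 1 (S.fibre₁ 0) =
    algebraMap ℝ R (κ.e - κ.n) * centered A χ 0 ^ κ.j * A.d 1 (A.w 0) := by
  obtain ⟨τ, hτ, h1, h2, h10, h20, h100, h200⟩ := exists_pow A χ κ.j
  obtain ⟨ρ, hρ, r1, r2, r10, r20, r100, r200⟩ := exists_pow A χ (κ.j + 1)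
  rw [fibre₁_zero hS]
  simp only [hτ, hρ, map_add, map_sub, Derivation.leibniz, Derivation.map_algebraMap, smul_zero,
    Derivation.map_natCast, Derivation.map_one_eq_zero, add_zero, smul_eq_mul, d1_centered,
    PointMap.d_two, d_three, pow_two, h1, h10, h100, r1, Fin.reduceEq, reduceIte, map_mul, map_ofNat]
  ring

theorem d2_fibre₁_zero (hS : S.HasParam κ) : A.d 2 (S.fibre₁ 0) =
    algebraMap ℝ R (κ.e - κ.n) * centered A χ 0 ^ κ.j * A.d 2 (A.w 0)
    + algebraMap ℝ R (κ.n - 3 * κ.e) * A.d 0 (centered A χ 0 ^ κ.j) := by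
  obtain ⟨τ, hτ, h1, h2, h10, h20, h100, h200⟩ := exists_pow A χ κ.j
  obtain ⟨ρ, hρ, r1, r2, r10, r20, r100, r200⟩ := exists_pow A χ (κ.j + 1)
  rw [fibre₁_zero hS]
  simp only [hτ, hρ, map_add, map_sub, Derivation.leibniz, Derivation.map_algebraMap, smul_zero,
    Derivation.map_natCast, Derivation.map_one_eq_zero, add_zero, smul_eq_mul, d2_centered,
    PointMap.d_two, d_three, pow_two, h2, h20, h200, r2, Fin.reduceEq, reduceIte, map_mul, map_ofNat]
  ring

theorem d1_fibre₁_one (hS : S.HasParam κ) : A.d 1 (S.fibre₁ 1) =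
    algebraMap ℝ R (2 * (κ.e - κ.n)) * centered A χ 0 ^ κ.j * A.d 1 (A.w 1)
    + (algebraMap ℝ R (2 * κ.e) * A.d 0 (centered A χ 0 ^ κ.j) * centered A χ 2
      + algebraMap ℝ R κ.c * centered A χ 0 ^ κ.j) * A.d 1 (A.w 0)
    + algebraMap ℝ R (2 * κ.e) * A.d 0 (centered A χ 0 ^ κ.j) := by
  obtain ⟨τ, hτ, h1, h2, h10, h20, h100, h200⟩ := exists_pow A χ κ.j
  obtain ⟨ρ, hρ, r1, r2, r10, r20, r100, r200⟩ := exists_pow A χ (κ.j + 1)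
  rw [fibre₁_one hS]
  simp only [hτ, hρ, map_add, map_sub, Derivation.leibniz, Derivation.map_algebraMap, smul_zero,
    Derivation.map_natCast, Derivation.map_one_eq_zero, add_zero, smul_eq_mul, d1_centered,
    PointMap.d_two, pow_two, h1, h10, h100, r1, Fin.reduceEq, reduceIte, map_mul, map_ofNat]
  ring

theorem d2_fibre₁_one (hS : S.HasParam κ) (he : κ.e = 0) : A.d 2 (S.fibre₁ 1) =
    algebraMap ℝ R (2 * (κ.e - κ.n)) * centered A χ 0 ^ κ.j * A.d 2 (A.w 1)
    + algebraMap ℝ R κ.c * centered A χ 0 ^ κ.j * A.d 2 (A.w 0)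
    + algebraMap ℝ R κ.c * A.d 0 (centered A χ 0 ^ κ.j) := by
  obtain ⟨τ, hτ, h1, h2, h10, h20, h100, h200⟩ := exists_pow A χ κ.j
  obtain ⟨ρ, hρ, r1, r2, r10, r20, r100, r200⟩ := exists_pow A χ (κ.j + 1)
  rw [fibre₁_one hS, he]
  simp only [map_zero, zero_mul, mul_zero, hτ, hρ, map_add, map_sub, Derivation.leibniz, Derivation.map_algebraMap, smul_zero,
    Derivation.map_natCast, Derivation.map_one_eq_zero, add_zero, smul_eq_mul, d2_centered,
    PointMap.d_two, pow_two, h2, h20, h200, r2, Fin.reduceEq, reduceIte, map_mul, map_ofNat]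
  ring

/-! ### Variation of the pivots u_x, u_xx and u_xy. -/

theorem jetVar_ux (hS : S.HasParam κ) : S.jetVar 0 ![0, 1, 0] =
    -(A.d 2 S.Y₁ * A.d 1 (A.w 0)) := by
  have e1 : A.d 1 (S.fibre₁ 0) = (A.d 1 S.X₁ - A.d 2 S.Y₁) * A.d 1 (A.w 0) := by
    rw [d1_fibre₁_zero hS, hS.X, hS.Y, d1_infX, d2_infY, ← sub_mul, ← map_sub]
    congr 3
    ring
  simp only [jetVar, dIter_010, char, map_sub, Derivation.leibniz, e1, S.d1T, S.d1Y, smul_eq_mul,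
    A.comm 1 0, A.comm 2 1]
  ring

theorem jetVar_uxx (hS : S.HasParam κ) : S.jetVar 0 ![0, 2, 0] =
    -((A.d 2 S.Y₁ + A.d 1 S.X₁) * A.d 1 (A.d 1 (A.w 0))) := by
  have e0 : S.jetVar 0 ![0, 2, 0] = A.d 1 (S.jetVar 0 ![0, 1, 0])
      - A.d 1 S.X₁ * A.d 1 (A.d 1 (A.w 0)) := by
    simp only [jetVar, dIter_010, dIter_020, map_add, Derivation.leibniz, S.d1T, S.d1Y, smul_eq_mul,
      A.comm 1 0, A.comm 2 1]
    ring
  have e1 : A.d 1 (A.d 2 S.Y₁) = 0 := by rw [A.comm, S.d1Y, map_zero]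
  rw [e0, jetVar_ux hS, map_neg, Derivation.leibniz, e1]
  simp only [smul_eq_mul]
  ring

theorem jetVar_uxy (hS : S.HasParam κ) : S.jetVar 0 ![0, 1, 1] =
    -(2 * A.d 2 S.Y₁ * A.d 1 (A.d 2 (A.w 0)) + A.d 2 S.X₁ * A.d 1 (A.d 1 (A.w 0))) := by
  have e0 : S.jetVar 0 ![0, 1, 1] = A.d 2 (S.jetVar 0 ![0, 1, 0])
      - A.d 2 S.Y₁ * A.d 1 (A.d 2 (A.w 0)) - A.d 2 S.X₁ * A.d 1 (A.d 1 (A.w 0)) := by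
    simp only [jetVar, dIter_010, dIter_011, map_add, Derivation.leibniz, S.d2T, smul_eq_mul,
      A.comm 2 0, A.comm 2 1]
    ring
  have e1 : A.d 2 (A.d 2 S.Y₁) = 0 := by
    rw [hS.Y, d2_infY]
    rw [Derivation.leibniz, d2_pow, Derivation.map_algebraMap, smul_zero, smul_zero, add_zero]
  rw [e0, jetVar_ux hS, map_neg, Derivation.leibniz, e1, A.comm 2 1]
  simp only [smul_eq_mul]
  ring

/-- The tangent vector of the orbit, in the free coordinates. -/
def tangent (S : Variation A χ) : FreeCoord → ℝ
  | Sum.inl i => χ (![S.T₁, S.X₁, S.Y₁] i)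
  | Sum.inr (a, α, β, γ) => χ (S.jetVar a ![α, β, γ.toNat])

/-! #### Symmetries vanishing to high order -/

/-- Without translation part, a vector field with parameters in degree N vanishes to order N + 1 in
T₁, and likewise in X₁ and Y₁. It therefore leaves jets of order less than N fixed to first order.
-/
theorem isVan_T₁ {N : ℕ} (hS : S.HasParam κ) (hN : κ.j = N) (ht : κ.t₀ = 0) :
    IsVan A χ (N + 1) S.T₁ := by
  rw [hS.T, infT, hN, ht, map_zero, add_zero]
  exact (isVan_pow_centered 0 (N + 1)).mul_left _

theorem isVan_d0_pow (j : ℕ) : IsVan A χ (j - 1) (A.d 0 (centered A χ 0 ^ j)) := by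
  cases j with
  | zero => trivial
  | succ j => exact (isVan_pow_centered 0 (j + 1)).2 0

theorem isVan_X₁ {N : ℕ} (hS : S.HasParam κ) (hN : κ.j = N) (hx : κ.x₀ = 0) :
    IsVan A χ (N + 1) S.X₁ := by
  rw [hS.X, infX, hN, hx, map_zero, add_zero]
  have h1 := (isVan_pow_centered (A := A) (χ := χ) 0 N).mul (isVan_centered 1)
  have h2 := (isVan_pow_centered (A := A) (χ := χ) 0 N).mul (isVan_centered 2)
  -- The derivative of the N-th power vanishes to order N - 1 (truncated at 0) and the square of the
  -- centered y to order 2, which together give at least N + 1.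
  have h3 := ((isVan_d0_pow (A := A) (χ := χ) N).mul (isVan_pow_centered 2 2)).mono
    (show N + 1 ≤ _ by omega)
  refine (((IsVan.add ?_ h3).mul_left _).add ?_).add ((isVan_pow_centered 0 (N + 1)).mul_left _)
  · rw [mul_assoc]; exact h1.mul_left _
  · rw [mul_assoc]; exact h2.mul_left _

theorem isVan_Y₁ {N : ℕ} (hS : S.HasParam κ) (hN : κ.j = N) (hy : κ.y₀ = 0) :
    IsVan A χ (N + 1) S.Y₁ := by
  rw [hS.Y, infY, hN, hy, map_zero, add_zero]
  have h2 := (isVan_pow_centered (A := A) (χ := χ) 0 N).mul (isVan_centered 2)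
  refine IsVan.add ?_ ((isVan_pow_centered 0 (N + 1)).mul_left _)
  rw [mul_assoc]; exact h2.mul_left _

theorem isVan_fibre₁ {N : ℕ} (hX : IsVan A χ (N + 1) S.X₁) (hY : IsVan A χ (N + 1) S.Y₁)
    (a : Fin 2) : IsVan A χ N (S.fibre₁ a) := by
  fin_cases a
  · exact ((((hX.2 1).sub (hY.2 2)).mul_right _).add (hY.2 0)).sub ((hX.2 2).mul_left _)
  · exact (((((hX.2 1).sub (hY.2 2)).mul_left _).mul_right _).add ((hX.2 2).mul_right _)).add (hX.2 0)

/-- The transport terms T₁ w_t + X₁ w_x + Y₁ w_y vanish to order N + 1, so the characteristic and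
the vertical component have the same derivatives up to order N. -/
theorem eval_jetVar {N : ℕ} (hT : IsVan A χ (N + 1) S.T₁) (hX : IsVan A χ (N + 1) S.X₁)
    (hY : IsVan A χ (N + 1) S.Y₁) (a : Fin 2) {σ : Fin 3 → ℕ} (hσ : ∑ i, σ i ≤ N) :
    χ (S.jetVar a σ) = χ (dIter A.d σ (S.fibre₁ a)) := by
  have hd : IsVan A χ (N + 1) (S.T₁ * A.d 0 (A.w a) + S.X₁ * A.d 1 (A.w a)
      + S.Y₁ * A.d 2 (A.w a)) :=
    ((hT.mul_right _).add (hX.mul_right _)).add (hY.mul_right _)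
  have e : S.fibre₁ a = S.char a + (S.T₁ * A.d 0 (A.w a) + S.X₁ * A.d 1 (A.w a)
      + S.Y₁ * A.d 2 (A.w a)) := by rw [char]; ring
  have hadd : ∀ f g : R, dIter A.d σ (f + g) = dIter A.d σ f + dIter A.d σ g := by
    intro f g
    simp only [dIter, iterate_map_add]
  rw [e, hadd, map_add, hd.eval_dIter (Nat.lt_succ_of_le hσ), jetVar]
  simp only [map_add, map_mul, hT.1, hX.1, hY.1, zero_mul, add_zero]

theorem eval_jetVar_eq_zero {N : ℕ} (hT : IsVan A χ (N + 1) S.T₁) (hX : IsVan A χ (N + 1) S.X₁)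
    (hY : IsVan A χ (N + 1) S.Y₁) (a : Fin 2) {σ : Fin 3 → ℕ} (hσ : ∑ i, σ i < N) :
    χ (S.jetVar a σ) = 0 := by
  rw [eval_jetVar hT hX hY a hσ.le]
  exact (isVan_fibre₁ hX hY a).eval_dIter hσ

theorem eval_iterate {n j : ℕ} (hj : j < n) {g : R} (hg : IsVan A χ n g) :
    χ ((A.d 0)^[j] g) = 0 := by
  have := hg.eval_dIter (σ := ![j, 0, 0]) (by simpa [Fin.sum_univ_three] using hj)
  exact this

theorem eval_iterate_d0_pow (r : ℝ) (j : ℕ) :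
    χ ((A.d 0)^[j] (algebraMap ℝ R r * centered A χ 0 ^ j)) = r * j.factorial := by
  rw [← Algebra.smul_def, show (A.d 0)^[j] (r • centered A χ 0 ^ j) =
    r • (A.d 0)^[j] (centered A χ 0 ^ j) from ?_, iterate_d_pow_centered, map_smul, map_natCast,
    smul_eq_mul]
  generalize centered A χ 0 ^ j = x
  induction j generalizing x with
  | zero => rfl
  | succ j ih => rw [Function.iterate_succ_apply, Derivation.map_smul, ih]; rfl

theorem eval_iterate_d0_pow' (r : ℝ) (j : ℕ) :
    χ ((A.d 0)^[j] (algebraMap ℝ R r * A.d 0 (centered A χ 0 ^ (j + 1)))) =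
      r * (j + 1).factorial := by
  rw [← eval_iterate_d0_pow (A := A) (χ := χ) r (j + 1), Function.iterate_succ_apply,
    Derivation.leibniz, Derivation.map_algebraMap, smul_zero, add_zero, smul_eq_mul]

theorem iterate_add (j : ℕ) (g h : R) :
    (A.d 0)^[j] (g + h) = (A.d 0)^[j] g + (A.d 0)^[j] h := iterate_map_add _ _ _ _

/-- Terms containing the undifferentiated power of degree j + 1, or a factor vanishing at the point,
die after j derivatives in t. Only the term with the differentiated power survives. The next two
lemmas rest on the same observation. -/
theorem eval_d1_fibre₁_one (hS : S.HasParam κ) {j : ℕ} (hj : κ.j = j + 1) :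
    χ (dIter A.d ![j, 1, 0] (S.fibre₁ 1)) = 2 * κ.e * (j + 1).factorial := by
  have h1 := isVan_pow_centered (A := A) (χ := χ) 0 (j + 1)
  have h2 := (isVan_d0_pow (A := A) (χ := χ) (j + 1)).mul (isVan_centered (A := A) (χ := χ) 2)
  change χ ((A.d 0)^[j] (A.d 1 (S.fibre₁ 1))) = _
  rw [d1_fibre₁_one hS, hj, iterate_add, map_add, eval_iterate_d0_pow', iterate_add, map_add,
    eval_iterate (Nat.lt_succ_self j) ((h1.mul_left _).mul_right _),
    eval_iterate (Nat.lt_succ_self j) (IsVan.mul_right (IsVan.add ?_ (h1.mul_left _)) _)]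
  · ring
  · rw [mul_assoc]; exact h2.mul_left _

theorem eval_d2_fibre₁_zero (hS : S.HasParam κ) {j : ℕ} (hj : κ.j = j + 1) :
    χ (dIter A.d ![j, 0, 1] (S.fibre₁ 0)) = (κ.n - 3 * κ.e) * (j + 1).factorial := by
  have h1 := isVan_pow_centered (A := A) (χ := χ) 0 (j + 1)
  change χ ((A.d 0)^[j] (A.d 2 (S.fibre₁ 0))) = _
  rw [d2_fibre₁_zero hS, hj, iterate_add, map_add, eval_iterate_d0_pow',
    eval_iterate (Nat.lt_succ_self j) ((h1.mul_left _).mul_right _), zero_add]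

theorem eval_d2_fibre₁_one (hS : S.HasParam κ) (he : κ.e = 0) {j : ℕ} (hj : κ.j = j + 1) :
    χ (dIter A.d ![j, 0, 1] (S.fibre₁ 1)) = κ.c * (j + 1).factorial := by
  have h1 := isVan_pow_centered (A := A) (χ := χ) 0 (j + 1)
  change χ ((A.d 0)^[j] (A.d 2 (S.fibre₁ 1))) = _
  rw [d2_fibre₁_one hS he, hj, iterate_add, map_add, eval_iterate_d0_pow', iterate_add, map_add,
    eval_iterate (Nat.lt_succ_self j) ((h1.mul_left _).mul_right _),
    eval_iterate (Nat.lt_succ_self j) ((h1.mul_left _).mul_right _)]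
  ring

theorem eval_fibre₁_zero (hS : S.HasParam κ) (he : κ.e = 0) (hn : κ.n = 0) (hc : κ.c = 0) :
    χ (dIter A.d ![κ.j, 0, 0] (S.fibre₁ 0)) = κ.b * (κ.j + 1) * κ.j.factorial := by
  change χ ((A.d 0)^[κ.j] (S.fibre₁ 0)) = _
  rw [← eval_iterate_d0_pow (A := A) (χ := χ), fibre₁_zero hS, he, hn, hc]
  simp

theorem eval_fibre₁_one (hS : S.HasParam κ) (he : κ.e = 0) (hn : κ.n = 0) (hc : κ.c = 0) :
    χ (dIter A.d ![κ.j, 0, 0] (S.fibre₁ 1)) = κ.a * (κ.j + 1) * κ.j.factorial := by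
  change χ ((A.d 0)^[κ.j] (S.fibre₁ 1)) = _
  rw [← eval_iterate_d0_pow (A := A) (χ := χ), fibre₁_one hS, he, hn, hc]
  simp [mul_assoc]

end Variation

end Infinitesimal

/-- The parameters of the infinitesimal symmetry attached to a group parameter. -/
def groupParam : GroupIndex → CurveParam
  | Sum.inl i => ⟨0, 0, 0, 0, 0, 0, if i = 0 then 1 else 0, if i = 1 then 1 else 0,
      if i = 2 then 1 else 0⟩
  | Sum.inr (j, 0) => ⟨j, 0, 0, 0, 0, 1, 0, 0, 0⟩
  | Sum.inr (j, 1) => ⟨j, 0, 0, 0, 1, 0, 0, 0, 0⟩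
  | Sum.inr (j, 2) => ⟨j, 0, 0, 1, 0, 0, 0, 0, 0⟩
  | Sum.inr (j, 3) => ⟨j, 1, 0, 0, 0, 0, 0, 0, 0⟩
  -- The choice n = -e keeps √D' E fixed to first order; in degree 0 this leaves u_x unchanged while
  -- u_xx varies, which separates E from D'.
  | Sum.inr (j, 4) => ⟨j, -1, 1, 0, 0, 0, 0, 0, 0⟩

/-- The order of elimination of the group parameters. -/
def pivotKey : GroupIndex → ℕ
  | Sum.inl i => i
  -- Degrees are treated in increasing order. In degree 0 the order is D', E, C, B, A, because the
  -- E-direction does not move u_x. In positive degree E precedes D', because only the E-direction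
  -- moves the t-derivatives of v_x that serve as pivots.
  | Sum.inr (j, a) => 5 * j + 3 + if j = 0 then (![4, 3, 2, 0, 1] a : ℕ) else 4 - (a : ℕ)

/-! ### Triangularity of the orbit directions in the pivot coordinates. -/

section Tangent

variable {R : Type} [CommRing R] [Algebra ℝ R] {A : DiffData R} {χ : R →ₐ[ℝ] ℝ}
  {S : Variation A χ}

namespace Variation

theorem isVan_param {s : ℕ × Fin 5} (hS : S.HasParam (groupParam (Sum.inr s))) :
    IsVan A χ (s.1 + 1) S.T₁ ∧ IsVan A χ (s.1 + 1) S.X₁ ∧ IsVan A χ (s.1 + 1) S.Y₁ := by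
  obtain ⟨j, a⟩ := s
  have h : (groupParam (Sum.inr (j, a))).j = j ∧ (groupParam (Sum.inr (j, a))).t₀ = 0 ∧
      (groupParam (Sum.inr (j, a))).x₀ = 0 ∧ (groupParam (Sum.inr (j, a))).y₀ = 0 := by
    fin_cases a <;> exact ⟨rfl, rfl, rfl, rfl⟩
  exact ⟨isVan_T₁ hS h.1 h.2.1, isVan_X₁ hS h.1 h.2.2.1, isVan_Y₁ hS h.1 h.2.2.2⟩

theorem tangent_inl {s : ℕ × Fin 5} (hS : S.HasParam (groupParam (Sum.inr s))) (i : Fin 3) :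
    S.tangent (Sum.inl i) = 0 := by
  obtain ⟨hT, hX, hY⟩ := isVan_param hS
  fin_cases i
  exacts [hT.1, hX.1, hY.1]

theorem tangent_inr_of_lt {s : ℕ × Fin 5} (hS : S.HasParam (groupParam (Sum.inr s)))
    {a : Fin 2} {α β : ℕ} {γ : Bool} (h : α + β + γ.toNat < s.1) :
    S.tangent (Sum.inr (a, α, β, γ)) = 0 := by
  obtain ⟨hT, hX, hY⟩ := isVan_param hS
  exact eval_jetVar_eq_zero hT hX hY a (by simpa [Fin.sum_univ_three] using h)

theorem tangent_inr {s : ℕ × Fin 5} (hS : S.HasParam (groupParam (Sum.inr s)))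
    {a : Fin 2} {α β : ℕ} {γ : Bool} (h : α + β + γ.toNat ≤ s.1) :
    S.tangent (Sum.inr (a, α, β, γ)) = χ (dIter A.d ![α, β, γ.toNat] (S.fibre₁ a)) := by
  obtain ⟨hT, hX, hY⟩ := isVan_param hS
  exact eval_jetVar hT hX hY a (by simpa [Fin.sum_univ_three] using h)

theorem tangent_special {κ : CurveParam} (hS : S.HasParam κ) :
    S.tangent (Sum.inr (0, 0, 1, false)) = -(χ (A.d 2 S.Y₁) * χ (A.d 1 (A.w 0))) ∧
    S.tangent (Sum.inr (0, 0, 2, false)) =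
      -((χ (A.d 2 S.Y₁) + χ (A.d 1 S.X₁)) * χ (A.d 1 (A.d 1 (A.w 0)))) ∧
    S.tangent (Sum.inr (0, 0, 1, true)) =
      -(2 * χ (A.d 2 S.Y₁) * χ (A.d 1 (A.d 2 (A.w 0)))
        + χ (A.d 2 S.X₁) * χ (A.d 1 (A.d 1 (A.w 0)))) := by
  refine ⟨?_, ?_, ?_⟩
  · change χ (S.jetVar 0 ![0, 1, 0]) = _
    rw [jetVar_ux hS, map_neg, map_mul]
  · change χ (S.jetVar 0 ![0, 2, 0]) = _
    rw [jetVar_uxx hS, map_neg, map_mul, map_add]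
  · change χ (S.jetVar 0 ![0, 1, 1]) = _
    rw [jetVar_uxy hS, map_neg, map_add, map_mul, map_mul, map_mul, map_ofNat]

/-- The order bound alone does not suffice, since u_xx and u_xy have order 2 while the degree may be
1. Their variations involve only the values of Y_y, X_x and X_y at the point, and these vanish in
positive degree. -/
theorem tangent_special_eq_zero {j : ℕ} {a : Fin 5}
    (hS : S.HasParam (groupParam (Sum.inr (j + 1, a)))) :
    S.tangent (Sum.inr (0, 0, 1, false)) = 0 ∧ S.tangent (Sum.inr (0, 0, 2, false)) = 0 ∧
    S.tangent (Sum.inr (0, 0, 1, true)) = 0 := by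
  obtain ⟨hT, hX, hY⟩ := isVan_param hS
  obtain ⟨h1, h2, h3⟩ := tangent_special hS
  have e1 : χ (A.d 2 S.Y₁) = 0 := (hY.2 2).1
  have e2 : χ (A.d 1 S.X₁) = 0 := (hX.2 1).1
  have e3 : χ (A.d 2 S.X₁) = 0 := (hX.2 2).1
  rw [h1, h2, h3, e1, e2, e3]
  simp

theorem tangent_succ_zero {j : ℕ} {a : Fin 5} (hS : S.HasParam (groupParam (Sum.inr (j + 1, a))))
    (b : Fin 5) : S.tangent (pivot (Sum.inr (0, b))) = 0 := by
  obtain ⟨h1, h2, h3⟩ := tangent_special_eq_zero hS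
  fin_cases b
  exacts [tangent_inr_of_lt hS (Nat.succ_pos j), tangent_inr_of_lt hS (Nat.succ_pos j), h3, h1, h2]

theorem tangent_succ_succ_of_lt {i j : ℕ} {a : Fin 5}
    (hS : S.HasParam (groupParam (Sum.inr (j + 1, a)))) (h : i < j) (b : Fin 5) :
    S.tangent (pivot (Sum.inr (i + 1, b))) = 0 := by
  fin_cases b <;>
  exact tangent_inr_of_lt hS (by simp only [Bool.toNat_false, Bool.toNat_true]; omega)

/-- Within one positive degree the pivots see the parameters in triangular fashion: e alone in v_x,
then n - 3e in u_y, then c in v_y once e = 0, and finally b in u and a in v once e, n and c are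
zero. -/
theorem tangent_succ_succ {j : ℕ} {a : Fin 5}
    (hS : S.HasParam (groupParam (Sum.inr (j + 1, a)))) :
    (∀ b, a < b → S.tangent (pivot (Sum.inr (j + 1, b))) = 0) ∧
      S.tangent (pivot (Sum.inr (j + 1, a))) ≠ 0 := by
  have hf : ((j + 1).factorial : ℝ) ≠ 0 := Nat.cast_ne_zero.mpr (Nat.factorial_ne_zero _)
  have hj : (j : ℝ) + 1 + 1 ≠ 0 := by positivity
  have h4 : S.tangent (pivot (Sum.inr (j + 1, 4))) = 2 * (groupParam (Sum.inr (j + 1, a))).e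
      * (j + 1).factorial := by
    refine (tangent_inr hS (by simp)).trans (eval_d1_fibre₁_one hS ?_)
    fin_cases a <;> rfl
  have h3 : S.tangent (pivot (Sum.inr (j + 1, 3))) = ((groupParam (Sum.inr (j + 1, a))).n
      - 3 * (groupParam (Sum.inr (j + 1, a))).e) * (j + 1).factorial := by
    refine (tangent_inr hS (by simp)).trans (eval_d2_fibre₁_zero hS ?_)
    fin_cases a <;> rfl
  have h2 (he : (groupParam (Sum.inr (j + 1, a))).e = 0) :
      S.tangent (pivot (Sum.inr (j + 1, 2))) = (groupParam (Sum.inr (j + 1, a))).c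
      * (j + 1).factorial := by
    refine (tangent_inr hS (by simp)).trans (eval_d2_fibre₁_one hS he ?_)
    fin_cases a <;> rfl
  have h1 (he : (groupParam (Sum.inr (j + 1, a))).e = 0)
      (hn : (groupParam (Sum.inr (j + 1, a))).n = 0)
      (hc : (groupParam (Sum.inr (j + 1, a))).c = 0) :
      S.tangent (pivot (Sum.inr (j + 1, 1))) = (groupParam (Sum.inr (j + 1, a))).b
      * (j + 1 + 1) * (j + 1).factorial := by
    refine (tangent_inr hS (by simp)).trans ?_
    have hk : (groupParam (Sum.inr (j + 1, a))).j = j + 1 := by fin_cases a <;> rfl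
    have := eval_fibre₁_zero hS he hn hc
    rw [hk] at this
    exact this.trans (by push_cast; ring)
  have h0 (he : (groupParam (Sum.inr (j + 1, a))).e = 0)
      (hn : (groupParam (Sum.inr (j + 1, a))).n = 0)
      (hc : (groupParam (Sum.inr (j + 1, a))).c = 0) :
      S.tangent (pivot (Sum.inr (j + 1, 0))) = (groupParam (Sum.inr (j + 1, a))).a
      * (j + 1 + 1) * (j + 1).factorial := by
    refine (tangent_inr hS (by simp)).trans ?_
    have hk : (groupParam (Sum.inr (j + 1, a))).j = j + 1 := by fin_cases a <;> rfl
    have := eval_fibre₁_one hS he hn hc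
    rw [hk] at this
    exact this.trans (by push_cast; ring)
  clear hS
  refine ⟨fun b hab => ?_, ?_⟩
  · fin_cases a <;> fin_cases b <;> simp only [Fin.reduceFinMk, Fin.reduceLT] at hab <;>
      first
        | exact h4.trans (by simp [groupParam])
        | exact h3.trans (by simp [groupParam])
        | exact (h2 rfl).trans (by simp [groupParam])
        | exact (h1 rfl rfl rfl).trans (by simp [groupParam])
  · fin_cases a
    · exact (h0 rfl rfl rfl).trans_ne (by simp [groupParam, hf, hj])
    · exact (h1 rfl rfl rfl).trans_ne (by simp [groupParam, hf, hj])
    · exact (h2 rfl).trans_ne (by simp [groupParam, hf])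
    · exact h3.trans_ne (by simp [groupParam, hf])
    · exact h4.trans_ne (by simp [groupParam, hf])

/-- The only place where genericity is used: C, D' and E in degree 0 act on u_xy, u_x, u_xx
proportionally to u_xx, u_x, u_xx respectively, so the diagonal entries are nonzero only off u_x
u_xx = 0. -/
theorem tangent_zero {a : Fin 5} (hS : S.HasParam (groupParam (Sum.inr (0, a))))
    (hx : χ (A.d 1 (A.w 0)) ≠ 0) (hxx : χ (A.d 1 (A.d 1 (A.w 0))) ≠ 0) :
    (∀ b, pivotKey (Sum.inr (0, b)) < pivotKey (Sum.inr (0, a)) →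
      S.tangent (pivot (Sum.inr (0, b))) = 0) ∧
      S.tangent (pivot (Sum.inr (0, a))) ≠ 0 := by
  obtain ⟨t1, t2, t3⟩ := tangent_special hS
  have hj : (groupParam (Sum.inr (0, a))).j = 0 := by fin_cases a <;> rfl
  have e1 : χ (A.d 2 S.Y₁) = (groupParam (Sum.inr (0, a))).n + (groupParam (Sum.inr (0, a))).e := by
    rw [hS.Y, d2_infY, hj, pow_zero, mul_one, AlgHom.commutes]; rfl
  have e2 : χ (A.d 1 S.X₁) = 2 * (groupParam (Sum.inr (0, a))).e := by
    rw [hS.X, d1_infX, hj, pow_zero, mul_one, AlgHom.commutes]; rfl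
  have e3 : χ (A.d 2 S.X₁) = (groupParam (Sum.inr (0, a))).c := by
    rw [hS.X, d2_infX, hj, pow_zero, mul_one, Derivation.map_one_eq_zero, mul_zero, zero_mul,
      zero_add, AlgHom.commutes]; rfl
  rw [e1] at t1
  rw [e1, e2] at t2
  rw [e1, e3] at t3
  have h1 (he : (groupParam (Sum.inr (0, a))).e = 0)
      (hn : (groupParam (Sum.inr (0, a))).n = 0)
      (hc : (groupParam (Sum.inr (0, a))).c = 0) :
      S.tangent (pivot (Sum.inr (0, 1))) = (groupParam (Sum.inr (0, a))).b := by
    refine (tangent_inr hS le_rfl).trans ?_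
    have := eval_fibre₁_zero hS he hn hc
    rw [hj] at this
    exact this.trans (by simp)
  have h0 (he : (groupParam (Sum.inr (0, a))).e = 0)
      (hn : (groupParam (Sum.inr (0, a))).n = 0)
      (hc : (groupParam (Sum.inr (0, a))).c = 0) :
      S.tangent (pivot (Sum.inr (0, 0))) = (groupParam (Sum.inr (0, a))).a := by
    refine (tangent_inr hS le_rfl).trans ?_
    have := eval_fibre₁_one hS he hn hc
    rw [hj] at this
    exact this.trans (by simp)
  clear hS
  refine ⟨fun b hab => ?_, ?_⟩
  · fin_cases a <;> fin_cases b <;>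
      first
        | exact absurd hab (by decide)
        | exact t1.trans (by simp [groupParam])
        | exact t2.trans (by simp [groupParam])
        | exact t3.trans (by simp [groupParam])
        | exact (h1 rfl rfl rfl).trans (by simp [groupParam])
  · fin_cases a
    · exact (h0 rfl rfl rfl).trans_ne (by simp [groupParam])
    · exact (h1 rfl rfl rfl).trans_ne (by simp [groupParam])
    · exact t3.trans_ne (by simp [groupParam, hxx])
    · exact t1.trans_ne (by simp [groupParam, hx])
    · exact t2.trans_ne (by simp [groupParam, hxx])

theorem tangent_translation {i : Fin 3} (hS : S.HasParam (groupParam (Sum.inl i))) (j : Fin 3) :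
    S.tangent (Sum.inl j) = if j = i then 1 else 0 := by
  rw [tangent, hS.T, hS.X, hS.Y]
  fin_cases j <;> fin_cases i <;>
    simp [infT, infX, infY, groupParam, eval_centered]

/-- Together with `tangent_pivot_ne_zero` this makes the pivot components of the orbit directions a
triangular matrix with nonzero diagonal, which gives a lower bound for the dimension of generic
orbits. -/
theorem tangent_pivot_eq_zero {s : GroupIndex} (hS : S.HasParam (groupParam s))
    (hx : χ (A.d 1 (A.w 0)) ≠ 0) (hxx : χ (A.d 1 (A.d 1 (A.w 0))) ≠ 0) {s' : GroupIndex}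
    (h : pivotKey s' < pivotKey s) : S.tangent (pivot s') = 0 := by
  rcases s with i | ⟨j, a⟩
  · rcases s' with i' | ⟨j', b⟩
    · refine (tangent_translation hS i').trans (if_neg ?_)
      rintro rfl
      exact lt_irrefl _ h
    · simp only [pivotKey] at h
      omega
  · rcases s' with i' | ⟨j', b⟩
    · exact tangent_inl hS i'
    rcases j with - | j
    · rcases j' with - | j'
      · exact (tangent_zero hS hx hxx).1 b h
      · exfalso
        have : ∀ a : Fin 5, (![4, 3, 2, 0, 1] a : ℕ) < 5 := by decide
        have := this a
        simp only [pivotKey, if_true] at h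
        omega
    · rcases j' with - | j'
      · exact tangent_succ_zero hS b
      · simp only [pivotKey, Nat.succ_ne_zero, if_false, add_eq_zero, one_ne_zero, and_false] at h
        rcases Nat.lt_trichotomy j' j with hj | rfl | hj
        · exact tangent_succ_succ_of_lt hS hj b
        · exact (tangent_succ_succ hS).1 b (by omega)
        · omega

theorem tangent_pivot_ne_zero {s : GroupIndex} (hS : S.HasParam (groupParam s))
    (hx : χ (A.d 1 (A.w 0)) ≠ 0) (hxx : χ (A.d 1 (A.d 1 (A.w 0))) ≠ 0) :
    S.tangent (pivot s) ≠ 0 := by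
  rcases s with i | ⟨j, a⟩
  · exact (tangent_translation hS i).trans_ne (by simp)
  · rcases j with - | j
    · exact (tangent_zero hS hx hxx).2
    · exact (tangent_succ_succ hS).2

end Variation

end Tangent

theorem pivotKey_injective : Function.Injective pivotKey := by
  have h5 : ∀ a : Fin 5, (![4, 3, 2, 0, 1] a : ℕ) < 5 := by decide
  have hi : ∀ a b : Fin 5, (![4, 3, 2, 0, 1] a : ℕ) = ![4, 3, 2, 0, 1] b → a = b := by decide
  rintro (i | ⟨j, a⟩) (i' | ⟨j', b⟩) h
  · exact congrArg _ (Fin.ext h)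
  · simp only [pivotKey] at h
    omega
  · simp only [pivotKey] at h
    omega
  · simp only [pivotKey] at h
    have ha := h5 a
    have hb := h5 b
    obtain rfl : j = j' := by split_ifs at h <;> omega
    split_ifs at h
    · rw [hi a b (by omega)]
    · obtain rfl : a = b := by omega
      rfl

end

end ManakovSantini

namespace ManakovSantini

noncomputable section

/-! ### Curves in the pseudogroup -/

section Curve

variable {R : Type} [CommRing R] [Algebra ℝ R] (A : DiffData R) (χ : R →ₐ[ℝ] ℝ) (κ : CurveParam)

/-- The family of functions `√D'`. -/
def famM (l : ℝ) : R := 1 + l • (algebraMap ℝ R κ.n * centered A χ 0 ^ κ.j)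

/-- The family of functions `E`. -/
def famE (l : ℝ) : R := 1 + l • (algebraMap ℝ R κ.e * centered A χ 0 ^ κ.j)

/-- The family of transformed coordinates `t`. -/
def famT (l : ℝ) : R := A.b 0 + l • infT A χ κ + l ^ 2 • (algebraMap ℝ R (κ.n ^ 2 / (2 * κ.j + 1)) *
  centered A χ 0 ^ (2 * κ.j + 1))

/-- The family of transformed coordinates `x`. -/
def famX (l : ℝ) : R := algebraMap ℝ R (χ (A.b 1)) + famE A χ κ l ^ 2 * centered A χ 1
  + famE A χ κ l * A.d 0 (famE A χ κ l) * centered A χ 2 ^ 2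
  + l • (algebraMap ℝ R κ.c * centered A χ 0 ^ κ.j) * centered A χ 2
  + l • (algebraMap ℝ R κ.a * centered A χ 0 ^ (κ.j + 1) + algebraMap ℝ R κ.x₀)

/-- The family of transformed coordinates `y`. -/
def famY (l : ℝ) : R := algebraMap ℝ R (χ (A.b 2)) + famM A χ κ l * famE A χ κ l * centered A χ 2
  + l • (algebraMap ℝ R κ.b * centered A χ 0 ^ (κ.j + 1) + algebraMap ℝ R κ.y₀)

variable {A χ κ}

theorem famM_zero : famM A χ κ 0 = 1 := by rw [famM, zero_smul, add_zero]
theorem famE_zero : famE A χ κ 0 = 1 := by rw [famE, zero_smul, add_zero]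

theorem famX_zero : famX A χ κ 0 = A.b 1 := by
  simp only [famX, famE_zero, zero_smul, Derivation.map_one_eq_zero, centered]
  ring

theorem famY_zero : famY A χ κ 0 = A.b 2 := by
  simp only [famY, famE_zero, famM_zero, zero_smul, centered]
  ring

theorem expands_famM : Expands A χ (famM A χ κ) (algebraMap ℝ R κ.n * centered A χ 0 ^ κ.j) :=
  ((expands_const 1).add (expands_smul _)).of_eq (zero_add _)

theorem expands_famE : Expands A χ (famE A χ κ) (algebraMap ℝ R κ.e * centered A χ 0 ^ κ.j) :=
  ((expands_const 1).add (expands_smul _)).of_eq (zero_add _)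

theorem expands_famX : Expands A χ (famX A χ κ) (infX A χ κ) := by
  have hE := expands_famE (A := A) (χ := χ) (κ := κ)
  refine (((((expands_const (algebraMap ℝ R (χ (A.b 1)))).add
    ((hE.pow 2).mul (expands_const (centered A χ 1)))).add
    ((hE.mul (hE.d 0)).mul (expands_const (centered A χ 2 ^ 2)))).add
    ((expands_smul (algebraMap ℝ R κ.c * centered A χ 0 ^ κ.j)).mul
      (expands_const (centered A χ 2)))).add
    (expands_smul (algebraMap ℝ R κ.a * centered A χ 0 ^ (κ.j + 1) +
      algebraMap ℝ R κ.x₀))).of_eq ?_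
  rw [infX]
  generalize centered A χ 0 ^ κ.j = τ
  simp only [famE_zero, Derivation.map_one_eq_zero, Derivation.leibniz, Derivation.map_algebraMap,
    smul_eq_mul, smul_zero, zero_smul]
  push_cast
  ring

theorem expands_famY : Expands A χ (famY A χ κ) (infY A χ κ) := by
  have hE := expands_famE (A := A) (χ := χ) (κ := κ)
  have hM := expands_famM (A := A) (χ := χ) (κ := κ)
  refine (((expands_const (algebraMap ℝ R (χ (A.b 2)))).add
    ((hM.mul hE).mul (expands_const (centered A χ 2)))).add
    (expands_smul (algebraMap ℝ R κ.b * centered A χ 0 ^ (κ.j + 1) +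
      algebraMap ℝ R κ.y₀))).of_eq ?_
  rw [infY]
  simp only [famE_zero, famM_zero, map_add]
  ring

theorem hasDerivAt_famT : HasDerivAt (fun l => χ (famT A χ κ l)) (χ (infT A χ κ)) 0 := by
  simp only [famT, map_add, map_smul, smul_eq_mul]
  have h := (((hasDerivAt_id (0 : ℝ)).mul_const (χ (infT A χ κ))).const_add (χ (A.b 0))).add
    (((hasDerivAt_id (0 : ℝ)).pow 2).mul_const (χ (algebraMap ℝ R (κ.n ^ 2 / (2 * κ.j + 1)) *
      centered A χ 0 ^ (2 * κ.j + 1))))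
  exact h.congr_deriv (by simp)

variable (A χ κ) in
/-- The variation defined by the curve with parameters `κ`. -/
def curveVariation (hM : ∀ᶠ l in nhds 0, IsUnit (famM A χ κ l))
    (hE : ∀ᶠ l in nhds 0, IsUnit (famE A χ κ l)) : Variation A χ where
  Q l := A.d 1 (famX A χ κ l)
  Pi l := Ring.inverse (famM A χ κ l) * Ring.inverse (famE A χ κ l)
  Qi l := Ring.inverse (famE A χ κ l) ^ 2
  c l := A.d 2 (famX A χ κ l)
  Xt l := A.d 0 (famX A χ κ l)
  Yt l := A.d 0 (famY A χ κ l)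
  T₁ := infT A χ κ
  X₁ := infX A χ κ
  Y₁ := infY A χ κ
  expQ := expands_famX.d 1
  expPi := by
    have h1 := expands_famM.inv (hM.mono fun l => Ring.mul_inverse_cancel _)
    have h2 := expands_famE.inv (hE.mono fun l => Ring.mul_inverse_cancel _)
    refine (h1.mul h2).of_eq ?_
    rw [famM_zero, famE_zero, Ring.inverse_one, d2_infY, map_add]
    ring
  expQi := by
    have h2 := expands_famE.inv (hE.mono fun l => Ring.mul_inverse_cancel _)
    refine (h2.pow 2).of_eq ?_
    rw [famE_zero, Ring.inverse_one, d1_infX, map_mul, map_ofNat]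
    push_cast
    ring
  expc := expands_famX.d 2
  expXt := expands_famX.d 0
  expYt := expands_famY.d 0
  Q0 := by rw [famX_zero, A.d_b, if_pos rfl]
  Pi0 := by rw [famM_zero, famE_zero, Ring.inverse_one, one_mul]
  Qi0 := by rw [famE_zero, Ring.inverse_one, one_pow]
  c0 := by rw [famX_zero, A.d_b, if_neg (by decide)]
  Xt0 := by rw [famX_zero, A.d_b, if_neg (by decide)]
  Yt0 := by rw [famY_zero, A.d_b, if_neg (by decide)]
  d0T := by
    rw [d0_infT, d2_infY, d1_infX]
    simp only [map_add, map_mul, map_ofNat]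
    ring
  d1T := d1_infT κ
  d2T := d2_infT κ
  d1Y := d1_infY κ

end Curve

/-! ### The functional parameters of the curves -/

section Parameters

variable {κ : CurveParam} (hn : |κ.n| ≤ 1) (he : |κ.e| ≤ 1) (p : Fin 3 → ℝ)

theorem one_add_mul_pow_pos {r l s : ℝ} (hr : |r| ≤ 1) (hl : |l| < 1) (hs : |s| < 1) (j : ℕ) :
    0 < 1 + l * (r * s ^ j) := by
  have h1 : |l * (r * s ^ j)| < 1 := by
    rw [abs_mul, abs_mul, abs_pow]
    have h2 : |s| ^ j ≤ 1 := pow_le_one₀ (abs_nonneg s) hs.le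
    have h3 : |r| * |s| ^ j ≤ 1 := mul_le_one₀ hr (by positivity) h2
    calc |l| * (|r| * |s| ^ j) ≤ |l| * 1 := by gcongr
      _ < 1 := by rw [mul_one]; exact hl
  have := neg_lt_of_abs_lt h1
  linarith

variable (κ) in
/-- The function `D` of the curve. -/
def curveD (t₁ l t : ℝ) : ℝ := t + l * (2 * κ.n / (κ.j + 1) * (t - t₁) ^ (κ.j + 1) + κ.t₀) +
  l ^ 2 * (κ.n ^ 2 / (2 * κ.j + 1) * (t - t₁) ^ (2 * κ.j + 1))

variable (κ) in
/-- The function `E` of the curve. -/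
def curveE (t₁ l t : ℝ) : ℝ := 1 + l * (κ.e * (t - t₁) ^ κ.j)

/-- The quadratic term in l completes D' to a square, so that √D' = 1 + l n (t - t₁)^j is affine in
l wherever this expression is nonnegative. -/
theorem hasDerivAt_curveD (t₁ l t : ℝ) :
    HasDerivAt (curveD κ t₁ l) ((1 + l * (κ.n * (t - t₁) ^ κ.j)) ^ 2) t := by
  have h1 : ∀ n : ℕ, HasDerivAt (fun t => (t - t₁) ^ (n + 1)) ((n + 1) * (t - t₁) ^ n) t := by
    intro n
    exact (((hasDerivAt_id t).sub_const t₁).pow (n + 1)).congr_deriv (by simp)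
  have h := ((hasDerivAt_id t).add ((((h1 κ.j).const_mul (2 * κ.n / (κ.j + 1))).add_const κ.t₀).const_mul l)).add
    (((h1 (2 * κ.j)).const_mul (κ.n ^ 2 / (2 * κ.j + 1))).const_mul (l ^ 2))
  refine h.congr_deriv ?_
  have h2 : (κ.j : ℝ) + 1 ≠ 0 := by positivity
  have h3 : 2 * (κ.j : ℝ) + 1 ≠ 0 := by positivity
  rw [pow_mul']
  push_cast
  field_simp
  ring

theorem contDiff_curveE (t₁ l : ℝ) : ContDiff ℝ ∞ (curveE κ t₁ l) := by
  unfold curveE; fun_prop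

theorem contDiff_deriv_curveE (t₁ l : ℝ) : ContDiff ℝ ∞ (deriv (curveE κ t₁ l)) :=
  contDiff_iff_contDiffAt.mpr fun _ => contDiffAt_deriv (contDiff_curveE t₁ l).contDiffAt

variable (κ) in
/-- The curve of functional parameters. -/
def curveParameters {l : ℝ} (hl : |l| < 1) : TopParameters where
  -- On the interval of radius 1, with |l| < 1 and |n|, |e| ≤ 1, both √D' and E stay positive.
  dom := Set.Ioo (p 0 - 1) (p 0 + 1)
  isOpen_dom := isOpen_Ioo
  D := curveD κ (p 0) l
  -- The functions A, B and C contain the terms that recenter the transformation at p: the images of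
  -- x and y become expressions in x - p 1 and y - p 2, as in `famX` and `famY`.
  A t := p 1 - curveE κ (p 0) l t ^ 2 * p 1
    + curveE κ (p 0) l t * deriv (curveE κ (p 0) l) t * p 2 ^ 2
    - l * (κ.c * (t - p 0) ^ κ.j) * p 2 + l * (κ.a * (t - p 0) ^ (κ.j + 1) + κ.x₀)
  B t := p 2 - (1 + l * (κ.n * (t - p 0) ^ κ.j)) * curveE κ (p 0) l t * p 2
    + l * (κ.b * (t - p 0) ^ (κ.j + 1) + κ.y₀)
  C t := l * (κ.c * (t - p 0) ^ κ.j)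
    - 2 * curveE κ (p 0) l t * deriv (curveE κ (p 0) l) t * p 2
  E := curveE κ (p 0) l
  smooth_D := by unfold curveD; fun_prop
  smooth_A := by
    have h1 := contDiff_curveE (κ := κ) (p 0) l
    have h2 := contDiff_deriv_curveE (κ := κ) (p 0) l
    fun_prop
  smooth_B := by
    have h1 := contDiff_curveE (κ := κ) (p 0) l
    fun_prop
  smooth_C := by
    have h1 := contDiff_curveE (κ := κ) (p 0) l
    have h2 := contDiff_deriv_curveE (κ := κ) (p 0) l
    fun_prop
  smooth_E := (contDiff_curveE (p 0) l).contDiffOn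
  injOn_D := by
    refine StrictMonoOn.injOn (strictMonoOn_of_deriv_pos (convex_Ioo _ _)
      (fun t _ => (hasDerivAt_curveD (p 0) l t).continuousAt.continuousWithinAt) fun t ht => ?_)
    rw [interior_Ioo] at ht
    rw [(hasDerivAt_curveD (p 0) l t).deriv]
    have := one_add_mul_pow_pos hn hl (abs_lt.mpr ⟨by linarith [ht.1], by linarith [ht.2]⟩ : |t - p 0| < 1) κ.j
    positivity
  deriv_D_pos t ht := by
    rw [(hasDerivAt_curveD (p 0) l t).deriv]
    have := one_add_mul_pow_pos hn hl (abs_lt.mpr ⟨by linarith [ht.1], by linarith [ht.2]⟩ : |t - p 0| < 1) κ.j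
    positivity
  E_pos t ht := one_add_mul_pow_pos he hl
    (abs_lt.mpr ⟨by linarith [ht.1], by linarith [ht.2]⟩ : |t - p 0| < 1) κ.j

end Parameters

end

end ManakovSantini

namespace ManakovSantini

noncomputable section

open Filter Topology

/-! ### The curves as families of germs -/

theorem inverse_eq_of_mul_eq_one {R : Type*} [CommRing R] {a b : R} (h : a * b = 1) :
    Ring.inverse a = b :=
  Ring.inverse_unit (Units.mkOfMulEqOne a b h)

section Germs

variable {κ : CurveParam} (hn : |κ.n| ≤ 1) (he : |κ.e| ≤ 1) {p : Fin 3 → ℝ} {l : ℝ} (hl : |l| < 1)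
  {s : (Fin 3 → ℝ) → (Fin 2 → ℝ)} (hs : ContDiffAt ℝ ∞ s p)

theorem mem_curve_dom : p 0 ∈ (curveParameters κ hn he p hl).dom := by
  change p 0 ∈ Set.Ioo (p 0 - 1) (p 0 + 1)
  constructor <;> linarith

theorem gs_one : TopParameters.gs p 1 = 1 := by
  simp [TopParameters.gs]

theorem coordGerm_eq (i : Fin 3) : coordGerm p i =
    centered (germData s hs) (germEval p) i + algebraMap ℝ (SGerm p) (p i) :=
  (sub_add_cancel (coordGerm p i) (algebraMap ℝ (SGerm p) (p i))).symm

theorem gE_curve : TopParameters.gE (mem_curve_dom hn he hl) =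
    famE (germData s hs) (germEval p) κ l := rfl

theorem gm_curve : TopParameters.gm (mem_curve_dom hn he hl) =
    famM (germData s hs) (germEval p) κ l := by
  have e : famM (germData s hs) (germEval p) κ l =
      germ (fun q : Fin 3 → ℝ => 1 + l * (κ.n * (q 0 - p 0) ^ κ.j)) (by fun_prop) := rfl
  rw [e]
  refine germ_eq_iff.mpr ?_
  filter_upwards [(continuous_apply (0 : Fin 3)).continuousAt.eventually
    ((curveParameters κ hn he p hl).mem_nhds (mem_curve_dom hn he hl))] with q hq
  change √(deriv (curveD κ (p 0) l) (q 0)) = _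
  rw [(hasDerivAt_curveD (p 0) l (q 0)).deriv]
  refine Real.sqrt_sq (one_add_mul_pow_pos hn hl ?_ κ.j).le
  have h1 : p 0 - 1 < q 0 := hq.1
  have h2 : q 0 < p 0 + 1 := hq.2
  exact abs_lt.mpr ⟨by linarith, by linarith⟩

theorem gE'_curve : TopParameters.gE' (mem_curve_dom hn he hl) =
    germDeriv p 0 (famE (germData s hs) (germEval p) κ l) := by
  rw [← gE_curve hn he hl, germDeriv_zero_tGerm]

theorem gT_curve : TopParameters.gs p 1 * TopParameters.gD (mem_curve_dom hn he hl) =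
    famT (germData s hs) (germEval p) κ l := by
  rw [gs_one, one_mul]
  rfl

theorem gX_curve : TopParameters.gX 1 (mem_curve_dom hn he hl) =
    famX (germData s hs) (germEval p) κ l := by
  have hC : TopParameters.gC (mem_curve_dom hn he hl) =
      l • (algebraMap ℝ (SGerm p) κ.c * centered (germData s hs) (germEval p) 0 ^ κ.j) -
      2 * TopParameters.gE (mem_curve_dom hn he hl) * TopParameters.gE' (mem_curve_dom hn he hl) *
        algebraMap ℝ (SGerm p) (p 2) := rfl
  have hA : TopParameters.gA (mem_curve_dom hn he hl) = algebraMap ℝ (SGerm p) (p 1)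
      - TopParameters.gE (mem_curve_dom hn he hl) ^ 2 * algebraMap ℝ (SGerm p) (p 1)
      + TopParameters.gE (mem_curve_dom hn he hl) * TopParameters.gE' (mem_curve_dom hn he hl) *
        algebraMap ℝ (SGerm p) (p 2) ^ 2
      - l • (algebraMap ℝ (SGerm p) κ.c * centered (germData s hs) (germEval p) 0 ^ κ.j) *
        algebraMap ℝ (SGerm p) (p 2)
      + l • (algebraMap ℝ (SGerm p) κ.a * centered (germData s hs) (germEval p) 0 ^ (κ.j + 1)
        + algebraMap ℝ (SGerm p) κ.x₀) := rfl
  rw [TopParameters.gX, gs_one, one_mul, hC, hA, gE'_curve hn he hl hs, gE_curve hn he hl hs,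
    coordGerm_eq hs 1, coordGerm_eq hs 2, famX]
  change _ = algebraMap ℝ (SGerm p) (p 1) + _ + _ + _ + _
  simp only [germData]
  ring

theorem gY_curve : TopParameters.gY 1 1 (mem_curve_dom hn he hl) =
    famY (germData s hs) (germEval p) κ l := by
  have hB : TopParameters.gB (mem_curve_dom hn he hl) = algebraMap ℝ (SGerm p) (p 2)
      - famM (germData s hs) (germEval p) κ l * TopParameters.gE (mem_curve_dom hn he hl) *
        algebraMap ℝ (SGerm p) (p 2)
      + l • (algebraMap ℝ (SGerm p) κ.b * centered (germData s hs) (germEval p) 0 ^ (κ.j + 1)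
        + algebraMap ℝ (SGerm p) κ.y₀) := rfl
  rw [TopParameters.gY, gs_one, one_mul, one_mul, hB, gm_curve hn he hl hs, gE_curve hn he hl hs,
    coordGerm_eq hs 2, famY]
  change _ = algebraMap ℝ (SGerm p) (p 2) + _ + _
  ring

theorem famM_mul : famM (germData s hs) (germEval p) κ l *
    TopParameters.gmi (mem_curve_dom hn he hl) = 1 := by
  rw [← gm_curve hn he hl]; exact TopParameters.gm_mul_gmi _

theorem famE_mul : famE (germData s hs) (germEval p) κ l *
    TopParameters.gEi (mem_curve_dom hn he hl) = 1 := by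
  rw [← gE_curve hn he hl]; exact TopParameters.gE_mul_gEi _

theorem eventually_abs_lt_one : ∀ᶠ l : ℝ in 𝓝 0, |l| < 1 := by
  have : ∀ᶠ l : ℝ in 𝓝 0, l ∈ Set.Ioo (-1) 1 := Ioo_mem_nhds (by norm_num) (by norm_num)
  exact this.mono fun l h => abs_lt.mpr h

/-- The variation of the jet of `s` along the curve with parameters `κ`. -/
def germVariation : Variation (germData s hs) (germEval p) :=
  curveVariation (germData s hs) (germEval p) κ
    (eventually_abs_lt_one.mono fun _ hl => IsUnit.of_mul_eq_one _ (famM_mul hn he hl hs))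
    (eventually_abs_lt_one.mono fun _ hl => IsUnit.of_mul_eq_one _ (famE_mul hn he hl hs))

theorem germVariation_matches {s' : (Fin 3 → ℝ) → (Fin 2 → ℝ)}
    (hs' : ContDiffAt ℝ ∞ s' (((curveParameters κ hn he p hl).trafo 1 1).base p))
    (h : ∀ᶠ q in 𝓝 p, s' (((curveParameters κ hn he p hl).trafo 1 1).base q) =
      ((curveParameters κ hn he p hl).trafo 1 1).fibre q (s q)) :
    (germVariation hn he hs).Matches
      (TopParameters.pointMap 1 1 (mem_curve_dom hn he hl) hs hs' h) l where
  Q := (TopParameters.d1_gX 1 _).symm.trans (congrArg (germDeriv p 1) (gX_curve hn he hl hs))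
  Pi := by
    change TopParameters.gPi 1 1 _ = Ring.inverse _ * Ring.inverse _
    rw [inverse_eq_of_mul_eq_one (famM_mul hn he hl hs),
      inverse_eq_of_mul_eq_one (famE_mul hn he hl hs), TopParameters.gPi, gs_one, one_mul, one_mul]
  Qi := by
    change TopParameters.gQi 1 _ = Ring.inverse _ ^ 2
    rw [inverse_eq_of_mul_eq_one (famE_mul hn he hl hs), TopParameters.gQi, gs_one, one_mul]
  c := (TopParameters.d2_gX 1 _).symm.trans (congrArg (germDeriv p 2) (gX_curve hn he hl hs))
  Xt := (TopParameters.d0_gX 1 _).symm.trans (congrArg (germDeriv p 0) (gX_curve hn he hl hs))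
  Yt := (TopParameters.d0_gY 1 1 _).symm.trans (congrArg (germDeriv p 0) (gY_curve hn he hl hs))

theorem base_curve (i : Fin 3) : ((curveParameters κ hn he p hl).trafo 1 1).base p i =
    germEval p (![famT (germData s hs) (germEval p) κ l, famX (germData s hs) (germEval p) κ l,
      famY (germData s hs) (germEval p) κ l] i) := by
  fin_cases i
  · exact congrArg (germEval p) (gT_curve hn he hl hs)
  · exact congrArg (germEval p) (gX_curve hn he hl hs)
  · exact congrArg (germEval p) (gY_curve hn he hl hs)

end Germs

/-! ### Transformed sections -/

theorem contDiffAt_fibre {g : TopParameters} {p : Fin 3 → ℝ} (ε δ : ℤˣ) (hp : p 0 ∈ g.dom)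
    {s : (Fin 3 → ℝ) → (Fin 2 → ℝ)} (hs : ContDiffAt ℝ ∞ s p) :
    ContDiffAt ℝ ∞ (fun q => (g.trafo ε δ).fibre q (s q)) p := by
  have hc : ∀ i, ContDiffAt ℝ ∞ (fun q : Fin 3 → ℝ => q i) p := fun i => contDiffAt_apply ℝ ℝ i p
  have hE0 := (g.E_pos _ hp).ne'
  have hm0 := (g.m_pos hp).ne'
  have hD0 := (g.deriv_D_pos _ hp).ne'
  have hE := contDiffAt_comp_zero (g.smoothE hp)
  have hE' := contDiffAt_comp_zero (contDiffAt_deriv (g.smoothE hp))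
  have hE'' := contDiffAt_comp_zero (contDiffAt_deriv (contDiffAt_deriv (g.smoothE hp)))
  have hm := contDiffAt_comp_zero (g.smooth_m hp)
  have hD' := contDiffAt_comp_zero (contDiffAt_deriv (g.smoothD hp))
  have hA' := contDiffAt_comp_zero (contDiffAt_deriv (g.smoothA hp))
  have hB' := contDiffAt_comp_zero (contDiffAt_deriv (g.smoothB hp))
  have hC := contDiffAt_comp_zero (g.smoothC hp)
  have h1 := contDiffAt_comp_zero (contDiffAt_deriv
    (((g.smoothE hp).pow 3).div (g.smooth_m hp) hm0))
  have h2 := contDiffAt_comp_zero (contDiffAt_deriv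
    ((g.smoothC hp).div ((g.smoothE hp).pow 4) (pow_ne_zero 4 hE0)))
  have hu := contDiffAt_component hs 0
  have hv := contDiffAt_component hs 1
  refine contDiffAt_pi.mpr fun i => ?_
  fin_cases i
  · exact contDiffAt_const.mul (((((hE.div hm hm0).mul hu).sub
      (((hc 2).div (hE.pow 2) (pow_ne_zero 2 hE0)).mul h1)).add (hB'.div hD' hD0)).sub
      ((contDiffAt_const.mul hC).div (hE.mul hm) (mul_ne_zero hE0 hm0)))
  · exact ((((((hE.pow 2).div hD' hD0).mul hv).add
      (((hC.add (((contDiffAt_const.mul hE).mul hE').mul (hc 2))).div hD' hD0).mul hu)).add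
      ((((hE.mul hE'').sub (contDiffAt_const.mul (hE'.pow 2))).div hD' hD0).mul ((hc 2).pow 2))).add
      ((((hE.pow 4).div hD' hD0).mul h2).mul (hc 2))).add
      ((((contDiffAt_const.mul hE).mul hE').div hD' hD0).mul (hc 1)) |>.add
      ((((hE.pow 2).mul hA').sub (hC.pow 2)).div (hD'.mul (hE.pow 2))
        (mul_ne_zero hD0 (pow_ne_zero 2 hE0)))

theorem fderiv_base_apply {g : TopParameters} {p : Fin 3 → ℝ} (ε δ : ℤˣ) (hp : p 0 ∈ g.dom)
    (v : Fin 3 → ℝ) (i : Fin 3) : fderiv ℝ (g.trafo ε δ).base p v i =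
      ∑ j, v j * germEval p (germDeriv p j (germ (fun q => (g.trafo ε δ).base q i)
        (contDiffAt_pi.mp (TopParameters.smooth_base ε δ hp) i))) := by
  have hd : DifferentiableAt ℝ (g.trafo ε δ).base p :=
    (TopParameters.smooth_base ε δ hp).differentiableAt (by simp)
  have e2 : ∀ j, germEval p (germDeriv p j (germ (fun q => (g.trafo ε δ).base q i)
        (contDiffAt_pi.mp (TopParameters.smooth_base ε δ hp) i))) =
        fderiv ℝ (g.trafo ε δ).base p (Pi.single j 1) i := by
    intro j
    rw [germDeriv_germ, germEval_germ, partialDeriv, (hasFDerivAt_pi'.mp hd.hasFDerivAt i).fderiv]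
    rfl
  have e3 : v = ∑ j, v j • Pi.single j (1 : ℝ) := by
    ext k
    simp [Finset.sum_apply, Pi.single_apply]
  simp only [e2]
  conv_lhs => rw [e3, map_sum]
  simp [Finset.sum_apply]

/-- In the order t, y, x the Jacobian matrix is triangular with diagonal P^2 / Q, P, Q, all units.
-/
theorem fderiv_base_injective {g : TopParameters} {p : Fin 3 → ℝ} (ε δ : ℤˣ) (hp : p 0 ∈ g.dom) :
    Function.Injective (fderiv ℝ (g.trafo ε δ).base p) := by
  have hP : TopParameters.gP ε δ hp * TopParameters.gPi ε δ hp = 1 := by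
    rw [TopParameters.gP, TopParameters.gPi]
    linear_combination (TopParameters.gs p ε * TopParameters.gs p ε * TopParameters.gs p δ *
      TopParameters.gs p δ * TopParameters.gE hp * TopParameters.gEi hp) *
        TopParameters.gm_mul_gmi hp +
      (TopParameters.gs p ε * TopParameters.gs p ε * TopParameters.gs p δ * TopParameters.gs p δ) *
        TopParameters.gE_mul_gEi hp +
      TopParameters.gs p δ * TopParameters.gs p δ * TopParameters.gs_mul_self (p := p) ε +
      TopParameters.gs_mul_self (p := p) δ
  have hQ : TopParameters.gQ ε hp * TopParameters.gQi ε hp = 1 := by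
    rw [TopParameters.gQ, TopParameters.gQi]
    linear_combination (TopParameters.gs p ε * TopParameters.gs p ε) *
      (TopParameters.gE hp * TopParameters.gEi hp + 1) * TopParameters.gE_mul_gEi hp +
      TopParameters.gs_mul_self (p := p) ε
  have hP' := congrArg (germEval p) hP
  have hQ' := congrArg (germEval p) hQ
  rw [map_mul, map_one] at hP' hQ'
  refine (injective_iff_map_eq_zero _).mpr fun v hv => ?_
  have h := fun i => (fderiv_base_apply ε δ hp v i).symm.trans (congrFun hv i)
  have h0 := h 0
  have h1 := h 1
  have h2 := h 2
  simp only [Fin.sum_univ_three, TopParameters.germ_base_zero ε δ hp,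
    TopParameters.germ_base_one ε δ hp, TopParameters.germ_base_two ε δ hp,
    TopParameters.d0_gT ε δ hp, TopParameters.d0_gX, TopParameters.d0_gY, TopParameters.d1_gT ε hp,
    TopParameters.d1_gX, TopParameters.d1_gY, TopParameters.d2_gT ε hp, TopParameters.d2_gX,
    TopParameters.d2_gY, map_zero, mul_zero, add_zero, map_mul, map_pow, Pi.zero_apply] at h0 h1 h2
  have v0 : v 0 = 0 := (mul_eq_zero.mp h0).resolve_right (mul_ne_zero
    (pow_ne_zero 2 (left_ne_zero_of_mul_eq_one hP')) (right_ne_zero_of_mul_eq_one hQ'))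
  rw [v0, zero_mul, zero_add] at h1 h2
  have v2 : v 2 = 0 := (mul_eq_zero.mp h2).resolve_right (left_ne_zero_of_mul_eq_one hP')
  rw [v2, zero_mul, add_zero] at h1
  have v1 : v 1 = 0 := (mul_eq_zero.mp h1).resolve_right (left_ne_zero_of_mul_eq_one hQ')
  funext i
  fin_cases i
  exacts [v0, v1, v2]

/-- By the inverse function theorem the base map has a smooth local inverse; carrying the section
through it gives the section whose graph is the image graph. -/
theorem exists_transformed {g : TopParameters} {p : Fin 3 → ℝ} (ε δ : ℤˣ) (hp : p 0 ∈ g.dom)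
    {s : (Fin 3 → ℝ) → (Fin 2 → ℝ)} (hs : ContDiffAt ℝ ∞ s p) :
    ∃ s' : (Fin 3 → ℝ) → (Fin 2 → ℝ), ContDiffAt ℝ ∞ s' ((g.trafo ε δ).base p) ∧
      ∀ᶠ q in 𝓝 p, s' ((g.trafo ε δ).base q) = (g.trafo ε δ).fibre q (s q) := by
  have hb := TopParameters.smooth_base ε δ hp
  let e : (Fin 3 → ℝ) ≃L[ℝ] (Fin 3 → ℝ) := (LinearEquiv.ofInjectiveEndo
    (fderiv ℝ (g.trafo ε δ).base p).toLinearMap (fderiv_base_injective ε δ hp)).toContinuousLinearEquiv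
  have he : HasFDerivAt (g.trafo ε δ).base (e : (Fin 3 → ℝ) →L[ℝ] (Fin 3 → ℝ)) p := by
    have h1 : (e : (Fin 3 → ℝ) →L[ℝ] (Fin 3 → ℝ)) = fderiv ℝ (g.trafo ε δ).base p := by
      ext1 v; rfl
    rw [h1]
    exact (hb.differentiableAt (by simp)).hasFDerivAt
  have hn : (∞ : WithTop ℕ∞) ≠ 0 := by simp
  refine ⟨fun q => (g.trafo ε δ).fibre (hb.localInverse he hn q) (s (hb.localInverse he hn q)),
    ?_, ?_⟩
  · refine ContDiffAt.comp (g := fun q => (g.trafo ε δ).fibre q (s q)) _ ?_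
      (hb.to_localInverse he hn)
    rw [hb.localInverse_apply_image he hn]
    exact contDiffAt_fibre ε δ hp hs
  · filter_upwards [(hb.hasStrictFDerivAt' he hn).eventually_left_inverse] with q hq
    have hq' : hb.localInverse he hn ((g.trafo ε δ).base q) = q := hq
    rw [hq']

/-! ### Sections with prescribed jets -/

section Monomials

variable {R : Type} [CommRing R] [Algebra ℝ R] {A : DiffData R} {χ : R →ₐ[ℝ] ℝ}

theorem iterate_d_pow (i : Fin 3) (m n : ℕ) : (A.d i)^[n] (centered A χ i ^ m) =
    (m.descFactorial n : R) * centered A χ i ^ (m - n) := by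
  induction n with
  | zero => simp
  | succ n ih =>
    rw [Function.iterate_succ_apply', ih, Derivation.leibniz, Derivation.map_natCast, smul_zero,
      add_zero, Derivation.leibniz_pow, d_centered, if_pos rfl, smul_eq_mul, nsmul_eq_mul,
      smul_eq_mul, mul_one, Nat.descFactorial_succ, Nat.sub_sub]
    push_cast
    ring

theorem iterate_mul_of_d_eq_zero {i : Fin 3} {g : R} (hg : A.d i g = 0) (n : ℕ) (h : R) :
    (A.d i)^[n] (g * h) = g * (A.d i)^[n] h := by
  induction n generalizing h with
  | zero => rfl
  | succ n ih =>
    rw [Function.iterate_succ_apply, Derivation.leibniz, hg, smul_zero, add_zero, smul_eq_mul, ih,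
      Function.iterate_succ_apply]

theorem d_pow_of_ne {i j : Fin 3} (hij : j ≠ i) (m : ℕ) : A.d i (centered A χ j ^ m) = 0 := by
  rw [Derivation.leibniz_pow, d_centered, if_neg hij, smul_zero, smul_zero]

theorem eval_iterate_d_pow (i : Fin 3) (m n : ℕ) :
    χ ((A.d i)^[n] (centered A χ i ^ m)) = if n = m then (m.factorial : ℝ) else 0 := by
  rw [iterate_d_pow, map_mul, map_natCast, map_pow, eval_centered]
  rcases lt_trichotomy n m with h | rfl | h
  · rw [if_neg h.ne, zero_pow (by omega), mul_zero]
  · rw [if_pos rfl, Nat.descFactorial_self, Nat.sub_self, pow_zero, mul_one]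
  · rw [if_neg h.ne', Nat.descFactorial_of_lt h, Nat.cast_zero, zero_mul]

variable (A χ) in
/-- A monomial in the centered coordinates. -/
def monomialAt (σ : Fin 3 → ℕ) : R :=
  centered A χ 0 ^ σ 0 * centered A χ 1 ^ σ 1 * centered A χ 2 ^ σ 2

theorem eval_dIter_monomialAt (σ τ : Fin 3 → ℕ) :
    χ (dIter A.d τ (monomialAt A χ σ)) =
      if τ = σ then (∏ i, (σ i).factorial : ℝ) else 0 := by
  have h2 : A.d 2 (centered A χ 0 ^ σ 0 * centered A χ 1 ^ σ 1) = 0 := by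
    rw [Derivation.leibniz, d_pow_of_ne (by decide), d_pow_of_ne (by decide), smul_zero, smul_zero,
      add_zero]
  have hz : ∀ {i j : Fin 3}, j ≠ i → ∀ m n : ℕ, A.d i ((A.d j)^[n] (centered A χ j ^ m)) = 0 := by
    intro i j hij m n
    rw [iterate_d_pow, Derivation.leibniz, d_pow_of_ne hij, Derivation.map_natCast, smul_zero,
      smul_zero, add_zero]
  have h1 : A.d 1 (centered A χ 0 ^ σ 0 * (A.d 2)^[τ 2] (centered A χ 2 ^ σ 2)) = 0 := by
    rw [Derivation.leibniz, d_pow_of_ne (by decide), hz (by decide), smul_zero, smul_zero, add_zero]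
  have h0 : A.d 0 ((A.d 1)^[τ 1] (centered A χ 1 ^ σ 1) *
      (A.d 2)^[τ 2] (centered A χ 2 ^ σ 2)) = 0 := by
    rw [Derivation.leibniz, hz (by decide), hz (by decide), smul_zero, smul_zero, add_zero]
  have e : dIter A.d τ (monomialAt A χ σ) = (A.d 1)^[τ 1] (centered A χ 1 ^ σ 1) *
      (A.d 2)^[τ 2] (centered A χ 2 ^ σ 2) * (A.d 0)^[τ 0] (centered A χ 0 ^ σ 0) := by
    rw [dIter, monomialAt, iterate_mul_of_d_eq_zero h2, mul_right_comm,
      iterate_mul_of_d_eq_zero h1, ← iterate_mul_of_d_eq_zero h0]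
    congr 1
    ring
  rw [e, map_mul, map_mul, eval_iterate_d_pow, eval_iterate_d_pow, eval_iterate_d_pow,
    Fin.prod_univ_three]
  by_cases h : τ = σ
  · subst h
    simp only [if_true]
    ring
  · rw [if_neg h]
    have : τ 0 ≠ σ 0 ∨ τ 1 ≠ σ 1 ∨ τ 2 ≠ σ 2 := by
      by_contra! hc
      refine h (funext fun i => ?_)
      fin_cases i
      exacts [hc.1, hc.2.1, hc.2.2]
    rcases this with h | h | h <;> simp [h]

theorem dIter_sum_smul {ι : Type*} (τ : Fin 3 → ℕ) (S : Finset ι) (c : ι → ℝ) (f : ι → R) :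
    dIter A.d τ (∑ i ∈ S, c i • f i) = ∑ i ∈ S, c i • dIter A.d τ (f i) := by
  obtain ⟨L, hL⟩ : ∃ L : R →ₗ[ℝ] R, ∀ h, dIter A.d τ h = L h :=
    ⟨(A.d 0).toLinearMap ^ τ 0 * (A.d 1).toLinearMap ^ τ 1 * (A.d 2).toLinearMap ^ τ 2,
      fun h => by simp only [dIter, Module.End.mul_apply, Module.End.pow_apply]; rfl⟩
  simp only [hL, map_sum, map_smul]

end Monomials

/-- A Taylor polynomial suffices, since only finitely many derivatives are prescribed. -/
theorem exists_section (K : ℕ) (p : Fin 3 → ℝ) (J : Fin 2 → (Fin 3 → ℕ) → ℝ) :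
    ∃ s : (Fin 3 → ℝ) → (Fin 2 → ℝ), ContDiffAt ℝ ∞ s p ∧
      ∀ a σ, (∀ i, σ i ≤ K) → iterPartialDeriv σ (fun q => s q a) p = J a σ := by
  have h0 : ContDiffAt ℝ ∞ (fun _ : Fin 3 → ℝ => (0 : Fin 2 → ℝ)) p := contDiffAt_const
  let S : Finset (Fin 3 → ℕ) := Fintype.piFinset fun _ => Finset.range (K + 1)
  choose f hf hfe using fun a : Fin 2 => exists_germ (∑ σ ∈ S, (J a σ / ∏ i, (σ i).factorial : ℝ) •
    monomialAt (germData _ h0) (germEval p) σ)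
  refine ⟨fun q a => f a q, contDiffAt_pi.mpr hf, fun a τ hτ => ?_⟩
  rw [← germEval_dIter τ (hf a), ← hfe]
  have e := dIter_sum_smul (A := germData _ h0) τ S (fun σ => (J a σ / ∏ i, (σ i).factorial : ℝ))
    (monomialAt (germData _ h0) (germEval p))
  refine (congrArg (germEval p) e).trans ?_
  simp only [map_sum, map_smul, eval_dIter_monomialAt]
  have hτS : τ ∈ S := Fintype.mem_piFinset.mpr fun i => Finset.mem_range_succ_iff.mpr (hτ i)
  rw [Finset.sum_eq_single_of_mem τ hτS fun σ _ h => by rw [if_neg h.symm, smul_zero], if_pos rfl,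
    smul_eq_mul, Nat.cast_prod, div_mul_cancel₀]
  exact Finset.prod_ne_zero_iff.mpr fun i _ => Nat.cast_ne_zero.mpr (Nat.factorial_ne_zero _)

/-! ### Orbit curves -/

theorem groupParam_bounds (s : GroupIndex) : |(groupParam s).n| ≤ 1 ∧ |(groupParam s).e| ≤ 1 := by
  rcases s with i | ⟨j, a⟩
  · simp [groupParam]
  · fin_cases a <;> simp [groupParam]

theorem freePart_jet {k : ℕ} {s : (Fin 3 → ℝ) → (Fin 2 → ℝ)} {p : Fin 3 → ℝ}
    (hs : ContDiffAt ℝ ∞ s p) {a : Fin 2} {α β : ℕ} {γ : Bool} (h : α + β + γ.toNat ≤ k) :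
    freePart (jet k s p) (Sum.inr (a, α, β, γ)) =
      germEval p (dIter (germDeriv p) ![α, β, γ.toNat] ((germData s hs).w a)) := by
  have h' : jetOrder (toJet (Sum.inr (a, α, β, γ))) ≤ k := (jetOrder_toJet _).trans_le h
  rw [freePart, extendJet, dif_pos h']
  exact (germEval_dIter _ (contDiffAt_component hs a)).symm

theorem freePart_jet_inl {k : ℕ} {s : (Fin 3 → ℝ) → (Fin 2 → ℝ)} {p : Fin 3 → ℝ} (i : Fin 3) :
    freePart (jet k s p) (Sum.inl i) = p i := by
  rw [freePart, extendJet, dif_pos ((jetOrder_toJet _).trans_le (Nat.zero_le k))]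
  rfl

theorem freePart_pointOfFree {k : ℕ} (z : FreeCoord → ℝ) {c : FreeCoord} (hc : freeOrder c ≤ k) :
    freePart (pointOfFree k z) c = z c := by
  rw [freePart, extendJet, dif_pos ((jetOrder_toJet _).trans_le hc), pointOfFree,
    restrictFree_toJet, MvPolynomial.aeval_X]

theorem isVan_of_jet_mem {k : ℕ} {s : (Fin 3 → ℝ) → (Fin 2 → ℝ)} {p : Fin 3 → ℝ}
    (hs : ContDiffAt ℝ ∞ s p) (h : jet k s p ∈ equationManifold k) (a : Fin 2) :
    IsVan (germData s hs) (germEval p) (k - 1) ((germData s hs).ev (msEquation a)) := by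
  refine isVan_of_eval_dIter fun σ hσ => ?_
  have hσ' : ∑ i, σ i + 2 ≤ k := by omega
  rw [DiffData.ev, ← evJet_iterTotalDeriv (germData s hs).comm (germData s hs).d_b]
  exact (germEval_ev k hs (iterTotalDeriv_msEquation_mem_ordLE a σ hσ')).trans (h a σ hσ')

theorem jet_mem_of_isVan {k : ℕ} {s : (Fin 3 → ℝ) → (Fin 2 → ℝ)} {p : Fin 3 → ℝ}
    (hs : ContDiffAt ℝ ∞ s p)
    (h : ∀ a, IsVan (germData s hs) (germEval p) (k - 1) ((germData s hs).ev (msEquation a))) :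
    jet k s p ∈ equationManifold k := by
  intro a σ hσ
  have h1 := (h a).eval_dIter (σ := σ) (by omega)
  rw [DiffData.ev, ← evJet_iterTotalDeriv (germData s hs).comm (germData s hs).d_b] at h1
  exact (germEval_ev k hs (iterTotalDeriv_msEquation_mem_ordLE a σ hσ)).symm.trans h1

/-- Through a generic point of the equation there are orbit curves with tangent vectors in
triangular position. -/
theorem exists_curve (k : ℕ) (z : FreeCoord → ℝ) (hx : z (Sum.inr (0, 0, 1, false)) ≠ 0)
    (hxx : z (Sum.inr (0, 0, 2, false)) ≠ 0) (i₀ : GroupIndex) :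
    ∃ (Θ : ℝ → FreeCoord → ℝ) (v : FreeCoord → ℝ),
      (∀ c, freeOrder c ≤ k → Θ 0 c = z c) ∧ (∀ c, HasDerivAt (fun l => Θ l c) (v c) 0) ∧
      (∀ l, |l| < 1 → ∃ Φ ∈ symmetryPseudogroup, ∃ θ ∈ equationManifold k,
        ProlongedMaps k Φ (pointOfFree k z) θ ∧ ∀ c, freeOrder c ≤ k → freePart θ c = Θ l c) ∧
      (∀ j, pivotKey j < pivotKey i₀ → v (pivot j) = 0) ∧ v (pivot i₀) ≠ 0 := by
  obtain ⟨hn, he⟩ := groupParam_bounds i₀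
  -- Order k + 2 rather than k, so that u_x and u_xx of the section take the prescribed nonzero
  -- values even when k < 2.
  obtain ⟨s, hs, hJ⟩ := exists_section (k + 2) (fun i => z (Sum.inl i))
    (fun a σ => MvPolynomial.aeval z (restrictFree (MvPolynomial.X (Sum.inr (a, σ)))))
  set p : Fin 3 → ℝ := fun i => z (Sum.inl i) with hp
  have hjet : ∀ K, K ≤ k + 2 → jet K s p = pointOfFree K z := by
    intro K hK
    funext ⟨c, hc⟩
    rcases c with i | ⟨a, σ⟩
    · simp only [jet, pointOfFree, restrictFree, evJet_inl, MvPolynomial.aeval_X, hp]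
    · refine hJ a σ fun i => ?_
      exact ((Finset.single_le_sum (fun _ _ => Nat.zero_le _) (Finset.mem_univ i)).trans hc).trans hK
  have hval : ∀ (a : Fin 2) (α β : ℕ) (γ : Bool), α + β + γ.toNat ≤ k + 2 →
      germEval p (dIter (germDeriv p) ![α, β, γ.toNat] ((germData s hs).w a)) =
        z (Sum.inr (a, α, β, γ)) := by
    intro a α β γ h
    rw [← freePart_jet hs h, hjet _ le_rfl, freePart_pointOfFree z h]
  set S := germVariation hn he hs with hSdef
  have hS : S.HasParam (groupParam i₀) := ⟨rfl, rfl, rfl⟩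
  have hx' : germEval p (germDeriv p 1 ((germData s hs).w 0)) ≠ 0 := by
    rw [← hval 0 0 1 false (by simp)] at hx
    exact hx
  have hxx' : germEval p (germDeriv p 1 (germDeriv p 1 ((germData s hs).w 0))) ≠ 0 := by
    rw [← hval 0 0 2 false (by simp)] at hxx
    exact hxx
  let Θ : ℝ → FreeCoord → ℝ := fun l c => match c with
    | Sum.inl i => germEval p (![famT (germData s hs) (germEval p) (groupParam i₀) l,
        famX (germData s hs) (germEval p) (groupParam i₀) l,
        famY (germData s hs) (germEval p) (groupParam i₀) l] i)
    | Sum.inr (a, α, β, γ) => germEval p (S.opIter ![α, β, γ.toNat] (S.fibre a) l)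
  refine ⟨Θ, S.tangent, ?_, ?_, ?_, fun j hj => Variation.tangent_pivot_eq_zero hS hx' hxx' hj,
    Variation.tangent_pivot_ne_zero hS hx' hxx'⟩
  · rintro (j | ⟨a, α, β, γ⟩) hc
    · fin_cases j
      · change germEval p (famT _ _ _ 0) = _
        rw [famT, zero_smul, zero_pow two_ne_zero, zero_smul, add_zero, add_zero]
        rfl
      · change germEval p (famX _ _ _ 0) = _
        rw [famX_zero]
        rfl
      · change germEval p (famY _ _ _ 0) = _
        rw [famY_zero]
        rfl
    · change germEval p (S.opIter _ _ 0) = _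
      rw [Variation.opIter_zero, Variation.fibre_zero]
      exact hval a α β γ (le_trans hc (by omega))
  · rintro (j | ⟨a, α, β, γ⟩)
    · fin_cases j
      · exact hasDerivAt_famT
      · exact expands_famX 0
      · exact expands_famY 0
    · exact S.hasDerivAt_opIter_fibre a _
  · intro l hl
    obtain ⟨s', hs', h⟩ := exists_transformed 1 1 (mem_curve_dom hn he hl) hs
    have hM := germVariation_matches hn he hl hs hs' h
    set Φ := (curveParameters (groupParam i₀) hn he p hl).trafo 1 1 with hΦ
    set G := TopParameters.pointMap 1 1 (mem_curve_dom hn he hl) hs hs' h with hG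
    have hχ : ∀ g, germEval p (G.φ g) = germEval (Φ.base p) g :=
      germEval_germPull (TopParameters.smooth_base 1 1 (mem_curve_dom hn he hl))
    have hmem : jet k s p ∈ equationManifold k := by
      rw [hjet k (by omega)]; exact pointOfFree_mem k z
    refine ⟨Φ, ⟨1, 1, _, rfl⟩, jet k s' (Φ.base p),
      jet_mem_of_isVan hs' (isVan_msEquation_of_pointMap G hχ (isVan_of_jet_mem hs hmem)),
      ⟨p, s, s', ⟨mem_curve_dom hn he hl, trivial⟩, hs, hs', h, hjet k (by omega), rfl⟩, ?_⟩
    rintro (j | ⟨a, α, β, γ⟩) hc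
    · rw [freePart_jet_inl]
      exact base_curve hn he hl hs j
    · rw [freePart_jet hs' hc, ← hχ]
      exact congrArg (germEval p) (hM.phi_dIter a _)

end

end ManakovSantini

namespace ManakovSantini

noncomputable section

/-! ### The upper bound for the number of invariants -/

/-- Linear independence over the fraction field gives a one-sided inverse. Clearing its denominators
gives a polynomial identity N B = q · 1, which specializes at every point with q ≠ 0. -/
theorem exists_eval_linearIndependent {ι m : Type*} [Fintype ι] [Fintype m]
    (N : m → ι → MvPolynomial ι ℝ)
    (h : LinearIndependent (RatFun ι) fun i j => algebraMap _ (RatFun ι) (N i j)) :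
    ∃ q : MvPolynomial ι ℝ, q ≠ 0 ∧ ∀ z, MvPolynomial.eval z q ≠ 0 →
      LinearIndependent ℝ fun i j => MvPolynomial.eval z (N i j) := by
  classical
  obtain ⟨g, hg⟩ := (Fintype.linearCombination (RatFun ι)
    fun i j => algebraMap _ (RatFun ι) (N i j)).exists_leftInverse_of_injective
    (LinearMap.ker_eq_bot.mpr (linearIndependent_iff_injective_fintypeLinearCombination.mp h))
  obtain ⟨q, hq⟩ := IsLocalization.exist_integer_multiples_of_finite
    (nonZeroDivisors (MvPolynomial ι ℝ)) (fun ji : ι × m => g (Pi.single ji.1 1) ji.2)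
  choose B hB using fun ji => hq ji
  have hNB : ∀ i i', ∑ j, N i j * B (j, i') = if i' = i then q.1 else 0 := by
    intro i i'
    apply IsFractionRing.injective (MvPolynomial ι ℝ) (RatFun ι)
    have h1 := congrFun (LinearMap.congr_fun hg (Pi.single i 1)) i'
    rw [LinearMap.comp_apply, Fintype.linearCombination_apply_single, one_smul,
      LinearMap.id_apply] at h1
    have h2 : (fun j => algebraMap _ (RatFun ι) (N i j)) =
        ∑ j, algebraMap _ (RatFun ι) (N i j) • (Pi.single j 1 : ι → RatFun ι) := by
      ext k
      simp [Finset.sum_apply, Pi.single_apply, Algebra.algebraMap_eq_smul_one]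
    rw [h2, map_sum, Finset.sum_apply] at h1
    simp only [map_smul, Pi.smul_apply, smul_eq_mul] at h1
    simp only [map_sum, map_mul, hB, Algebra.smul_def]
    rw [show (∑ j, algebraMap _ (RatFun ι) (N i j) * (algebraMap _ (RatFun ι) q.1 *
      g (Pi.single j 1) i')) = algebraMap _ (RatFun ι) q.1 *
        ∑ j, algebraMap _ (RatFun ι) (N i j) * g (Pi.single j 1) i' by
      rw [Finset.mul_sum]; exact Finset.sum_congr rfl fun j _ => by ring, h1, Pi.single_apply]
    split_ifs <;> simp
  refine ⟨q.1, nonZeroDivisors.ne_zero q.2, fun z hz => ?_⟩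
  refine Fintype.linearIndependent_iff.mpr fun c hc i => ?_
  have h3 : ∑ j, (∑ i', c i' * MvPolynomial.eval z (N i' j)) * MvPolynomial.eval z (B (j, i)) =
      c i * MvPolynomial.eval z q.1 := by
    have h4 : ∀ i', ∑ j, MvPolynomial.eval z (N i' j) * MvPolynomial.eval z (B (j, i)) =
        if i = i' then MvPolynomial.eval z q.1 else 0 := by
      intro i'
      have := congrArg (MvPolynomial.eval z) (hNB i' i)
      simp only [map_sum, map_mul] at this
      rw [this]
      split_ifs <;> simp
    simp only [Finset.sum_mul]
    rw [Finset.sum_comm]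
    simp only [mul_assoc, ← Finset.mul_sum, h4]
    simp
  have h5 : ∀ j, ∑ i', c i' * MvPolynomial.eval z (N i' j) = 0 := by
    intro j
    have := congrFun hc j
    simpa [Finset.sum_apply] using this
  simp only [h5, zero_mul, Finset.sum_const_zero] at h3
  exact (mul_eq_zero.mp h3.symm).resolve_right hz

/-- Rank and nullity: the vectors v lie in the kernel of the matrix with rows N. -/
theorem card_add_card_le {ι m n : Type*} [Fintype ι] [Fintype m] [Fintype n] {N : m → ι → ℝ}
    (hN : LinearIndependent ℝ N) {v : n → ι → ℝ} (hv : LinearIndependent ℝ v)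
    (h : ∀ i s, ∑ j, N i j * v s j = 0) : Fintype.card m + Fintype.card n ≤ Fintype.card ι := by
  classical
  let M : Matrix m ι ℝ := Matrix.of N
  have h1 : M.rank = Fintype.card m := LinearIndependent.rank_matrix (M := M) hN
  have h2 := M.mulVecLin.finrank_range_add_finrank_ker
  rw [Module.finrank_fintype_fun_eq_card] at h2
  have h3 : Submodule.span ℝ (Set.range v) ≤ LinearMap.ker M.mulVecLin := by
    rw [Submodule.span_le]
    rintro _ ⟨s, rfl⟩
    rw [SetLike.mem_coe, LinearMap.mem_ker]
    funext i
    exact h i s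
  have h4 := Submodule.finrank_mono h3
  rw [finrank_span_eq_card hv] at h4
  rw [Matrix.rank] at h1
  omega

theorem hasDerivAt_eval {ι : Type*} [Fintype ι] {Θ : ℝ → ι → ℝ} {v : ι → ℝ}
    (h : ∀ j, HasDerivAt (fun l => Θ l j) (v j) 0) (p : MvPolynomial ι ℝ) :
    HasDerivAt (fun l => MvPolynomial.eval (Θ l) p)
      (∑ j, MvPolynomial.eval (Θ 0) (MvPolynomial.pderiv j p) * v j) 0 := by
  classical
  induction p using MvPolynomial.induction_on with
  | C a => simpa using hasDerivAt_const (0 : ℝ) a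
  | add p q hp hq =>
    simp only [map_add, add_mul, Finset.sum_add_distrib]
    exact hp.add hq
  | mul_X p i hp =>
    simp only [map_mul, MvPolynomial.eval_X]
    refine (hp.mul (h i)).congr_deriv ?_
    simp only [Derivation.leibniz, smul_eq_mul, map_add, map_mul, MvPolynomial.eval_X,
      MvPolynomial.pderiv_X, add_mul, Finset.sum_add_distrib, Finset.sum_mul]
    rw [add_comm]
    congr 1
    · rw [Finset.sum_eq_single i] <;> simp +contextual [eq_comm]
    · exact Finset.sum_congr rfl fun j _ => by ring

/-- The numerators of the differential of an invariant vanish on the tangent vectors of orbit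
curves. -/
theorem sum_mul_tangent_eq_zero {k : ℕ} [Fintype (FreeCoordLE k)]
    {P Q : MvPolynomial (JetCoordLE k) ℝ}
    (hinv : ∀ Φ ∈ symmetryPseudogroup, ∀ θ ∈ equationManifold k, ∀ θ' ∈ equationManifold k,
      ProlongedMaps k Φ θ θ' →
      MvPolynomial.eval θ Q ≠ 0 → MvPolynomial.eval θ' Q ≠ 0 →
      MvPolynomial.eval θ P / MvPolynomial.eval θ Q =
        MvPolynomial.eval θ' P / MvPolynomial.eval θ' Q)
    {z : FreeCoord → ℝ} {Θ : ℝ → FreeCoord → ℝ} {v : FreeCoord → ℝ}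
    (h0 : ∀ c, freeOrder c ≤ k → Θ 0 c = z c) (hd : ∀ c, HasDerivAt (fun l => Θ l c) (v c) 0)
    (hΘ : ∀ l, |l| < 1 → ∃ Φ ∈ symmetryPseudogroup, ∃ θ ∈ equationManifold k,
      ProlongedMaps k Φ (pointOfFree k z) θ ∧ ∀ c, freeOrder c ≤ k → freePart θ c = Θ l c)
    (hQ : MvPolynomial.eval (fun c : FreeCoordLE k => z c.1) (chart k Q) ≠ 0) :
    ∑ j : FreeCoordLE k, MvPolynomial.eval (fun c : FreeCoordLE k => z c.1)
      (chart k Q * MvPolynomial.pderiv j (chart k P) - chart k P * MvPolynomial.pderiv j (chart k Q)) *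
        v j.1 = 0 := by
  let Ψ : ℝ → FreeCoordLE k → ℝ := fun l c => Θ l c.1
  have hΨ0 : Ψ 0 = fun c => z c.1 := funext fun c => h0 c.1 c.2
  have hdP := hasDerivAt_eval (Θ := Ψ) (fun j => hd j.1) (chart k P)
  have hdQ := hasDerivAt_eval (Θ := Ψ) (fun j => hd j.1) (chart k Q)
  rw [hΨ0] at hdP hdQ
  have hne : ∀ᶠ l in nhds 0, MvPolynomial.eval (Ψ l) (chart k Q) ≠ 0 :=
    hdQ.continuousAt.eventually_ne (by rw [hΨ0]; exact hQ)
  have hz : ∀ R : MvPolynomial (JetCoordLE k) ℝ, MvPolynomial.eval (pointOfFree k z) R =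
      MvPolynomial.eval (fun c : FreeCoordLE k => z c.1) (chart k R) := fun R => by
    rw [eval_pointOfFree, aeval_chart]
  -- Constancy of P / Q along the orbit curve, with denominators cleared. Its derivative at l = 0 is
  -- the required sum.
  have hconst : ∀ᶠ l in nhds 0, MvPolynomial.eval (fun c : FreeCoordLE k => z c.1) (chart k Q) *
      MvPolynomial.eval (Ψ l) (chart k P) -
      MvPolynomial.eval (fun c : FreeCoordLE k => z c.1) (chart k P) *
      MvPolynomial.eval (Ψ l) (chart k Q) = 0 := by
    filter_upwards [hne, eventually_abs_lt_one] with l hl hl1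
    obtain ⟨Φ, hΦ, θ, hθ, hm, hc⟩ := hΘ l hl1
    have hθe : ∀ R : MvPolynomial (JetCoordLE k) ℝ, MvPolynomial.eval θ R =
        MvPolynomial.eval (Ψ l) (chart k R) := fun R => by
      rw [eval_eq_of_mem hθ, ← aeval_chart]
      congr 1
      exact congrArg _ (funext fun c => hc c.1 c.2)
    have := hinv Φ hΦ _ (pointOfFree_mem k z) θ hθ hm (by rwa [hz]) (by rwa [hθe])
    rw [hz, hz, hθe, hθe, div_eq_div_iff hQ hl] at this
    linear_combination -this
  have hD := (hdP.const_mul (MvPolynomial.eval (fun c : FreeCoordLE k => z c.1) (chart k Q))).sub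
    (hdQ.const_mul (MvPolynomial.eval (fun c : FreeCoordLE k => z c.1) (chart k P)))
  have hD0 := (hasDerivAt_const (0 : ℝ) (0 : ℝ)).congr_of_eventuallyEq hconst
  have := hD.unique hD0
  rw [← this, Finset.mul_sum, Finset.mul_sum, ← Finset.sum_sub_distrib]
  refine Finset.sum_congr rfl fun j _ => ?_
  simp only [map_sub, map_mul]
  ring

theorem exists_eval_ne_zero {k : ℕ} {q : MvPolynomial (FreeCoordLE k) ℝ} (hq : q ≠ 0) :
    ∃ z : FreeCoord → ℝ, MvPolynomial.eval (fun c : FreeCoordLE k => z c.1) q ≠ 0 ∧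
      z (Sum.inr (0, 0, 1, false)) ≠ 0 ∧ z (Sum.inr (0, 0, 2, false)) ≠ 0 := by
  have h1 : MvPolynomial.rename (Subtype.val : FreeCoordLE k → FreeCoord) q ≠ 0 :=
    (map_ne_zero_iff _ (MvPolynomial.rename_injective _ Subtype.val_injective)).mpr hq
  have h2 := mul_ne_zero h1 (mul_ne_zero (freeX_ne_zero 0 0 1 false) (freeX_ne_zero 0 0 2 false))
  obtain ⟨z, hz⟩ : ∃ z, MvPolynomial.eval z (MvPolynomial.rename Subtype.val q *
      (freeX 0 0 1 false * freeX 0 0 2 false)) ≠ 0 := by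
    by_contra! h
    exact h2 (MvPolynomial.funext fun z => by rw [h z, map_zero])
  simp only [map_mul, MvPolynomial.eval_X, MvPolynomial.eval_rename] at hz
  exact ⟨z, left_ne_zero_of_mul hz, left_ne_zero_of_mul (right_ne_zero_of_mul hz),
    right_ne_zero_of_mul (right_ne_zero_of_mul hz)⟩

/-- At one generic point the differentials of the invariants and the orbit directions are both
linearly independent and annihilate each other, so their numbers add up to at most the dimension of
𝓔_k. -/
theorem card_add_groupIndexLE_le {k : ℕ} {m : Type*} [Fintype m]
    {F : m → differentialInvariants k}
    (hF : LinearIndependent (RatFun (FreeCoordLE k))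
      fun i j => ratDeriv j (rationalChart k (F i).1)) :
    Fintype.card m + Nat.card (GroupIndexLE k) ≤ Nat.card (FreeCoordLE k) := by
  have : Fintype (FreeCoordLE k) := Fintype.ofFinite _
  have := finite_groupIndexLE k
  have : Fintype (GroupIndexLE k) := Fintype.ofFinite _
  choose P Q hQ hPQ hinv using fun i => (F i).2
  have hb : ∀ i, chart k (Q i) ≠ 0 := fun i => (restrict_mem_nonZeroDivisors_iff k _).mp (hQ i)
  have hb' : ∀ i, algebraMap _ (RatFun (FreeCoordLE k)) (chart k (Q i)) ≠ 0 := fun i =>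
    (map_ne_zero_iff _ (IsFractionRing.injective _ _)).mpr (hb i)
  -- Numerators of the quotient rule: up to the square of the denominator these are the partial
  -- derivatives of the invariant.
  let N : m → FreeCoordLE k → MvPolynomial (FreeCoordLE k) ℝ := fun i j =>
    chart k (Q i) * MvPolynomial.pderiv j (chart k (P i)) -
      chart k (P i) * MvPolynomial.pderiv j (chart k (Q i))
  have hN : ∀ i j, algebraMap _ (RatFun (FreeCoordLE k)) (N i j) =
      algebraMap _ (RatFun (FreeCoordLE k)) (chart k (Q i)) ^ 2 *
        ratDeriv j (rationalChart k (F i).1) := by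
    intro i j
    have h := congrArg (rationalChart k) (hPQ i)
    rw [map_mul, rationalChart_algebraMap, rationalChart_algebraMap] at h
    have h' := congrArg (ratDeriv j) h
    rw [Derivation.leibniz, ratDeriv_algebraMap, ratDeriv_algebraMap, smul_eq_mul, smul_eq_mul] at h'
    simp only [N, map_sub, map_mul]
    rw [← h, ← h']
    ring
  have hNi : LinearIndependent (RatFun (FreeCoordLE k))
      fun i j => algebraMap _ (RatFun (FreeCoordLE k)) (N i j) := by
    have := hF.units_smul fun i => Units.mk0 _ (pow_ne_zero 2 (hb' i))
    convert this using 1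
    funext i j
    exact hN i j
  obtain ⟨q, hq0, hq⟩ := exists_eval_linearIndependent N hNi
  obtain ⟨z, hz, hx, hxx⟩ := exists_eval_ne_zero
    (mul_ne_zero hq0 (Finset.prod_ne_zero_iff.mpr fun i (_ : i ∈ Finset.univ) => hb i))
  rw [map_mul, map_prod] at hz
  have hzq := left_ne_zero_of_mul hz
  have hzb := fun i => Finset.prod_ne_zero_iff.mp (right_ne_zero_of_mul hz) i (Finset.mem_univ i)
  choose Θ v h0 hd hΘ hlt hdiag using exists_curve k z hx hxx
  -- The order of keys is reversed, because the directions vanish at pivots of smaller key whereas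
  -- the triangularity lemma asks for zeros at larger key.
  have hv : LinearIndependent ℝ fun (s : GroupIndexLE k) (j : FreeCoordLE k) => v s.1 j.1 :=
    linearIndependent_of_triangular (fun s : GroupIndexLE k => OrderDual.toDual (pivotKey s.1))
      (fun s s' h => Subtype.ext (pivotKey_injective h)) (fun s => ⟨pivot s.1, s.2⟩) _
      (fun s s' h => hlt s.1 s'.1 h) (fun s => hdiag s.1)
  have := card_add_card_le (hq _ hzq) hv fun i s =>
    sum_mul_tangent_eq_zero (hinv i) (h0 s.1) (hd s.1) (hΘ s.1) (hzb i)
  rwa [← Nat.card_eq_fintype_card (α := GroupIndexLE k),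
    ← Nat.card_eq_fintype_card (α := FreeCoordLE k)] at this

/-- The transcendence degree is a supremum over algebraically independent sets. The Jacobian
criterion makes each such set finite, and the dimension count bounds its size. -/
theorem invariantRank_le (k : ℕ) : invariantRank k ≤ (Nat.card (InvariantCoord k) : Cardinal) := by
  have : Fintype (FreeCoordLE k) := Fintype.ofFinite _
  refine ciSup_le' fun s => ?_
  have hinj : Function.Injective ((rationalChart k).comp (differentialInvariants k).val) :=
    (rationalChart k).toRingHom.injective.comp Subtype.val_injective
  have h := linearIndependent_jacobian (s.2.map' hinj)
  have : Finite s.1 := h.finite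
  have : Fintype s.1 := Fintype.ofFinite _
  have h2 := card_add_groupIndexLE_le (F := ((↑) : s.1 → differentialInvariants k)) h
  rw [← card_invariantCoord_add k, ← Nat.card_eq_fintype_card] at h2
  have h3 := Nat.le_of_add_le_add_right h2
  rw [← Nat.cast_card]
  exact_mod_cast h3

end

end ManakovSantini

namespace ManakovSantini

noncomputable section

/-! ### Counting invariants -/

theorem invariantRank_eq (k : ℕ) : invariantRank k = (Nat.card (InvariantCoord k) : Cardinal) := by
  refine le_antisymm (invariantRank_le k) ?_
  rw [Nat.cast_card]
  exact mk_invariantCoord_le k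

theorem invariantCount_eq (k : ℕ) : invariantCount k = Nat.card (InvariantCoord k) := by
  rw [invariantCount, invariantRank_eq, Cardinal.toNat_natCast]

theorem invariantCount_of_le_one {k : ℕ} (hk : k ≤ 1) : invariantCount k = 0 := by
  have := isEmpty_invariantCoord hk
  rw [invariantCount_eq, Nat.card_of_isEmpty]

/-- The value is 3 + 2(k + 1)^2 - (5k + 8). -/
theorem invariantCount_of_two_le {k : ℕ} (hk : 2 ≤ k) :
    (invariantCount k : ℤ) = 2 * (k : ℤ) ^ 2 - (k : ℤ) - 3 := by
  have h := card_invariantCoord_add k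
  rw [card_groupIndexLE hk, card_freeCoordLE, ← invariantCount_eq] at h
  zify at h
  linear_combination h

theorem pureInvariantCount_of_le_one {k : ℕ} (hk : k ≤ 1) : pureInvariantCount k = 0 := by
  rcases k with _ | k
  · simp [pureInvariantCount, invariantCount_of_le_one]
  · obtain rfl : k = 0 := by omega
    simp [pureInvariantCount, invariantCount_of_le_one]

theorem pureInvariantCount_two : pureInvariantCount 2 = 3 := by
  rw [pureInvariantCount, invariantCount_of_two_le le_rfl, invariantCount_of_le_one le_rfl]
  norm_num

theorem pureInvariantCount_of_two_lt {k : ℕ} (hk : 2 < k) :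
    pureInvariantCount k = 4 * (k : ℤ) - 3 := by
  obtain ⟨k, rfl⟩ : ∃ j, k = j + 1 := ⟨k - 1, by omega⟩
  rw [pureInvariantCount, invariantCount_of_two_le (by omega), invariantCount_of_two_le (by omega)]
  push_cast
  ring

theorem hilbertPolynomial_iff (H : Polynomial ℚ) :
    (∀ᶠ k : ℕ in Filter.atTop, (pureInvariantCount k : ℚ) = H.eval (k : ℚ)) ↔
      H = 4 * Polynomial.X - 3 := by
  have key : ∀ k : ℕ, 2 < k → (pureInvariantCount k : ℚ) =
      (4 * Polynomial.X - 3 : Polynomial ℚ).eval (k : ℚ) := by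
    intro k hk
    rw [pureInvariantCount_of_two_lt hk]
    simp
  constructor
  · intro h
    obtain ⟨N, hN⟩ := Filter.eventually_atTop.mp h
    refine Polynomial.eq_of_infinite_eval_eq _ _ (Set.Infinite.mono
      (s := (fun k : ℕ => (k : ℚ)) '' Set.Ici (max N 3)) ?_ ((Set.Ici_infinite _).image
        (fun _ _ _ _ h => Nat.cast_injective h)))
    rintro _ ⟨k, hk, rfl⟩
    have hk' : max N 3 ≤ k := hk
    exact (hN k (by omega)).symm.trans (key k (by omega))
  · rintro rfl
    exact Filter.eventually_atTop.mpr ⟨3, fun k hk => key k hk⟩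

theorem mk_pureInvariantCount :
    PowerSeries.mk (fun k : ℕ => (pureInvariantCount k : ℚ)) =
      (3 + 3 * PowerSeries.X - 2 * PowerSeries.X ^ 2) * PowerSeries.X ^ 2 *
        ((1 - PowerSeries.X) ^ 2)⁻¹ := by
  rw [PowerSeries.eq_mul_inv_iff_mul_eq (by simp)]
  set h := PowerSeries.mk (fun k : ℕ => (pureInvariantCount k : ℚ)) with hh
  have hc : ∀ n, PowerSeries.coeff n h = (pureInvariantCount n : ℚ) := fun n =>
    PowerSeries.coeff_mk n _
  have h0 : pureInvariantCount 0 = 0 := pureInvariantCount_of_le_one (by norm_num)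
  have h1 : pureInvariantCount 1 = 0 := pureInvariantCount_of_le_one le_rfl
  have e1 : h * (1 - PowerSeries.X) ^ 2 = h - 2 • (h * PowerSeries.X) + h * PowerSeries.X ^ 2 := by
    rw [two_nsmul]; ring
  have e2 : (3 + 3 * PowerSeries.X - 2 * PowerSeries.X ^ 2) * PowerSeries.X ^ 2 =
      (3 • PowerSeries.X ^ 2 + 3 • PowerSeries.X ^ 3 - 2 • PowerSeries.X ^ 4 : PowerSeries ℚ) := by
    simp only [nsmul_eq_mul]; push_cast; ring
  rw [e1, e2]
  ext n
  simp only [map_add, map_sub, map_nsmul, PowerSeries.coeff_X_pow]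
  rcases n with _ | _ | n
  · simp [hc, h0]
  · rw [PowerSeries.coeff_succ_mul_X, PowerSeries.coeff_mul_X_pow', hc, hc]
    simp [h0, h1]
  · rw [PowerSeries.coeff_succ_mul_X, PowerSeries.coeff_mul_X_pow', hc, hc, if_pos (by omega), hc]
    simp only [Nat.reduceSubDiff, Nat.add_sub_cancel]
    -- Coefficients 2, 3 and 4 are 3, 3 and -2. From 5 on, all three values involved follow 4k - 3,
    -- whose second difference is zero.
    rcases n with _ | _ | _ | n
    · simp [h0, h1, pureInvariantCount_two]
    · rw [pureInvariantCount_of_two_lt (k := 0 + 1 + 1 + 1) (by norm_num)]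
      simp [h1, pureInvariantCount_two]
      norm_num
    · rw [pureInvariantCount_of_two_lt (k := 0 + 1 + 1 + 1 + 1) (by norm_num),
        pureInvariantCount_of_two_lt (k := 0 + 1 + 1 + 1) (by norm_num)]
      simp [pureInvariantCount_two]
      norm_num
    · rw [pureInvariantCount_of_two_lt (by omega), pureInvariantCount_of_two_lt (by omega),
        pureInvariantCount_of_two_lt (by omega)]
      simp
      ring

theorem hasSum_pureInvariantCount {z : ℂ} (hz : ‖z‖ < 1) :
    HasSum (fun k : ℕ => (pureInvariantCount k : ℂ) * z ^ k)
      ((3 + 3 * z - 2 * z ^ 2) * z ^ 2 / (1 - z) ^ 2) := by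
  have h1 := ((hasSum_coe_mul_geometric_of_norm_lt_one hz).mul_left 4).sub
    ((hasSum_geometric_of_norm_lt_one hz).mul_left 3)
  -- Corrections at k = 0, 1, 2: the formula 4k - 3 gives -3, 1, 5 there, whereas h_k is 0, 0, 3.
  have h2 := ((hasSum_ite_eq (0 : ℕ) (3 : ℂ)).add (hasSum_ite_eq (1 : ℕ) (-z))).add
    (hasSum_ite_eq (2 : ℕ) (-2 * z ^ 2))
  have hz1 : 1 - z ≠ 0 := by
    intro h
    rw [← sub_eq_zero.mp h] at hz
    simp at hz
  have h3 := h1.add h2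
  have e : 4 * (z / (1 - z) ^ 2) - 3 * (1 - z)⁻¹ + (3 + -z + -2 * z ^ 2) =
      (3 + 3 * z - 2 * z ^ 2) * z ^ 2 / (1 - z) ^ 2 := by
    field_simp
    ring
  rw [e] at h3
  refine Eq.mpr (congrArg (fun f : ℕ → ℂ => HasSum f _) (funext fun k => ?_)) h3
  rcases k with _ | _ | _ | k
  · simp [pureInvariantCount_of_le_one]
  · simp [pureInvariantCount_of_le_one]
    ring
  · simp [pureInvariantCount_two]
    ring
  · rw [pureInvariantCount_of_two_lt (by omega)]
    simp
    ring

end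

end ManakovSantini

theorem mainTheorem6 :
    -- the number of independent invariants of order at most k is finite
    (∀ k : ℕ, ManakovSantini.invariantRank k = (ManakovSantini.invariantCount k : Cardinal)) ∧
    -- the values of s_k
    (∀ k : ℕ, k ≤ 1 → ManakovSantini.invariantCount k = 0) ∧
    (∀ k : ℕ, 2 ≤ k →
      (ManakovSantini.invariantCount k : ℤ) = 2 * (k : ℤ) ^ 2 - (k : ℤ) - 3) ∧
    -- the values of h_k
    (∀ k : ℕ, k ≤ 1 → ManakovSantini.pureInvariantCount k = 0) ∧
    ManakovSantini.pureInvariantCount 2 = 3 ∧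
    (∀ k : ℕ, 2 < k → ManakovSantini.pureInvariantCount k = 4 * (k : ℤ) - 3) ∧
    -- the Hilbert polynomial, i.e. the unique polynomial equal to h_k for all large k
    (∀ H : Polynomial ℚ,
      (∀ᶠ k : ℕ in Filter.atTop,
        (ManakovSantini.pureInvariantCount k : ℚ) = H.eval (k : ℚ)) ↔
      H = 4 * Polynomial.X - 3) ∧
    -- the Poincaré function, as a formal power series
    PowerSeries.mk (fun k : ℕ => (ManakovSantini.pureInvariantCount k : ℚ)) =
      (3 + 3 * PowerSeries.X - 2 * PowerSeries.X ^ 2) * PowerSeries.X ^ 2 *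
        ((1 - PowerSeries.X) ^ 2)⁻¹ ∧
    -- the Poincaré function, as a convergent power series
    (∀ z : ℂ, ‖z‖ < 1 →
      HasSum (fun k : ℕ => (ManakovSantini.pureInvariantCount k : ℂ) * z ^ k)
        ((3 + 3 * z - 2 * z ^ 2) * z ^ 2 / (1 - z) ^ 2)) := by
  refine ⟨fun k => ?_, fun k hk => ManakovSantini.invariantCount_of_le_one hk,
    fun k hk => ManakovSantini.invariantCount_of_two_le hk,
    fun k hk => ManakovSantini.pureInvariantCount_of_le_one hk,
    ManakovSantini.pureInvariantCount_two,
    fun k hk => ManakovSantini.pureInvariantCount_of_two_lt hk,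
    ManakovSantini.hilbertPolynomial_iff, ManakovSantini.mk_pureInvariantCount,
    fun z hz => ManakovSantini.hasSum_pureInvariantCount hz⟩
  rw [ManakovSantini.invariantCount_eq, ManakovSantini.invariantRank_eq]
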